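/- Let $\mathbb K$ be a commutative ring and let $B$ be a finite set with an involution $b\mapsto b^*$ (that is, $b^{**}=b$). **The bialgebra.** For $n\ge 0$ put $B\wr\mathfrak S_n=B^n\times\mathfrak S_n$, with $\pi\cdot(b_1,\dots,b_n;\sigma)=(b_{\pi^{-1}(1)},\dots,b_{\pi^{-1}(n)};\pi\sigma)$ for $\pi\in\mathfrak S_n$. Let $\mathscr F_n(\mathbb KB)$ be the free $\mathbb K$-module with basis $B\wr\mathfrak S_n$, and let $\mathscr F(\mathbb KB)=\bigoplus_{n\ge0}\mathscr F_n(\mathbb KB)$ be the free quasisymmetric graded bialgebra, with product $$(b_1,\dots,b_n;\sigma)*(b'_1,\dots,b'_m;\sigma')=\sum_\rho\rho\cdot(b_1,\dots,b_n,b'_1,\dots,b'_m;\sigma\times\sigma'),$$ where $\rho$ runs over the permutations in $\mathfrak S_{n+m}$ that are increasing on $[1,n]$ and on $[n+1,n+m]$, and with coproduct $$\Delta(b_1,\dots,b_n;\sigma)=\sum_{k=0}^n(b_1,\dots,b_k;\pi_k)\otimes(b_{k+1},\dots,b_n;\pi'_{n-k}),$$ where $\pi_k$ and $\pi'_{n-k}$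 are the inverses of the standardizations of the words $\sigma^{-1}(1)\cdots\sigma^{-1}(k)$ and $\sigma^{-1}(k+1)\cdots\sigma^{-1}(n)$. The unit is the element of $B\wr\mathfrak S_0$, and the counit is the projection onto $\mathscr F_0(\mathbb KB)=\mathbb K$. Let $\varpi_{\mathrm{tot}}$ be the symmetric bilinear form on $\mathscr F(\mathbb KB)$ such that, for basis elements $\alpha,\beta$, $\varpi_{\mathrm{tot}}(\alpha,\beta)=1$ if $\beta=\alpha^*$ and $0$ otherwise, where $(b_1,\dots,b_n;\sigma)^*=\sigma^{-1}\cdot(b_1^*,\dots,b_n^*;e_n)$. The polar of a submodule $S$ is $S^\circ=\{x\mid\varpi_{\mathrm{tot}}(x,y)=0\text{ for all }y\in S\}$. **Tableaux.** A $B$-tableau is a family $\mathbf T=(T_b)_{b\in B}$ of semistandard tableaux with integer labels; its shape $\mathrm{sh}(\mathbf T)$ is the family of the shapes of the $T_b$. It is standard if the labels $1,2,\dots,n$ are used exactly once each and no other label occurs, where $n$ is the total number of boxes. Write $\alpha\in B\wr\mathfrak S_n$ as $\alpha=\sigma\cdot(b_1,\dots,b_n;e_n)$ and put $w(\alpha)=(\sigma(1),b_1)\cdots(\sigma(n),b_n)$.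 The Robinson–Schensted–Okada (RSO) record tableau $\mathbf Q(\alpha)=(Q_b)_{b\in B}$ is obtained as follows: for each $b$, the letters $\sigma(j)$ with $b_j=b$ are inserted in increasing order of $j$ by Schensted row insertion, and $Q_b$ records with the label $j$ the box created when $\sigma(j)$ is inserted. For a standard $B$-tableau $\mathbf T$ with $n$ boxes, put $$t_{\mathbf T}=\sum_{\alpha\in B\wr\mathfrak S_n,\ \mathbf Q(\alpha)=\mathbf T}\alpha ,$$ and let $\mathscr Q(B)$ be the $\mathbb K$-submodule of $\mathscr F(\mathbb KB)$ spanned by the $t_{\mathbf T}$, for all standard $B$-tableaux $\mathbf T$. **Knuth relation.** For $\alpha,\alpha'\in B\wr\mathfrak S_n$ write $\alpha\sim_K\alpha'$ if $w(\alpha')$ is obtained from $w(\alpha)$ either by exchanging two consecutive letters with different second components, or by replacing three consecutive letters with the same second component $b$ and first components $u$ by letters with second component $b$ and first components $u'$, where $\{u,u'\}=\{xzy,zxy\}$ with $x\le y<z$, or $\{u,u'\}=\{yxz,yzx\}$ with $x<y\le z$. **Proposition.** 1. For each $n\ge0$, the module $\mathscr Q(B)^\circ\cap\mathscr F_n(\mathbb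 KB)$ is spanned over $\mathbb K$ by the differences $\alpha-\alpha'$, where $\alpha,\alpha'\in B\wr\mathfrak S_n$ and $\alpha\sim_K\alpha'$. 2. The submodule $\mathscr Q(B)$ is a graded subbialgebra of $(\mathscr F(\mathbb KB),*,\Delta)$: it is graded, contains the unit, is closed under $*$, and $\Delta(\mathscr Q(B))\subseteq\mathscr Q(B)\otimes\mathscr Q(B)$. The submodule $\mathscr Q(B)^\circ$ is a graded biideal: it is graded, is a two-sided ideal for $*$, satisfies $\Delta(\mathscr Q(B)^\circ)\subseteq\mathscr Q(B)^\circ\otimes\mathscr F(\mathbb KB)+\mathscr F(\mathbb KB)\otimes\mathscr Q(B)^\circ$, and the counit vanishes on it. 3. The submodule $\mathscr Q(B)\cap\mathscr Q(B)^\circ$ is spanned over $\mathbb K$ by the differences $t_{\mathbf T}-t_{\mathbf T'}$, where $\mathbf T$ and $\mathbf T'$ are standard $B$-tableaux with $\mathrm{sh}(\mathbf T)=\mathrm{sh}(\mathbf T')$. 4. The submodule $\mathscr Q(B)+\mathscr Q(B)^\circ$ is a direct summand of $\mathscr F(\mathbb KB)$. -/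

import Mathlib

open scoped TensorProduct

namespace FQ

/-! ### The free quasisymmetric bialgebra on a finite basis `B` -/

/-- The set `B ≀ 𝔖ₙ`: the pair `(c, σ)` stands for the element `(c₁, …, cₙ; σ)`, that is, for
`(c₁ ⊗ ⋯ ⊗ cₙ) # σ`. Positions and values are numbered from `0`. -/
abbrev Wr (B : Type*) (n : ℕ) : Type _ := (Fin n → B) × Equiv.Perm (Fin n)

/-- The left action `π · (c; σ) = (c ∘ π⁻¹; π σ)` of the symmetric group. -/
def leftAct {B : Type*} {n : ℕ} (π : Equiv.Perm (Fin n)) (α : Wr B n) : Wr B n :=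
  (fun i => α.1 (π⁻¹ i), π * α.2)

/-- The free module `𝓕(KB) = ⨁ₙ 𝓕ₙ(KB)`, with basis the disjoint union of the sets `B ≀ 𝔖ₙ`. -/
abbrev Free (K : Type*) [CommRing K] (B : Type*) : Type _ := (Σ n : ℕ, Wr B n) →₀ K

/-- The basis element of `𝓕(KB)` attached to `α ∈ B ≀ 𝔖ₙ`. -/
noncomputable def elt (K : Type*) [CommRing K] {B : Type*} {n : ℕ} (α : Wr B n) : Free K B :=
  Finsupp.single ⟨n, α⟩ 1

/-- The homogeneous component `𝓕ₙ(KB)`. -/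
def degreePart (K : Type*) [CommRing K] (B : Type*) (n : ℕ) : Submodule K (Free K B) :=
  Finsupp.supported K K {α | α.1 = n}

/-- The set `X_{(n,m)}` of the permutations that are increasing on the first `n` and on the last `m`
elements. -/
def shuffles (n m : ℕ) : Finset (Equiv.Perm (Fin (n + m))) :=
  {ρ | (∀ i j : Fin n, i < j → ρ (Fin.castAdd m i) < ρ (Fin.castAdd m j)) ∧
    (∀ i j : Fin m, i < j → ρ (Fin.natAdd n i) < ρ (Fin.natAdd n j))}

/-- The permutation `σ × σ'` of `n + m` elements. -/
def permProd {n m : ℕ} (σ : Equiv.Perm (Fin n)) (σ' : Equiv.Perm (Fin m)) :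
    Equiv.Perm (Fin (n + m)) :=
  finSumFinEquiv.permCongr (Equiv.Perm.sumCongr σ σ')

/-- The element `(c₁, …, cₙ, c'₁, …, c'ₘ; σ × σ')` of `B ≀ 𝔖ₙ₊ₘ`. -/
def concat {B : Type*} {n m : ℕ} (α : Wr B n) (β : Wr B m) : Wr B (n + m) :=
  (Fin.append α.1 β.1, permProd α.2 β.2)

/-- The external product: `α * β = ∑_{ρ ∈ X_{(n,m)}} ρ · (c, c'; σ × σ')`, extended bilinearly. -/
noncomputable def extMul (K : Type*) [CommRing K] (B : Type*) :
    Free K B →ₗ[K] Free K B →ₗ[K] Free K B :=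
  Finsupp.linearCombination K fun α =>
    Finsupp.linearCombination K fun β =>
      ∑ ρ ∈ shuffles α.1 β.1, elt K (leftAct ρ (concat α.2 β.2))

/-- The unit of the external product, the only element of `B ≀ 𝔖₀`. -/
noncomputable def one (K : Type*) [CommRing K] (B : Type*) : Free K B :=
  elt K ((Fin.elim0, 1) : Wr B 0)

/-- The standardization of a word. The permutation `Tuple.sort w` lists the positions of the letters
of `w` in weakly increasing order of letters, equal letters being listed from left to right; the
standardization is its inverse. -/
def standardization {A : Type*} [LinearOrder A] {n : ℕ} (w : Fin n → A) : Equiv.Perm (Fin n) :=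
  (Tuple.sort w)⁻¹

/-- `(c₁, …, c_k; π)`, where `π` is the inverse of the standardization of `σ⁻¹(1) ⋯ σ⁻¹(k)`. -/
def headPart {B : Type*} {n : ℕ} (α : Wr B n) (k : Fin (n + 1)) : Wr B (k : ℕ) :=
  (fun i => α.1 ⟨i, by omega⟩,
    (standardization fun i : Fin (k : ℕ) => α.2⁻¹ ⟨i, by omega⟩)⁻¹)

/-- `(c_{k+1}, …, cₙ; π')`, where `π'` is the inverse of the standardization of
`σ⁻¹(k+1) ⋯ σ⁻¹(n)`. -/
def tailPart {B : Type*} {n : ℕ} (α : Wr B n) (k : Fin (n + 1)) : Wr B (n - k) :=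
  (fun i => α.1 ⟨k + i, by omega⟩,
    (standardization fun i : Fin (n - k) => α.2⁻¹ ⟨k + i, by omega⟩)⁻¹)

/-- The coproduct. -/
noncomputable def comul (K : Type*) [CommRing K] (B : Type*) :
    Free K B →ₗ[K] Free K B ⊗[K] Free K B :=
  Finsupp.linearCombination K fun α =>
    ∑ k : Fin (α.1 + 1), elt K (headPart α.2 k) ⊗ₜ[K] elt K (tailPart α.2 k)

/-- The counit: the projection onto `𝓕₀(KB) = K`. -/
noncomputable def counit (K : Type*) [CommRing K] (B : Type*) : Free K B →ₗ[K] K :=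
  Finsupp.lapply ⟨0, (Fin.elim0, 1)⟩

/-- A submodule is graded if it is the sum of its homogeneous components. -/
def IsGraded {K : Type*} [CommRing K] {B : Type*} (S : Submodule K (Free K B)) : Prop :=
  S = ⨆ n, S ⊓ degreePart K B n

/-- Graded subbialgebras of `(𝓕(KB), *, Δ)`: graded submodules `S` that contain the unit, are closed
under the product, and satisfy `Δ(S) ⊆ S ⊗ S` (image in `𝓕(KB) ⊗ 𝓕(KB)`). -/
structure IsGradedSubbialgebra {K : Type*} [CommRing K] {B : Type*}
    (S : Submodule K (Free K B)) : Prop where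
  graded : IsGraded S
  one_mem : one K B ∈ S
  mul_mem : ∀ x ∈ S, ∀ y ∈ S, extMul K B x y ∈ S
  comul_mem : ∀ x ∈ S, comul K B x ∈ LinearMap.range (TensorProduct.map S.subtype S.subtype)

/-- Graded biideals of `(𝓕(KB), *, Δ)`: graded submodules `I` that are two-sided ideals for the
product, satisfy `Δ(I) ⊆ I ⊗ 𝓕(KB) + 𝓕(KB) ⊗ I`, and on which the counit vanishes. -/
structure IsGradedBiideal {K : Type*} [CommRing K] {B : Type*}
    (I : Submodule K (Free K B)) : Prop where
  graded : IsGraded I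
  mul_mem_left : ∀ x, ∀ y ∈ I, extMul K B x y ∈ I
  mul_mem_right : ∀ x ∈ I, ∀ y, extMul K B x y ∈ I
  comul_mem : ∀ x ∈ I, comul K B x ∈
    LinearMap.range (TensorProduct.map I.subtype (LinearMap.id : Free K B →ₗ[K] Free K B)) ⊔
    LinearMap.range (TensorProduct.map (LinearMap.id : Free K B →ₗ[K] Free K B) I.subtype)
  counit_eq_zero : ∀ x ∈ I, counit K B x = 0

/-! ### The pairing and polars -/

/-- The dual `α* = σ⁻¹ · (c₁*, …, cₙ*; e)` of `α = (c₁, …, cₙ; σ)`. -/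
def dual {B : Type*} (inv : B → B) {n : ℕ} (α : Wr B n) : Wr B n :=
  leftAct α.2⁻¹ (fun i => inv (α.1 i), 1)

/-- The pairing on `𝓕(KB)` induced by the pairing `ϖ` of `KB` with `ϖ(b, b') = 1` if `b' = b*` and
`0` otherwise: components of different degrees are orthogonal, and the pairing of `(c; σ)` with
`(c'; σ')` is `∏ᵢ ϖ(c_{σ(i)}, c'ᵢ)` if `σ' = σ⁻¹` and `0` otherwise; in other words it is `1` if
`(c'; σ')` is the dual of `(c; σ)`, and `0` otherwise. -/
noncomputable def pairing (K : Type*) [CommRing K] {B : Type*} (inv : B → B) :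
    Free K B →ₗ[K] Free K B →ₗ[K] K :=
  Finsupp.linearCombination K fun α => Finsupp.lapply ⟨α.1, dual inv α.2⟩

/-- The polar of a submodule with respect to the pairing. -/
def polar {K : Type*} [CommRing K] {B : Type*} (inv : B → B) (S : Submodule K (Free K B)) :
    Submodule K (Free K B) where
  carrier := {x | ∀ y ∈ S, pairing K inv x y = 0}
  zero_mem' := fun y _ => by simp
  add_mem' := fun hx hx' y hy => by simp [hx y hy, hx' y hy]
  smul_mem' := fun a x hx y hy => by simp [hx y hy]

/-! ### Words and Knuth relations -/

/-- The word `w(α) = (σ(1), b₁) ⋯ (σ(n), bₙ)`, where `α = σ · (b₁, …, bₙ; e)`, that is,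
`bᵢ = c_{σ(i)}`. -/
def word {B : Type*} {n : ℕ} (α : Wr B n) : List (ℕ × B) :=
  List.ofFn fun i : Fin n => ((α.2 i : ℕ) + 1, α.1 (α.2 i))

/-- The Knuth relation on words with letters in `ℕ × B`: either exchange two consecutive letters
with different second components, or apply one of the usual relations `acb ∼ cab` for `a ≤ b < c` and
`bac ∼ bca` for `a < b ≤ c` to three consecutive letters with the same second component. -/
inductive Knuth {B : Type*} : List (ℕ × B) → List (ℕ × B) → Prop
  | exchange (u v : List (ℕ × B)) (x y : ℕ × B) (h : x.2 ≠ y.2) :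
      Knuth (u ++ [x, y] ++ v) (u ++ [y, x] ++ v)
  | acb_cab (u v : List (ℕ × B)) (a b c : ℕ) (β : B) (hab : a ≤ b) (hbc : b < c) :
      Knuth (u ++ [(a, β), (c, β), (b, β)] ++ v) (u ++ [(c, β), (a, β), (b, β)] ++ v)
  | cab_acb (u v : List (ℕ × B)) (a b c : ℕ) (β : B) (hab : a ≤ b) (hbc : b < c) :
      Knuth (u ++ [(c, β), (a, β), (b, β)] ++ v) (u ++ [(a, β), (c, β), (b, β)] ++ v)
  | bac_bca (u v : List (ℕ × B)) (a b c : ℕ) (β : B) (hab : a < b) (hbc : b ≤ c) :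
      Knuth (u ++ [(b, β), (a, β), (c, β)] ++ v) (u ++ [(b, β), (c, β), (a, β)] ++ v)
  | bca_bac (u v : List (ℕ × B)) (a b c : ℕ) (β : B) (hab : a < b) (hbc : b ≤ c) :
      Knuth (u ++ [(b, β), (c, β), (a, β)] ++ v) (u ++ [(b, β), (a, β), (c, β)] ++ v)

/-! ### The Robinson-Schensted-Okada correspondence -/

/-- Row insertion of the letter `a`: it replaces the first entry that is greater than `a`, and this
entry is bumped; if there is no such entry, then `a` is put at the end of the row. -/
def rowInsert (a : ℕ) : List ℕ → List ℕ × Option ℕ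
  | [] => ([a], none)
  | x :: r => if a < x then (a :: r, some x) else (x :: (rowInsert a r).1, (rowInsert a r).2)

/-- A step of the Robinson-Schensted correspondence. A pair `(P, Q)` of tableaux of the same shape is
given as the list of the pairs (row of `P`, row of `Q`). The letter `a` is inserted in `P` by bumping
from row to row, and the label `j` is put in the new box of `Q`. -/
def insertStep (j : ℕ) : ℕ → List (List ℕ × List ℕ) → List (List ℕ × List ℕ)
  | a, [] => [([a], [j])]
  | a, (p, q) :: t =>
    match rowInsert a p with
    | (p', none) => (p', q ++ [j]) :: t
    | (p', some c) => (p', q) :: insertStep j c t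

/-- The pair `(P, Q)` attached to a word in two lines, a list of pairs (label, letter). -/
def robinsonSchensted (w : List (ℕ × ℕ)) : List (List ℕ × List ℕ) :=
  w.foldl (fun t x => insertStep x.1 x.2 t) []

/-- The component of index `b` of the RSO correspondent of `α`: the subword of `w(α)` formed by the
letters of colour `b` is inserted, the labels being the positions (from `1` to `n`) of these letters
in `w(α)`. -/
def rso {B : Type*} [DecidableEq B] {n : ℕ} (α : Wr B n) (b : B) : List (List ℕ × List ℕ) :=
  robinsonSchensted
    (((List.finRange n).filter fun i : Fin n => α.1 (α.2 i) = b).map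
      fun i : Fin n => ((i : ℕ) + 1, (α.2 i : ℕ) + 1))

/-- The rows of the component of index `b` of the insertion tableau `𝐏(α)`. -/
def insertionRows {B : Type*} [DecidableEq B] {n : ℕ} (α : Wr B n) (b : B) : List (List ℕ) :=
  (rso α b).map Prod.fst

/-- The rows of the component of index `b` of the record tableau `𝐐(α)`. -/
def recordRows {B : Type*} [DecidableEq B] {n : ℕ} (α : Wr B n) (b : B) : List (List ℕ) :=
  (rso α b).map Prod.snd

/-! ### Tableaux -/

/-- A semistandard tableau with its shape. -/
abbrev Tableau : Type := Σ μ : YoungDiagram, SemistandardYoungTableau μ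

/-- The list of the rows of a tableau. -/
def Tableau.rows (T : Tableau) : List (List ℕ) :=
  (List.range (T.1.colLen 0)).map fun i => (List.range (T.1.rowLen i)).map fun j => T.2 i j

/-- The weight of a tableau: the multiset of its labels. -/
def Tableau.weight (T : Tableau) : Multiset ℕ :=
  T.1.cells.val.map fun c => T.2 c.1 c.2

/-- A `B`-tableau is a family of tableaux indexed by `B`. -/
abbrev BTableau (B : Type*) : Type _ := B → Tableau

/-- The shape of a `B`-tableau. -/
def BTableau.shape {B : Type*} (T : BTableau B) : B → YoungDiagram := fun b => (T b).1

/-- The total number of boxes of a `B`-tableau. -/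
def BTableau.size {B : Type*} [Fintype B] (T : BTableau B) : ℕ := ∑ b, (T.shape b).card

/-- A `B`-tableau with `n` boxes is standard if each of the labels `1, …, n` is used exactly once. -/
def BTableau.IsStandard {B : Type*} [Fintype B] (T : BTableau B) : Prop :=
  ∑ b, (T b).weight = (Finset.Icc 1 T.size).val

/-! ### Coplactic classes -/

/-- The coplactic class `t_𝐓`: the sum of the elements `α` of `B ≀ 𝔖ₙ` with `𝐐(α) = 𝐓`, where `n` is
the number of boxes of `𝐓`. -/
noncomputable def coplacticClass (K : Type*) [CommRing K] {B : Type*} [Fintype B] [DecidableEq B]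
    (T : BTableau B) : Free K B :=
  ∑ α : Wr B T.size with ∀ b, recordRows α b = (T b).rows, elt K α

/-- The submodule `𝓠(B)` spanned by the coplactic classes of the standard `B`-tableaux. -/
noncomputable def coplactic (K : Type*) [CommRing K] (B : Type*) [Fintype B] [DecidableEq B] :
    Submodule K (Free K B) :=
  Submodule.span K {x | ∃ T : BTableau B, T.IsStandard ∧ x = coplacticClass K T}

end FQ

namespace FQ

/-! ### Row insertion -/

/-! The RSO correspondence $\alpha\mapsto(\mathbf P(\alpha),\mathbf Q(\alpha))$ identifies the basis
with the pairs of standard $B$-tableaux of equal shape (`isPairing_keys`). Hence $\mathscr Q(B)$ is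
the module of elements whose coefficients are constant on the fibers of $\mathbf Q$
(`mem_coplactic_iff`). By Schützenberger's symmetry (`robinsonSchensted_inverse`),
$\alpha\mapsto\alpha^*$ exchanges $\mathbf P$ and $\mathbf Q$, up to the involution of the colours.
The polar is therefore the kernel of the pushforward along $\mathbf P$ (`polar_coplactic`): the sum
of the coefficients over each fiber of $\mathbf P$ vanishes.

Such a kernel is spanned by differences of elements of one fiber. By Knuth's theorem the fibers of
$\mathbf P$ are the classes generated by the coloured Knuth relation: insertion is invariant
(`Knuth.tabInsertWord_colourPart`), and a word can be brought to the reading words of its tableaux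
(`knuthEquiv_of_tabInsertWord_eq`). This gives statement 1.

On words, a term of the product is a concatenation after increasing relabellings, and a term of the
coproduct is a pair of restrictions to intervals of values. Both operations respect the Knuth
relation, so the polar is a biideal. The pairing makes product and coproduct adjoint
(`pairing_extMul`), so the biideal property dualizes: the coideal condition makes $\mathscr Q(B)$
closed under products, and the ideal condition makes it closed under coproducts.

Statements 3 and 4 are linear algebra for a set of pairs of equal shape (`IsPairing`). If $J$ sends
a tableau to its fiber sum for $\mathbf Q$ and $M$ is the pushforward along $\mathbf P$, then
$(MJy)(k)$ is the total of $y$ over the tableaux of the shape of $k$. So $Jy\in\ker M$ exactly when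
all these totals vanish. Choosing a tableau in each shape yields an idempotent with kernel
$\operatorname{im}J+\ker M$, over any commutative ring. -/

theorem rowInsert_cons_lt {a x : ℕ} (h : a < x) (r : List ℕ) :
    rowInsert a (x :: r) = (a :: r, some x) := by simp [rowInsert, h]

theorem rowInsert_cons_le {a x : ℕ} (h : x ≤ a) (r : List ℕ) :
    rowInsert a (x :: r) = (x :: (rowInsert a r).1, (rowInsert a r).2) := by
  simp [rowInsert, not_lt.2 h]

theorem rowInsert_eq_none_iff {a : ℕ} {p : List ℕ} :
    (rowInsert a p).2 = none ↔ ∀ x ∈ p, x ≤ a := by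
  induction p with
  | nil => simp [rowInsert]
  | cons x r ih =>
    rcases lt_or_ge a x with h | h
    · simp [rowInsert_cons_lt h, h]
    · simp [rowInsert_cons_le h, ih, h]

theorem rowInsert_of_le {a : ℕ} {p : List ℕ} (h : ∀ x ∈ p, x ≤ a) :
    rowInsert a p = (p ++ [a], none) := by
  induction p with
  | nil => rfl
  | cons x r ih =>
    rw [rowInsert_cons_le (h x (by simp)), ih fun y hy => h y (by simp [hy])]
    rfl

theorem rowInsert_of_eq_none {a : ℕ} {p : List ℕ} (h : (rowInsert a p).2 = none) :
    (rowInsert a p).1 = p ++ [a] := by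
  rw [rowInsert_of_le (rowInsert_eq_none_iff.1 h)]

theorem mem_rowInsert_self (a : ℕ) (p : List ℕ) : a ∈ (rowInsert a p).1 := by
  induction p with
  | nil => simp [rowInsert]
  | cons x r ih =>
    rcases lt_or_ge a x with h | h
    · simp [rowInsert_cons_lt h]
    · simp [rowInsert_cons_le h, ih]

theorem lt_of_rowInsert_eq_some {a c : ℕ} {p : List ℕ} (h : (rowInsert a p).2 = some c) :
    a < c := by
  induction p with
  | nil => simp [rowInsert] at h
  | cons x r ih =>
    rcases lt_or_ge a x with h' | h'
    · simp [rowInsert_cons_lt h'] at h; omega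
    · rw [rowInsert_cons_le h'] at h; exact ih h

theorem rowInsert_perm (a : ℕ) (p : List ℕ) :
    ((rowInsert a p).1 ++ (rowInsert a p).2.toList).Perm (a :: p) := by
  induction p with
  | nil => simp [rowInsert]
  | cons x r ih =>
    rcases lt_or_ge a x with h | h
    · simp only [rowInsert_cons_lt h, Option.toList_some, List.cons_append]
      exact List.Perm.cons _ (List.perm_append_singleton x r)
    · rw [rowInsert_cons_le h]
      exact (List.Perm.cons x ih).trans (List.Perm.swap _ _ _)

theorem mem_of_rowInsert_eq_some {a c : ℕ} {p : List ℕ} (h : (rowInsert a p).2 = some c) :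
    c ∈ p := by
  induction p with
  | nil => simp [rowInsert] at h
  | cons x r ih =>
    rcases lt_or_ge a x with h' | h'
    · simp [rowInsert_cons_lt h'] at h; simp [h]
    · rw [rowInsert_cons_le h'] at h; exact List.mem_cons_of_mem _ (ih h)

theorem mem_rowInsert {a x : ℕ} {p : List ℕ} (h : x ∈ (rowInsert a p).1) : x = a ∨ x ∈ p := by
  have := (rowInsert_perm a p).mem_iff (a := x)
  simp only [List.mem_append, List.mem_cons] at this
  exact this.1 (Or.inl h)

theorem length_rowInsert {a c : ℕ} {p : List ℕ} (h : (rowInsert a p).2 = some c) :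
    (rowInsert a p).1.length = p.length := by
  have := (rowInsert_perm a p).length_eq
  simp [h] at this
  omega

theorem rowInsert_append_of_eq_some {a c : ℕ} {p : List ℕ} (h : (rowInsert a p).2 = some c)
    (n : List ℕ) : rowInsert a (p ++ n) = ((rowInsert a p).1 ++ n, some c) := by
  induction p with
  | nil => simp [rowInsert] at h
  | cons x r ih =>
    rcases lt_or_ge a x with h' | h'
    · simp [rowInsert_cons_lt h'] at h ⊢; exact h
    · rw [rowInsert_cons_le h'] at h ⊢
      rw [List.cons_append, rowInsert_cons_le h', ih h]; rfl

theorem rowInsert_append_of_lt {a n : ℕ} {p : List ℕ} (h : (rowInsert a p).2 = none)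
    (hn : a < n) : rowInsert a (p ++ [n]) = (p ++ [a], some n) := by
  induction p with
  | nil => simp [rowInsert, hn]
  | cons x r ih =>
    rcases lt_or_ge a x with h' | h'
    · simp [rowInsert_cons_lt h'] at h
    · rw [rowInsert_cons_le h'] at h
      rw [List.cons_append, rowInsert_cons_le h', ih h]; rfl

theorem pairwise_rowInsert {a : ℕ} {p : List ℕ} (h : p.Pairwise (· ≤ ·)) :
    (rowInsert a p).1.Pairwise (· ≤ ·) := by
  induction p with
  | nil => simp [rowInsert]
  | cons x r ih =>
    rw [List.pairwise_cons] at h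
    rcases lt_or_ge a x with h' | h'
    · rw [rowInsert_cons_lt h', List.pairwise_cons]
      exact ⟨fun y hy => h'.le.trans (h.1 y hy), h.2⟩
    · rw [rowInsert_cons_le h', List.pairwise_cons]
      refine ⟨fun y hy => ?_, ih h.2⟩
      rcases mem_rowInsert hy with rfl | hy
      exacts [h', h.1 y hy]

/-- Given a row `p` that contains an entry smaller than `c`, row insertion can be reverted so that
`c` is the bumped letter. -/
theorem exists_rowInsert_eq {c : ℕ} {p : List ℕ} (hp : p.Pairwise (· ≤ ·))
    (hc : ∃ x ∈ p, x < c) :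
    ∃ a p₀, p₀.Pairwise (· ≤ ·) ∧ rowInsert a p₀ = (p, some c) := by
  induction p with
  | nil => simp at hc
  | cons x r ih =>
    rw [List.pairwise_cons] at hp
    -- The letter to recover is the last entry of `p` smaller than `c`; `c` takes its place back.
    by_cases h : ∃ y ∈ r, y < c
    · obtain ⟨a, r₀, hr₀, h₀⟩ := ih hp.2 h
      have ha : x ≤ a := hp.1 a (by simpa [h₀] using mem_rowInsert_self a r₀)
      refine ⟨a, x :: r₀, List.pairwise_cons.2 ⟨fun y hy => ?_, hr₀⟩, ?_⟩
      · have := (rowInsert_perm a r₀).mem_iff (a := y)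
        simp only [h₀, Option.toList_some, List.mem_append, List.mem_cons, hy, or_true,
          List.not_mem_nil, or_false, iff_true] at this
        obtain ⟨z, hz, hzc⟩ := h
        rcases this with h | rfl
        exacts [hp.1 y h, (hp.1 z hz).trans hzc.le]
      · rw [rowInsert_cons_le ha, h₀]
    · push Not at h
      have hx : x < c := by
        obtain ⟨y, hy, hyc⟩ := hc
        rcases List.mem_cons.1 hy with rfl | hy
        exacts [hyc, absurd hyc (not_lt.2 (h y hy))]
      exact ⟨x, c :: r, List.pairwise_cons.2 ⟨h, hp.2⟩, rowInsert_cons_lt hx r⟩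

/-- In the new row, the inserted letter is the last entry smaller than the bumped letter `c`, so its
position can be read off. -/
theorem rowInsert_injective {a a' c : ℕ} {p p₀ p₀' : List ℕ} (h₀ : p₀.Pairwise (· ≤ ·))
    (h₀' : p₀'.Pairwise (· ≤ ·)) (h : rowInsert a p₀ = (p, some c))
    (h' : rowInsert a' p₀' = (p, some c)) : a = a' ∧ p₀ = p₀' := by
  induction p₀ generalizing p₀' p with
  | nil => simp [rowInsert] at h
  | cons x r ih =>
    cases p₀' with
    | nil => simp [rowInsert] at h'
    | cons x' r' =>
      rw [List.pairwise_cons] at h₀ h₀'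
      rcases lt_or_ge a x with hx | hx <;> rcases lt_or_ge a' x' with hx' | hx'
      · rw [rowInsert_cons_lt hx] at h
        rw [rowInsert_cons_lt hx'] at h'
        grind
      · rw [rowInsert_cons_lt hx] at h
        rw [rowInsert_cons_le hx'] at h'
        have h1 := mem_rowInsert_self a' r'
        have h2 : a' < c := lt_of_rowInsert_eq_some (p := r') (by grind)
        have h3 := h₀.1 a' (by grind)
        grind
      · rw [rowInsert_cons_le hx] at h
        rw [rowInsert_cons_lt hx'] at h'
        have h1 := mem_rowInsert_self a r
        have h2 : a < c := lt_of_rowInsert_eq_some (p := r) (by grind)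
        have h3 := h₀'.1 a (by grind)
        grind
      · rw [rowInsert_cons_le hx] at h
        rw [rowInsert_cons_le hx'] at h'
        obtain ⟨rfl, rfl⟩ : a = a' ∧ r = r' :=
          ih (p := (rowInsert a r).1) h₀.2 h₀'.2 (by grind) (by grind)
        grind

/-! ### Tableaux as lists of rows -/

/-- The row `q` can be placed under the row `p` in a tableau. -/
def Dominates : List ℕ → List ℕ → Prop
  | _, [] => True
  | [], _ :: _ => False
  | x :: p, y :: q => x < y ∧ Dominates p q

@[simp] theorem dominates_nil (p : List ℕ) : Dominates p [] := by cases p <;> trivial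

@[simp] theorem not_nil_dominates_cons (y : ℕ) (q : List ℕ) : ¬ Dominates [] (y :: q) := id

@[simp] theorem cons_dominates_cons {x y : ℕ} {p q : List ℕ} :
    Dominates (x :: p) (y :: q) ↔ x < y ∧ Dominates p q := Iff.rfl

theorem Dominates.exists_lt {p q : List ℕ} (h : Dominates p q) {y : ℕ} (hy : y ∈ q) :
    ∃ x ∈ p, x < y := by
  induction q generalizing p with
  | nil => simp at hy
  | cons z q ih =>
    cases p with
    | nil => exact h.elim
    | cons x p =>
      rcases List.mem_cons.1 hy with rfl | hy
      · exact ⟨x, by simp, h.1⟩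
      · obtain ⟨w, hw, hwy⟩ := ih h.2 hy
        exact ⟨w, by simp [hw], hwy⟩

theorem Dominates.of_append {p q r : List ℕ} (h : Dominates p (q ++ r)) : Dominates p q := by
  induction q generalizing p with
  | nil => simp
  | cons y q ih =>
    cases p with
    | nil => exact h.elim
    | cons x p => exact ⟨h.1, ih h.2⟩

theorem Dominates.of_append_left {p q : List ℕ} {j : ℕ} (h : Dominates (p ++ [j]) q)
    (hj : ∀ y ∈ q, y ≤ j) : Dominates p q := by
  induction q generalizing p with
  | nil => simp
  | cons y q ih =>
    cases p with
    | nil => exact absurd h.1 (not_lt.2 (hj y (by simp)))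
    | cons x p => exact ⟨h.1, ih h.2 fun z hz => hj z (by simp [hz])⟩

theorem Dominates.append_left {p q : List ℕ} (h : Dominates p q) (r : List ℕ) :
    Dominates (p ++ r) q := by
  induction q generalizing p with
  | nil => simp
  | cons y q ih =>
    cases p with
    | nil => exact h.elim
    | cons x p => exact ⟨h.1, ih h.2⟩

theorem Dominates.rowInsert_left {p q : List ℕ} (h : Dominates p q) (a : ℕ) :
    Dominates (rowInsert a p).1 q := by
  induction q generalizing p with
  | nil => simp
  | cons y q ih =>
    cases p with
    | nil => exact h.elim
    | cons x p =>
      rcases lt_or_ge a x with hx | hx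
      · rw [rowInsert_cons_lt hx]; exact ⟨hx.trans h.1, h.2⟩
      · rw [rowInsert_cons_le hx]; exact ⟨h.1, ih h.2⟩

/-- Bumping moves weakly to the left: the entry of `q` below the bumped `c`, if any, exceeds `c`, so
`c` enters `q` in the same column or earlier, under an entry that is now smaller than `c`. -/
theorem Dominates.rowInsert {p q : List ℕ} {a c : ℕ} (h : Dominates p q)
    (hc : (FQ.rowInsert a p).2 = some c) :
    Dominates (FQ.rowInsert a p).1 (FQ.rowInsert c q).1 := by
  induction p generalizing q with
  | nil => simp [FQ.rowInsert] at hc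
  | cons x r ih =>
    rcases lt_or_ge a x with hx | hx
    · rw [rowInsert_cons_lt hx] at hc ⊢
      obtain rfl : x = c := by simpa using hc
      cases q with
      | nil => simpa [FQ.rowInsert] using hx
      | cons y s => rw [rowInsert_cons_lt h.1]; exact ⟨hx, h.2⟩
    · rw [rowInsert_cons_le hx] at hc ⊢
      have hac := lt_of_rowInsert_eq_some hc
      cases q with
      | nil => exact ⟨hx.trans_lt hac, by simp⟩
      | cons y s =>
        rcases lt_or_ge c y with hy | hy
        · rw [rowInsert_cons_lt hy]; exact ⟨hx.trans_lt hac, h.2.rowInsert_left a⟩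
        · rw [rowInsert_cons_le hy]; exact ⟨h.1, ih h.2 hc⟩

theorem Dominates.of_rowInsert_left {p q : List ℕ} {a c : ℕ}
    (h : Dominates (FQ.rowInsert a p).1 q) (hc : (FQ.rowInsert a p).2 = some c)
    (hq : ∀ y ∈ q, c < y) : Dominates p q := by
  induction p generalizing q with
  | nil => simp [FQ.rowInsert] at hc
  | cons x r ih =>
    cases q with
    | nil => simp
    | cons y s =>
      rcases lt_or_ge a x with hx | hx
      · rw [rowInsert_cons_lt hx] at hc h
        obtain rfl : x = c := by simpa using hc
        exact ⟨hq y (by simp), h.2⟩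
      · rw [rowInsert_cons_le hx] at hc h
        exact ⟨h.1, ih h.2 hc fun z hz => hq z (by simp [hz])⟩

/-- Needed to revert insertions. If `c` is bumped from the head of `p`, it cannot enter `q` farther
right: it would lie under an entry that is at least `c`. -/
theorem Dominates.of_rowInsert {p q : List ℕ} {a c : ℕ}
    (h : Dominates (FQ.rowInsert a p).1 (FQ.rowInsert c q).1)
    (hc : (FQ.rowInsert a p).2 = some c) (hp : p.Pairwise (· ≤ ·)) (hq : q.Pairwise (· ≤ ·)) :
    Dominates p q := by
  induction p generalizing q with
  | nil => simp [FQ.rowInsert] at hc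
  | cons x r ih =>
    cases q with
    | nil => simp
    | cons y s =>
      rw [List.pairwise_cons] at hp hq
      rcases lt_or_ge a x with hx | hx
      · rw [rowInsert_cons_lt hx] at hc h
        obtain rfl : x = c := by simpa using hc
        rcases lt_or_ge x y with hy | hy
        · rw [rowInsert_cons_lt hy] at h; exact ⟨hy, h.2⟩
        · rw [rowInsert_cons_le hy] at h
          obtain ⟨z, hz, hzx⟩ := h.2.exists_lt (mem_rowInsert_self x s)
          exact absurd hzx (not_lt.2 (hp.1 z hz))
      · rw [rowInsert_cons_le hx] at hc h
        rcases lt_or_ge c y with hy | hy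
        · rw [rowInsert_cons_lt hy] at h
          exact ⟨h.1.trans hy, h.2.of_rowInsert_left hc fun z hz => hy.trans_le (hq.1 z hz)⟩
        · rw [rowInsert_cons_le hy] at h
          exact ⟨h.1, ih h.2 hc hp.2 hq.2⟩

/-- A list of rows is that of a semistandard tableau. -/
def IsTableau : List (List ℕ) → Prop
  | [] => True
  | p :: t => p ≠ [] ∧ p.Pairwise (· ≤ ·) ∧ Dominates p (t.headD []) ∧ IsTableau t

@[simp] theorem isTableau_nil : IsTableau [] := trivial

theorem isTableau_cons {p : List ℕ} {t : List (List ℕ)} : IsTableau (p :: t) ↔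
    p ≠ [] ∧ p.Pairwise (· ≤ ·) ∧ Dominates p (t.headD []) ∧ IsTableau t := Iff.rfl

/-- Insertion of a letter in a tableau, without record. -/
def tabInsert : ℕ → List (List ℕ) → List (List ℕ)
  | a, [] => [[a]]
  | a, p :: t =>
    match rowInsert a p with
    | (p', none) => p' :: t
    | (p', some c) => p' :: tabInsert c t

theorem tabInsert_of_none {a : ℕ} {p : List ℕ} (h : (rowInsert a p).2 = none)
    (t : List (List ℕ)) : tabInsert a (p :: t) = (p ++ [a]) :: t := by
  rw [tabInsert, rowInsert_of_le (rowInsert_eq_none_iff.1 h)]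

theorem tabInsert_of_some {a c : ℕ} {p : List ℕ} (h : (rowInsert a p).2 = some c)
    (t : List (List ℕ)) : tabInsert a (p :: t) = (rowInsert a p).1 :: tabInsert c t := by
  have : rowInsert a p = ((rowInsert a p).1, some c) := by rw [← h]
  rw [tabInsert, this]

theorem headD_tabInsert (a : ℕ) (t : List (List ℕ)) :
    (tabInsert a t).headD [] = (rowInsert a (t.headD [])).1 := by
  cases t with
  | nil => rfl
  | cons p t =>
    cases h : (rowInsert a p).2 with
    | none => simp [tabInsert_of_none h, rowInsert_of_eq_none h]
    | some c => simp [tabInsert_of_some h]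

theorem rowInsert_ne_nil (a : ℕ) (p : List ℕ) : (rowInsert a p).1 ≠ [] :=
  List.ne_nil_of_mem (mem_rowInsert_self a p)

theorem IsTableau.tabInsert {t : List (List ℕ)} (h : IsTableau t) (a : ℕ) :
    IsTableau (tabInsert a t) := by
  induction t generalizing a with
  | nil => simp [FQ.tabInsert, isTableau_cons]
  | cons p t ih =>
    obtain ⟨h1, h2, h3, h4⟩ := h
    have h5 := pairwise_rowInsert (a := a) h2
    cases hc : (rowInsert a p).2 with
    | none =>
      rw [tabInsert_of_none hc, isTableau_cons]
      rw [rowInsert_of_eq_none hc] at h5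
      exact ⟨by simp, h5, h3.append_left _, h4⟩
    | some c =>
      rw [tabInsert_of_some hc, isTableau_cons, headD_tabInsert]
      exact ⟨rowInsert_ne_nil a p, h5, h3.rowInsert hc, ih h4 c⟩

/-! ### The Robinson-Schensted correspondence on pairs of tableaux -/

theorem insertStep_of_none {a : ℕ} {p : List ℕ} (h : (rowInsert a p).2 = none) (j : ℕ)
    (q : List ℕ) (t : List (List ℕ × List ℕ)) :
    insertStep j a ((p, q) :: t) = (p ++ [a], q ++ [j]) :: t := by
  rw [insertStep, rowInsert_of_le (rowInsert_eq_none_iff.1 h)]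

theorem insertStep_of_some {a c : ℕ} {p : List ℕ} (h : (rowInsert a p).2 = some c) (j : ℕ)
    (q : List ℕ) (t : List (List ℕ × List ℕ)) :
    insertStep j a ((p, q) :: t) = ((rowInsert a p).1, q) :: insertStep j c t := by
  have : rowInsert a p = ((rowInsert a p).1, some c) := by rw [← h]
  rw [insertStep, this]

theorem map_fst_insertStep (j a : ℕ) (t : List (List ℕ × List ℕ)) :
    (insertStep j a t).map Prod.fst = tabInsert a (t.map Prod.fst) := by
  induction t generalizing a with
  | nil => rfl
  | cons pq t ih =>
    obtain ⟨p, q⟩ := pq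
    cases h : (rowInsert a p).2 with
    | none => simp [insertStep_of_none h, tabInsert_of_none h]
    | some c => simp [insertStep_of_some h, tabInsert_of_some h, ih]

/-- The entries of the first components of a list of pairs of rows. -/
def letters (t : List (List ℕ × List ℕ)) : List ℕ := (t.map Prod.fst).flatten

/-- The entries of the second components of a list of pairs of rows. -/
def labels (t : List (List ℕ × List ℕ)) : List ℕ := (t.map Prod.snd).flatten

@[simp] theorem letters_cons (p q : List ℕ) (t : List (List ℕ × List ℕ)) :
    letters ((p, q) :: t) = p ++ letters t := rfl
@[simp] theorem labels_cons (p q : List ℕ) (t : List (List ℕ × List ℕ)) :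
    labels ((p, q) :: t) = q ++ labels t := rfl

theorem letters_insertStep (j a : ℕ) (t : List (List ℕ × List ℕ)) :
    (letters (insertStep j a t)).Perm (a :: letters t) := by
  induction t generalizing a with
  | nil => simp [insertStep]
  | cons pq t ih =>
    obtain ⟨p, q⟩ := pq
    cases h : (rowInsert a p).2 with
    | none => simp [insertStep_of_none h]
    | some c =>
      have h1 := rowInsert_perm a p
      rw [insertStep_of_some h, letters_cons, letters_cons]
      refine ((ih c).append_left _).trans ?_
      rw [h] at h1
      simpa using h1.append_right (letters t)

theorem labels_insertStep (j a : ℕ) (t : List (List ℕ × List ℕ)) :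
    (labels (insertStep j a t)).Perm (j :: labels t) := by
  induction t generalizing a with
  | nil => simp [insertStep]
  | cons pq t ih =>
    obtain ⟨p, q⟩ := pq
    cases h : (rowInsert a p).2 with
    | none => simp [insertStep_of_none h]
    | some c =>
      rw [insertStep_of_some h, labels_cons, labels_cons]
      exact ((ih c).append_left _).trans List.perm_middle

/-- The two rows of each pair of rows have the same length. -/
def SameShape (t : List (List ℕ × List ℕ)) : Prop := ∀ pq ∈ t, pq.1.length = pq.2.length

theorem SameShape.insertStep {t : List (List ℕ × List ℕ)} (h : SameShape t) (j a : ℕ) :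
    SameShape (insertStep j a t) := by
  induction t generalizing a with
  | nil => simp [SameShape, FQ.insertStep]
  | cons pq t ih =>
    obtain ⟨p, q⟩ := pq
    simp only [SameShape, List.forall_mem_cons] at h ih ⊢
    cases hc : (rowInsert a p).2 with
    | none => simp only [insertStep_of_none hc, List.forall_mem_cons]; simpa using h
    | some c =>
      simp only [insertStep_of_some hc, List.forall_mem_cons]
      exact ⟨(length_rowInsert hc).trans h.1, ih h.2 c⟩

/-- The insertion step for exchanged pairs. -/
def coinsertStep (i n : ℕ) (t : List (List ℕ × List ℕ)) : List (List ℕ × List ℕ) :=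
  (insertStep n i (t.map Prod.swap)).map Prod.swap

theorem coinsertStep_nil (i n : ℕ) : coinsertStep i n [] = [([n], [i])] := rfl

theorem coinsertStep_of_none {i : ℕ} {q : List ℕ} (h : (rowInsert i q).2 = none) (n : ℕ)
    (p : List ℕ) (t : List (List ℕ × List ℕ)) :
    coinsertStep i n ((p, q) :: t) = (p ++ [n], q ++ [i]) :: t := by
  simp [coinsertStep, insertStep_of_none h]

theorem coinsertStep_of_some {i c : ℕ} {q : List ℕ} (h : (rowInsert i q).2 = some c) (n : ℕ)
    (p : List ℕ) (t : List (List ℕ × List ℕ)) :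
    coinsertStep i n ((p, q) :: t) = (p, (rowInsert i q).1) :: coinsertStep c n t := by
  simp [coinsertStep, insertStep_of_some h]

/-- When letter and label are both maximal, either insertion just appends the new box to the first
row. -/
theorem insertStep_eq_coinsertStep {i n : ℕ} {t : List (List ℕ × List ℕ)}
    (hi : ∀ l ∈ labels t, l ≤ i) (hn : ∀ l ∈ letters t, l ≤ n) :
    insertStep i n t = coinsertStep i n t := by
  cases t with
  | nil => rfl
  | cons pq t =>
    obtain ⟨p, q⟩ := pq
    rw [insertStep_of_none, coinsertStep_of_none]
    · exact rowInsert_eq_none_iff.2 fun x hx => hi x (by simp [hx])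
    · exact rowInsert_eq_none_iff.2 fun x hx => hn x (by simp [hx])

/-- This commutation is the core of the symmetry: inserting into $P$ with the largest label and
inserting into $Q$ with the largest letter interact only when both want the same new box. -/
theorem insertStep_coinsertStep {i j a n : ℕ} {t : List (List ℕ × List ℕ)}
    (hj : ∀ l ∈ labels t, l < j) (hn : ∀ l ∈ letters t, l < n) (hi : i < j) (ha : a < n) :
    insertStep j a (coinsertStep i n t) = coinsertStep i n (insertStep j a t) := by
  induction t generalizing i a with
  | nil =>
    have h1 : (rowInsert a [n]).2 = some n := by simp [rowInsert, ha]
    have h2 : (rowInsert i [j]).2 = some j := by simp [rowInsert, hi]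
    have h3 : insertStep j a [] = [([a], [j])] := rfl
    rw [coinsertStep_nil, h3, coinsertStep_of_some h2, insertStep_of_some h1]
    simp [rowInsert, ha, hi, insertStep, coinsertStep_nil]
  | cons pq t ih =>
    obtain ⟨p, q⟩ := pq
    simp only [labels_cons, letters_cons, List.mem_append] at hj hn
    cases hc : (rowInsert a p).2 with
    | none =>
      cases hd : (rowInsert i q).2 with
      | none =>
        -- The two new boxes collide. Whichever comes second bumps the maximal entry `n` of $P$ or
        -- `j` of $Q$ to the next rows, where the two insertions agree.
        have h1 := rowInsert_append_of_lt hc ha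
        have h2 := rowInsert_append_of_lt hd hi
        rw [coinsertStep_of_none hd, insertStep_of_none hc,
          insertStep_of_some (congrArg Prod.snd h1), coinsertStep_of_some (congrArg Prod.snd h2),
          h1, h2, insertStep_eq_coinsertStep (fun l hl => (hj l (Or.inr hl)).le)
            fun l hl => (hn l (Or.inr hl)).le]
      | some d =>
        have h2 := rowInsert_append_of_eq_some hd [j]
        rw [coinsertStep_of_some hd, insertStep_of_none hc, insertStep_of_none hc,
          coinsertStep_of_some (congrArg Prod.snd h2), h2]
    | some c =>
      have hcn := hn c (Or.inl (mem_of_rowInsert_eq_some hc))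
      cases hd : (rowInsert i q).2 with
      | none =>
        have h1 := rowInsert_append_of_eq_some hc [n]
        rw [coinsertStep_of_none hd, insertStep_of_some hc, coinsertStep_of_none hd,
          insertStep_of_some (congrArg Prod.snd h1), h1]
      | some d =>
        have hdj := hj d (Or.inl (mem_of_rowInsert_eq_some hd))
        rw [coinsertStep_of_some hd, insertStep_of_some hc, insertStep_of_some hc,
          coinsertStep_of_some hd,
          ih (fun l hl => hj l (Or.inr hl)) (fun l hl => hn l (Or.inr hl)) hdj hcn]

theorem robinsonSchensted_append_singleton (w : List (ℕ × ℕ)) (x : ℕ × ℕ) :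
    robinsonSchensted (w ++ [x]) = insertStep x.1 x.2 (robinsonSchensted w) := by
  simp [robinsonSchensted]

theorem letters_robinsonSchensted (w : List (ℕ × ℕ)) :
    (letters (robinsonSchensted w)).Perm (w.map Prod.snd) := by
  induction w using List.reverseRecOn with
  | nil => exact .nil
  | append_singleton w x ih =>
    rw [robinsonSchensted_append_singleton, List.map_append]
    exact (letters_insertStep _ _ _).trans ((ih.cons _).trans (List.perm_append_singleton _ _).symm)

theorem labels_robinsonSchensted (w : List (ℕ × ℕ)) :
    (labels (robinsonSchensted w)).Perm (w.map Prod.fst) := by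
  induction w using List.reverseRecOn with
  | nil => exact .nil
  | append_singleton w x ih =>
    rw [robinsonSchensted_append_singleton, List.map_append]
    exact (labels_insertStep _ _ _).trans ((ih.cons _).trans (List.perm_append_singleton _ _).symm)

theorem map_fst_robinsonSchensted (w : List (ℕ × ℕ)) :
    (robinsonSchensted w).map Prod.fst = (w.map Prod.snd).foldl (fun t a => tabInsert a t) [] := by
  induction w using List.reverseRecOn with
  | nil => rfl
  | append_singleton w x ih =>
    rw [robinsonSchensted_append_singleton, map_fst_insertStep, ih]
    simp

theorem isTableau_foldl_tabInsert (w : List ℕ) :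
    IsTableau (w.foldl (fun t a => tabInsert a t) []) := by
  induction w using List.reverseRecOn with
  | nil => trivial
  | append_singleton w x ih => rw [List.foldl_append]; exact ih.tabInsert x

theorem sameShape_robinsonSchensted (w : List (ℕ × ℕ)) : SameShape (robinsonSchensted w) := by
  induction w using List.reverseRecOn with
  | nil => simp [robinsonSchensted, SameShape]
  | append_singleton w x ih => rw [robinsonSchensted_append_singleton]; exact ih.insertStep _ _

theorem foldl_insertStep_coinsertStep {i n : ℕ} {t : List (List ℕ × List ℕ)}
    {v : List (ℕ × ℕ)} (hv : (v.map Prod.fst).Pairwise (· < ·))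
    (ht : ∀ l ∈ labels t, ∀ x ∈ v, l < x.1) (hi : ∀ x ∈ v, i < x.1)
    (htn : ∀ l ∈ letters t, l < n) (hvn : ∀ x ∈ v, x.2 < n) :
    v.foldl (fun t x => insertStep x.1 x.2 t) (coinsertStep i n t) =
      coinsertStep i n (v.foldl (fun t x => insertStep x.1 x.2 t) t) := by
  induction v generalizing t with
  | nil => rfl
  | cons x v ih =>
    simp only [List.forall_mem_cons, List.map_cons, List.pairwise_cons, List.mem_map,
      forall_exists_index, and_imp, forall_apply_eq_imp_iff₂] at hv ht hi hvn
    rw [List.foldl_cons, List.foldl_cons,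
      insertStep_coinsertStep (fun l hl => (ht l hl).1) htn hi.1 hvn.1]
    refine ih hv.2 (fun l hl => ?_) hi.2 (fun l hl => ?_) hvn.2
    · rcases List.mem_cons.1 ((labels_insertStep _ _ _).mem_iff.1 hl) with rfl | hl
      exacts [hv.1, (ht l hl).2]
    · rcases List.mem_cons.1 ((letters_insertStep _ _ _).mem_iff.1 hl) with rfl | hl
      exacts [hvn.1, htn l hl]

/-- Schützenberger's symmetry: the inverse of a word in two lines corresponds to the exchanged pair
of tableaux. -/
theorem robinsonSchensted_inverse {w w' : List (ℕ × ℕ)}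
    (hw : (w.map Prod.fst).Pairwise (· < ·)) (hw' : (w'.map Prod.fst).Pairwise (· < ·))
    (h : w'.Perm (w.map Prod.swap)) :
    robinsonSchensted w' = (robinsonSchensted w).map Prod.swap := by
  induction w using List.reverseRecOn generalizing w' with
  | nil => simp at h; simp [h, robinsonSchensted]
  | append_singleton w x ih =>
    obtain ⟨n, i⟩ := x
    -- The last column of `w` has the largest label `n`. In the inverse word it becomes a column
    -- whose letter is maximal, and its insertion is a coinsertion that commutes with the steps of
    -- `v`.
    obtain ⟨u, v, rfl⟩ := List.append_of_mem (h.mem_iff.2 (by simp : (i, n) ∈ _))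
    simp only [List.map_append, List.map_cons, List.map_nil, Prod.swap_prod_mk,
      List.pairwise_append, List.pairwise_cons, List.mem_map, List.mem_cons, forall_exists_index,
      and_imp, forall_apply_eq_imp_iff₂, List.not_mem_nil, or_false, forall_eq] at hw hw' h
    have h1 : (u ++ v).Perm (w.map Prod.swap) :=
      List.Perm.cons_inv (List.perm_middle.symm.trans (h.trans (List.perm_append_singleton _ _)))
    have h2 : ∀ x ∈ u ++ v, x.2 < n := fun x hx => by
      have := h1.mem_iff.1 hx
      obtain ⟨y, hy, rfl⟩ := List.mem_map.1 this
      exact hw.2.2 y hy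
    have hu : ∀ l ∈ labels (robinsonSchensted u), ∃ x ∈ u, x.1 = l := fun l hl => by
      simpa using (labels_robinsonSchensted u).mem_iff.1 hl
    have hu' : ∀ l ∈ letters (robinsonSchensted u), ∃ x ∈ u, x.2 = l := fun l hl => by
      simpa using (letters_robinsonSchensted u).mem_iff.1 hl
    have h3 : ((u ++ v).map Prod.fst).Pairwise (· < ·) := by
      simp only [List.map_append, List.pairwise_append, List.mem_map, forall_exists_index, and_imp,
        forall_apply_eq_imp_iff₂]
      exact ⟨hw'.1, hw'.2.1.2, fun x hx y hy => hw'.2.2 x hx y.1 (Or.inr ⟨y, hy, rfl⟩)⟩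
    rw [robinsonSchensted_append_singleton,
      show (insertStep (n, i).1 (n, i).2 (robinsonSchensted w)).map Prod.swap =
        coinsertStep i n ((robinsonSchensted w).map Prod.swap) by simp [coinsertStep],
      ← ih hw.1 h3 h1, robinsonSchensted, robinsonSchensted, List.foldl_append, List.foldl_append,
      List.foldl_cons, ← robinsonSchensted,
      insertStep_eq_coinsertStep, foldl_insertStep_coinsertStep]
    · exact hw'.2.1.2
    · intro l hl x hx
      obtain ⟨y, hy, rfl⟩ := hu l hl
      exact hw'.2.2 y hy x.1 (Or.inr ⟨x, hx, rfl⟩)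
    · exact hw'.2.1.1
    · intro l hl
      obtain ⟨y, hy, rfl⟩ := hu' l hl
      exact h2 y (by simp [hy])
    · exact fun x hx => h2 x (by simp [hx])
    · intro l hl
      obtain ⟨y, hy, rfl⟩ := hu l hl
      exact (hw'.2.2 y hy i (Or.inl rfl)).le
    · intro l hl
      obtain ⟨y, hy, rfl⟩ := hu' l hl
      exact (h2 y (by simp [hy])).le

/-! ### Reverse insertion -/

theorem IsTableau.forall_mem {t : List (List ℕ)} (h : IsTableau t) :
    ∀ p ∈ t, p ≠ [] ∧ p.Pairwise (· ≤ ·) := by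
  induction t with
  | nil => simp
  | cons p t ih => exact List.forall_mem_cons.2 ⟨⟨h.1, h.2.1⟩, ih h.2.2.2⟩

/-- The fresh label `j` marks the new box, hence the row where the bumping stopped; row insertions
are then undone upwards. -/
theorem insertStep_injective {j a a' : ℕ} {t t' : List (List ℕ × List ℕ)}
    (ht : ∀ pq ∈ t, pq.1 ≠ [] ∧ pq.1.Pairwise (· ≤ ·))
    (ht' : ∀ pq ∈ t', pq.1 ≠ [] ∧ pq.1.Pairwise (· ≤ ·))
    (hs : SameShape t) (hs' : SameShape t')
    (hj : j ∉ labels t) (hj' : j ∉ labels t') (h : insertStep j a t = insertStep j a' t') :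
    a = a' ∧ t = t' := by
  have key : ∀ {a a' : ℕ} {p q} {t : List (List ℕ × List ℕ)}, j ∉ q → p ≠ [] →
      p.length = q.length → insertStep j a [] = insertStep j a' ((p, q) :: t) → False := by
    intro a a' p q t hq hp hpq h
    cases hc : (rowInsert a' p).2 with
    | none =>
      rw [insertStep_of_none hc] at h
      have : q = [] := by simp [insertStep] at h; grind
      simp [this] at hpq; exact hp hpq
    | some c =>
      rw [insertStep_of_some hc] at h
      simp [insertStep] at h
      simp [← h.1.2] at hq
  induction t generalizing t' a a' with
  | nil =>
    cases t' with
    | nil => simpa [insertStep] using h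
    | cons pq' t' =>
      obtain ⟨p, q⟩ := pq'
      simp only [SameShape, List.forall_mem_cons, labels_cons, List.mem_append, not_or] at ht' hs' hj'
      exact (key hj'.1 ht'.1.1 hs'.1 h).elim
  | cons pq t ih =>
    obtain ⟨p, q⟩ := pq
    simp only [SameShape, List.forall_mem_cons, labels_cons, List.mem_append, not_or] at ht hs hj
    cases t' with
    | nil => exact (key hj.1 ht.1.1 hs.1 h.symm).elim
    | cons pq' t' =>
      obtain ⟨p', q'⟩ := pq'
      simp only [SameShape, List.forall_mem_cons, labels_cons, List.mem_append, not_or]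
        at ht' hs' hj'
      cases hc : (rowInsert a p).2 with
      | none =>
        cases hc' : (rowInsert a' p').2 with
        | none => rw [insertStep_of_none hc, insertStep_of_none hc'] at h; simp at h; grind
        | some c' =>
          rw [insertStep_of_none hc, insertStep_of_some hc'] at h
          simp at h; simp [← h.1.2] at hj'
      | some c =>
        cases hc' : (rowInsert a' p').2 with
        | none =>
          rw [insertStep_of_some hc, insertStep_of_none hc'] at h
          simp at h; simp [h.1.2] at hj
        | some c' =>
          rw [insertStep_of_some hc, insertStep_of_some hc'] at h
          simp only [List.cons.injEq, Prod.mk.injEq] at h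
          obtain ⟨⟨h1, rfl⟩, h2⟩ := h
          obtain ⟨rfl, rfl⟩ := ih ht.2 ht'.2 hs.2 hs'.2 hj.2 hj'.2 h2
          obtain ⟨rfl, rfl⟩ := rowInsert_injective ht.1.2 ht'.1.2 (Prod.ext rfl hc)
            (Prod.ext h1.symm hc')
          exact ⟨rfl, rfl⟩

theorem isTableau_map_fst_robinsonSchensted (w : List (ℕ × ℕ)) :
    IsTableau ((robinsonSchensted w).map Prod.fst) := by
  rw [map_fst_robinsonSchensted]; exact isTableau_foldl_tabInsert _

/-- The labels of the pair of tableaux, sorted, are the top line of the word; so the last labels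
agree and the last steps can be undone together. -/
theorem robinsonSchensted_injective {w w' : List (ℕ × ℕ)}
    (hw : (w.map Prod.fst).Pairwise (· < ·)) (hw' : (w'.map Prod.fst).Pairwise (· < ·))
    (h : robinsonSchensted w = robinsonSchensted w') : w = w' := by
  have hl : w.map Prod.fst = w'.map Prod.fst :=
    (((labels_robinsonSchensted w).symm.trans (h ▸ labels_robinsonSchensted w')).eq_of_pairwise
      (fun _ _ _ _ h h' => absurd h h'.not_gt) hw hw')
  induction w using List.reverseRecOn generalizing w' with
  | nil => simpa using hl.symm
  | append_singleton w x ih =>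
    rcases List.eq_nil_or_concat' w' with rfl | ⟨w', x', rfl⟩
    · simp at hl
    rw [robinsonSchensted_append_singleton, robinsonSchensted_append_singleton] at h
    simp only [List.map_append, List.map_cons, List.map_nil] at hl hw hw'
    obtain ⟨h1, h2⟩ := List.append_inj' hl rfl
    simp only [List.cons.injEq, and_true] at h2
    rw [List.pairwise_append] at hw hw'
    rw [h2] at h
    have rows := fun w => (isTableau_map_fst_robinsonSchensted w).forall_mem
    simp only [List.forall_mem_map] at rows
    obtain ⟨h3, h4⟩ := insertStep_injective (rows w) (rows w')
      (sameShape_robinsonSchensted w) (sameShape_robinsonSchensted w')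
      (fun hx => (hw.2.2 _ ((labels_robinsonSchensted w).mem_iff.1 hx) x.1 (by simp)).ne h2.symm)
      (fun hx => (hw'.2.2 _ ((labels_robinsonSchensted w').mem_iff.1 hx) x'.1 (by simp)).ne rfl) h
    rw [ih hw.1 hw'.1 h4 h1, Prod.ext h2 h3]

/-- A pair of tableaux of the same shape, given as a list of pairs of rows. -/
structure IsTableauPair (t : List (List ℕ × List ℕ)) : Prop where
  fst : IsTableau (t.map Prod.fst)
  snd : IsTableau (t.map Prod.snd)
  sameShape : SameShape t

theorem IsTableauPair.tail {pq : List ℕ × List ℕ} {t : List (List ℕ × List ℕ)}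
    (h : IsTableauPair (pq :: t)) : IsTableauPair t :=
  ⟨h.fst.2.2.2, h.snd.2.2.2, fun x hx => h.sameShape x (by simp [hx])⟩

theorem dominates_of_insertStep {q : List ℕ} {j c : ℕ} {t : List (List ℕ × List ℕ)}
    (h : Dominates q (((insertStep j c t).map Prod.snd).headD [])) :
    Dominates q ((t.map Prod.snd).headD []) := by
  cases t with
  | nil => simp
  | cons pq t =>
    obtain ⟨p, r⟩ := pq
    cases hc : (rowInsert c p).2 with
    | none => rw [insertStep_of_none hc] at h; exact h.of_append
    | some d => rw [insertStep_of_some hc] at h; exact h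

theorem pairwise_headD {t : List (List ℕ)} (h : IsTableau t) :
    (t.headD []).Pairwise (· ≤ ·) := by
  cases t with
  | nil => simp
  | cons p t => exact h.2.1

/-- The largest label sits in a corner of the shape. Removing that corner and bumping its letter of
$P$ back up to the first row reverts one step. -/
theorem exists_insertStep_eq {t : List (List ℕ × List ℕ)} (ht : IsTableauPair t) {j : ℕ}
    (hj : j ∈ labels t) (hmax : ∀ l ∈ labels t, l ≤ j) (hnd : (labels t).Nodup) :
    ∃ a t₀, insertStep j a t₀ = t ∧ IsTableauPair t₀ := by
  induction t with
  | nil => exact absurd hj List.not_mem_nil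
  | cons pq t ih =>
    obtain ⟨p, q⟩ := pq
    obtain ⟨hp1, hp2, hp3, hp4⟩ := ht.fst
    obtain ⟨hq1, hq2, hq3, hq4⟩ := ht.snd
    have hlen := ht.sameShape (p, q) (by simp)
    dsimp only at hp1 hp2 hp3 hp4 hq1 hq2 hq3 hq4 hlen
    rw [labels_cons] at hj hmax hnd
    rw [List.nodup_append] at hnd
    rcases List.mem_append.1 hj with hjq | hjt
    · obtain ⟨q, l, rfl⟩ := (List.eq_nil_or_concat' q).resolve_left hq1
      obtain ⟨p, a, rfl⟩ := (List.eq_nil_or_concat' p).resolve_left hp1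
      rw [List.pairwise_append] at hp2 hq2
      obtain rfl : l = j := by
        refine le_antisymm (hmax l (by simp)) ?_
        rcases List.mem_append.1 hjq with h | h
        exacts [hq2.2.2 j h l (by simp), (List.mem_singleton.1 h).le]
      have hpa : (rowInsert a p).2 = none :=
        rowInsert_eq_none_iff.2 fun x hx => hp2.2.2 x hx a (by simp)
      have hlt : ∀ y ∈ (t.map Prod.snd).headD [], y ≤ l := fun y hy => hmax y <| by
        cases t with
        | nil => simp at hy
        | cons pq t => exact List.mem_append_right _ (List.mem_append_left _ hy)
      -- No entry below the corner could exceed the maximal label, so the row underneath stays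
      -- within the shortened row.
      have hdq := hq3.of_append_left hlt
      have hlen' : p.length = q.length := by simpa using hlen
      rcases eq_or_ne q [] with rfl | hq
      · obtain rfl : p = [] := by simpa using hlen'
        have : t = [] := by
          cases t with
          | nil => rfl
          | cons pq t =>
            have h1 := hq4.1
            simp only [List.map_cons, List.headD_cons] at hdq
            cases h2 : pq.2 with
            | nil => exact absurd h2 h1
            | cons y r => rw [h2] at hdq; exact hdq.elim
        subst this
        exact ⟨a, [], rfl, ⟨trivial, trivial, by simp [SameShape]⟩⟩
      · have hp : p ≠ [] := by rintro rfl; simp at hlen'; exact hq (by simpa using hlen'.symm)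
        -- Maximality only concerns $Q$; for $P$ the length bound is transferred through the common
        -- shape.
        have hdp : Dominates p ((t.map Prod.fst).headD []) := by
          have hlen2 : ((t.map Prod.fst).headD []).length ≤ p.length := by
            have h1 : ∀ {p q : List ℕ}, Dominates p q → q.length ≤ p.length := by
              intro p q h
              induction q generalizing p with
              | nil => simp
              | cons y q ih =>
                cases p with
                | nil => exact h.elim
                | cons x p => simpa using ih h.2
            rw [hlen']
            refine le_trans (le_of_eq ?_) (h1 hdq)
            cases t with
            | nil => rfl
            | cons pq t => exact ht.sameShape pq (by simp)
          have h2 : ∀ {p q : List ℕ}, Dominates (p ++ [a]) q → q.length ≤ p.length →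
              Dominates p q := by
            intro p q h hl
            induction q generalizing p with
            | nil => simp
            | cons y q ih =>
              cases p with
              | nil => simp at hl
              | cons x p => exact ⟨h.1, ih h.2 (by simpa using hl)⟩
          exact h2 hp3 hlen2
        refine ⟨a, (p, q) :: t, insertStep_of_none hpa _ _ _,
          ⟨⟨hp, hp2.1, hdp, hp4⟩, ⟨hq, hq2.1, hdq, hq4⟩, ?_⟩⟩
        exact List.forall_mem_cons.2 ⟨hlen', ht.tail.sameShape⟩
    · obtain ⟨c, t₀, h₀, ht₀⟩ := ih ht.tail hjt (fun l hl => hmax l (by simp [hl])) hnd.2.1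
      subst h₀
      -- The letter `c` pushed out of the lower rows lies in the row under `p`, so `p` has a smaller
      -- entry and `c` can be bumped back into it.
      rw [map_fst_insertStep, headD_tabInsert] at hp3
      obtain ⟨a, p₀, hp₀, hpa⟩ :=
        exists_rowInsert_eq hp2 (hp3.exists_lt (mem_rowInsert_self c _))
      have hpa1 : (rowInsert a p₀).2 = some c := congrArg Prod.snd hpa
      have hpa2 : (rowInsert a p₀).1 = p := congrArg Prod.fst hpa
      have hl := length_rowInsert hpa1
      rw [hpa2] at hl
      refine ⟨a, (p₀, q) :: t₀, by rw [insertStep_of_some hpa1, hpa2], ⟨⟨?_, hp₀, ?_, ht₀.fst⟩,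
        ⟨hq1, hq2, dominates_of_insertStep hq3, ht₀.snd⟩, ?_⟩⟩
      · exact List.ne_nil_of_mem (mem_of_rowInsert_eq_some hpa1)
      · exact Dominates.of_rowInsert (by rwa [hpa2]) hpa1 hp₀ (pairwise_headD ht₀.fst)
      · exact List.forall_mem_cons.2 ⟨hl.symm.trans hlen, ht₀.sameShape⟩

/-- Every pair of tableaux of the same shape comes from a word in two lines. -/
theorem exists_robinsonSchensted_eq {t : List (List ℕ × List ℕ)} (ht : IsTableauPair t)
    (hnd : (labels t).Nodup) :
    ∃ w : List (ℕ × ℕ), (w.map Prod.fst).Pairwise (· < ·) ∧ robinsonSchensted w = t := by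
  induction hn : (labels t).length generalizing t with
  | zero =>
    cases t with
    | nil => exact ⟨[], by simp, rfl⟩
    | cons pq t =>
      have h : pq.2 = [] := by simp [labels] at hn; exact hn.1
      exact absurd h ht.snd.1
  | succ n ih =>
    have hne : (labels t).toFinset.Nonempty := by
      rw [List.toFinset_nonempty_iff]; rintro h; simp [h] at hn
    obtain ⟨j, hj, hmax⟩ := (labels t).toFinset.exists_max_image id hne
    simp only [List.mem_toFinset, id] at hj hmax
    obtain ⟨a, t₀, rfl, ht₀⟩ := exists_insertStep_eq ht hj hmax hnd
    have hperm := labels_insertStep j a t₀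
    have hnd' := hperm.nodup_iff.1 hnd
    rw [List.nodup_cons] at hnd'
    obtain ⟨w, hw, rfl⟩ := ih ht₀ hnd'.2 (by simpa [hn] using hperm.length_eq.symm)
    refine ⟨w ++ [(j, a)], ?_, robinsonSchensted_append_singleton _ _⟩
    rw [List.map_append, List.pairwise_append]
    refine ⟨hw, by simp, fun l hl k hk => ?_⟩
    obtain rfl : k = j := by simpa using hk
    have hl' := (labels_robinsonSchensted w).mem_iff.2 hl
    -- The removed label was the largest, so appending its column keeps the top line increasing.
    exact lt_of_le_of_ne (hmax l (hperm.mem_iff.2 (by simp [hl']))) fun h => hnd'.1 (h ▸ hl')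

/-! ### Knuth equivalence -/

section Knuth

variable {B : Type*}

theorem Knuth.symm {w w' : List (ℕ × B)} (h : Knuth w w') : Knuth w' w := by
  cases h with
  | exchange u v x y h => exact .exchange u v y x h.symm
  | acb_cab u v a b c β h h' => exact .cab_acb u v a b c β h h'
  | cab_acb u v a b c β h h' => exact .acb_cab u v a b c β h h'
  | bac_bca u v a b c β h h' => exact .bca_bac u v a b c β h h'
  | bca_bac u v a b c β h h' => exact .bac_bca u v a b c β h h'

theorem Knuth.append_append {w w' : List (ℕ × B)} (h : Knuth w w') (x y : List (ℕ × B)) :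
    Knuth (x ++ w ++ y) (x ++ w' ++ y) := by
  cases h with
  | exchange u v p q h => simpa using Knuth.exchange (x ++ u) (v ++ y) p q h
  | acb_cab u v a b c β h h' => simpa using Knuth.acb_cab (x ++ u) (v ++ y) a b c β h h'
  | cab_acb u v a b c β h h' => simpa using Knuth.cab_acb (x ++ u) (v ++ y) a b c β h h'
  | bac_bca u v a b c β h h' => simpa using Knuth.bac_bca (x ++ u) (v ++ y) a b c β h h'
  | bca_bac u v a b c β h h' => simpa using Knuth.bca_bac (x ++ u) (v ++ y) a b c β h h'

theorem Knuth.perm {w w' : List (ℕ × B)} (h : Knuth w w') : w.Perm w' := by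
  have : ∀ (u v : List (ℕ × B)) {x y : List (ℕ × B)}, x.Perm y → (u ++ x ++ v).Perm (u ++ y ++ v) :=
    fun u v _ _ h => (h.append_left u).append_right v
  cases h with
  | exchange u v x y h => exact this _ _ (.swap _ _ _)
  | acb_cab u v a b c β h h' => exact this _ _ (.swap _ _ _)
  | cab_acb u v a b c β h h' => exact this _ _ (.swap _ _ _)
  | bac_bca u v a b c β h h' => exact this _ _ (.cons _ (.swap _ _ _))
  | bca_bac u v a b c β h h' => exact this _ _ (.cons _ (.swap _ _ _))

/-- Two words are related by a sequence of Knuth relations. -/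
def KnuthEquiv (w w' : List (ℕ × B)) : Prop := Relation.ReflTransGen Knuth w w'

theorem KnuthEquiv.refl (w : List (ℕ × B)) : KnuthEquiv w w := Relation.ReflTransGen.refl

theorem KnuthEquiv.trans {w w' w'' : List (ℕ × B)} (h : KnuthEquiv w w')
    (h' : KnuthEquiv w' w'') : KnuthEquiv w w'' := Relation.ReflTransGen.trans h h'

theorem Knuth.equiv {w w' : List (ℕ × B)} (h : Knuth w w') : KnuthEquiv w w' :=
  Relation.ReflTransGen.single h

theorem KnuthEquiv.symm {w w' : List (ℕ × B)} (h : KnuthEquiv w w') : KnuthEquiv w' w := by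
  induction h with
  | refl => exact .refl _
  | tail _ h ih => exact h.symm.equiv.trans ih

theorem KnuthEquiv.append_append {w w' : List (ℕ × B)} (h : KnuthEquiv w w')
    (x y : List (ℕ × B)) : KnuthEquiv (x ++ w ++ y) (x ++ w' ++ y) := by
  induction h with
  | refl => exact .refl _
  | tail _ h ih => exact ih.trans (h.append_append x y).equiv

theorem KnuthEquiv.append_left {w w' : List (ℕ × B)} (h : KnuthEquiv w w') (x : List (ℕ × B)) :
    KnuthEquiv (x ++ w) (x ++ w') := by simpa using h.append_append x []

theorem KnuthEquiv.append_right {w w' : List (ℕ × B)} (h : KnuthEquiv w w') (x : List (ℕ × B)) :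
    KnuthEquiv (w ++ x) (w' ++ x) := by simpa using h.append_append [] x

theorem KnuthEquiv.cons {w w' : List (ℕ × B)} (h : KnuthEquiv w w') (x : ℕ × B) :
    KnuthEquiv (x :: w) (x :: w') := h.append_left [x]

theorem knuthEquiv_cons_append {x : ℕ × B} {w : List (ℕ × B)} (h : ∀ y ∈ w, y.2 ≠ x.2) :
    KnuthEquiv (x :: w) (w ++ [x]) := by
  induction w with
  | nil => exact .refl _
  | cons y w ih =>
    simp only [List.forall_mem_cons] at h
    exact (Knuth.exchange [] w x y h.1.symm).equiv.trans ((ih h.2).cons y)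

/-- The letters of a word can be sorted according to a property of their second components. -/
theorem knuthEquiv_filter_append_filter (p : B → Bool) (w : List (ℕ × B)) :
    KnuthEquiv w (w.filter (fun x => p x.2) ++ w.filter (fun x => !p x.2)) := by
  induction w with
  | nil => exact .refl _
  | cons x w ih =>
    cases hx : p x.2 with
    | true => simpa [hx] using ih.cons x
    | false =>
      have h : ∀ y ∈ w.filter (fun x => p x.2), y.2 ≠ x.2 := fun y hy h => by
        simp [h, hx] at hy
      simpa [hx] using (ih.cons x).trans
        ((knuthEquiv_cons_append h).append_right (w.filter (fun x => !p x.2)))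

/-- Exchanges of letters of different colours reduce the coloured theory to one-coloured words. -/
theorem knuthEquiv_flatMap_filter [DecidableEq B] {bs : List B} {w : List (ℕ × B)}
    (hbs : bs.Nodup) (h : ∀ x ∈ w, x.2 ∈ bs) :
    KnuthEquiv w (bs.flatMap fun b => w.filter fun x => x.2 = b) := by
  induction bs generalizing w with
  | nil =>
    cases w with
    | nil => exact .refl _
    | cons x w => exact absurd (h x (by simp)) (by simp)
  | cons b bs ih =>
    rw [List.nodup_cons] at hbs
    refine (knuthEquiv_filter_append_filter (fun c => c = b) w).trans ?_
    rw [List.flatMap_cons]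
    refine KnuthEquiv.append_left ?_ _
    have h1 : ∀ c ∈ bs, (w.filter fun x => !decide (x.2 = b)).filter (fun x => x.2 = c) =
        w.filter fun x => x.2 = c := fun c hc => by
      rw [List.filter_filter]
      refine List.filter_congr fun x _ => ?_
      have : c ≠ b := fun h => hbs.1 (h ▸ hc)
      grind
    have h2 := ih (w := w.filter fun x => !decide (x.2 = b)) hbs.2 fun x hx => by
      have h3 := List.mem_filter.1 hx
      have := h x h3.1
      grind
    rwa [List.flatMap_congr h1] at h2

/-- The word with letters in `ℕ × {β}` attached to a word with letters in `ℕ`. -/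
def coloured (β : B) (l : List ℕ) : List (ℕ × B) := l.map fun a => (a, β)

theorem coloured_append (β : B) (l l' : List ℕ) :
    coloured β (l ++ l') = coloured β l ++ coloured β l' := List.map_append

/-- A letter smaller than a whole row travels left by moves $bca\to bac$, each using the entry on
the left as the witness $b$; it stops right after the first entry. -/
theorem knuthEquiv_cons_append_of_lt (β : B) {x a : ℕ} {r : List ℕ}
    (hr : (x :: r).Pairwise (· ≤ ·)) (ha : a < x) :
    KnuthEquiv (coloured β (x :: (r ++ [a]))) (coloured β (x :: a :: r)) := by
  induction r generalizing x with
  | nil => exact .refl _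
  | cons y r ih =>
    rw [List.pairwise_cons] at hr
    have hxy := hr.1 y (by simp)
    refine ((ih hr.2 (ha.trans_le hxy)).cons (x, β)).trans (Knuth.equiv ?_)
    exact Knuth.bca_bac [] (coloured β r) a x y β ha hxy

/-- Row insertion is a sequence of Knuth moves that carries the bumped letter to the front. It
passes an unaffected head `x` by $acb\to cab$, with the next entry of the new row as the witness
$b$. -/
theorem knuthEquiv_rowInsert (β : B) {a : ℕ} {p : List ℕ} (hp : p.Pairwise (· ≤ ·)) :
    KnuthEquiv (coloured β (p ++ [a]))
      (coloured β ((rowInsert a p).2.toList ++ (rowInsert a p).1)) := by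
  induction p with
  | nil => exact .refl _
  | cons x r ih =>
    rcases lt_or_ge a x with h | h
    · rw [rowInsert_cons_lt h]; exact knuthEquiv_cons_append_of_lt β hp h
    · rw [List.pairwise_cons] at hp
      rw [rowInsert_cons_le h]
      cases hc : (rowInsert a r).2 with
      | none => rw [rowInsert_of_eq_none hc]; exact .refl _
      | some c =>
        have h1 := ih hp.2
        have hac := lt_of_rowInsert_eq_some hc
        rw [hc] at h1
        refine (h1.cons (x, β)).trans ?_
        obtain ⟨y, s, hy⟩ := List.exists_cons_of_ne_nil (rowInsert_ne_nil a r)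
        have h2 : x ≤ y := by
          rcases mem_rowInsert (hy ▸ List.mem_cons_self : y ∈ (rowInsert a r).1) with rfl | h2
          exacts [h, hp.1 y h2]
        have h3 : y < c := by
          have h4 := pairwise_rowInsert (a := a) hp.2
          have h5 := mem_rowInsert_self a r
          rw [hy] at h4 h5
          rw [List.pairwise_cons] at h4
          rcases List.mem_cons.1 h5 with rfl | h5
          exacts [hac, (h4.1 a h5).trans_lt hac]
        rw [hy]
        exact (Knuth.acb_cab [] (coloured β s) x y c β h2 h3).equiv

/-- The word obtained by reading the rows of a tableau from bottom to top. -/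
def readingWord (t : List (List ℕ)) : List ℕ := t.reverse.flatten

theorem readingWord_cons (p : List ℕ) (t : List (List ℕ)) :
    readingWord (p :: t) = readingWord t ++ p := by simp [readingWord]

/-- The bumped letter arrives just after the reading word of the lower rows, ready to be inserted
there. -/
theorem knuthEquiv_tabInsert (β : B) {a : ℕ} {t : List (List ℕ)} (ht : IsTableau t) :
    KnuthEquiv (coloured β (readingWord t ++ [a])) (coloured β (readingWord (tabInsert a t))) := by
  induction t generalizing a with
  | nil => exact .refl _
  | cons p t ih =>
    cases hc : (rowInsert a p).2 with
    | none => simpa [tabInsert_of_none hc, readingWord_cons] using KnuthEquiv.refl _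
    | some c =>
      have h := knuthEquiv_rowInsert β (a := a) ht.2.1
      rw [hc] at h
      rw [tabInsert_of_some hc, readingWord_cons, readingWord_cons, List.append_assoc,
        coloured_append]
      refine (h.append_left _).trans ?_
      rw [← coloured_append, ← List.append_assoc, coloured_append, Option.toList_some,
        coloured_append β (readingWord (tabInsert c t))]
      exact (ih ht.2.2.2).append_right _

theorem knuthEquiv_readingWord (β : B) (w : List ℕ) :
    KnuthEquiv (coloured β w) (coloured β (readingWord (w.foldl (fun t a => tabInsert a t) []))) := by
  induction w using List.reverseRecOn with
  | nil => exact .refl _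
  | append_singleton w x ih =>
    rw [List.foldl_append, coloured_append]
    refine (ih.append_right _).trans ?_
    rw [← coloured_append]
    exact knuthEquiv_tabInsert β (isTableau_foldl_tabInsert w)

end Knuth

/-- The elementary Knuth relations on words of three letters. -/
inductive KnuthTriple : List ℕ → List ℕ → Prop
  | acb_cab {a b c : ℕ} (hab : a ≤ b) (hbc : b < c) : KnuthTriple [a, c, b] [c, a, b]
  | bac_bca {a b c : ℕ} (hab : a < b) (hbc : b ≤ c) : KnuthTriple [b, a, c] [b, c, a]

/-- The row obtained by inserting a word, and the word formed by the bumped letters. -/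
def rowInsertWord : List ℕ → List ℕ → List ℕ × List ℕ
  | [], p => (p, [])
  | a :: w, p =>
    ((rowInsertWord w (rowInsert a p).1).1,
      (rowInsert a p).2.toList ++ (rowInsertWord w (rowInsert a p).1).2)

/-- The tableau obtained by inserting a word. -/
def tabInsertWord (w : List ℕ) (t : List (List ℕ)) : List (List ℕ) :=
  w.foldl (fun t a => tabInsert a t) t

/-- Bumping can be organised row by row instead of letter by letter: the first row absorbs the whole
word, and the bumped word is passed on to the remaining rows. -/
theorem tabInsertWord_cons (w : List ℕ) (p : List ℕ) (t : List (List ℕ)) :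
    tabInsertWord w (p :: t) = (rowInsertWord w p).1 :: tabInsertWord (rowInsertWord w p).2 t := by
  induction w generalizing p t with
  | nil => rfl
  | cons a w ih =>
    simp only [tabInsertWord, List.foldl_cons, rowInsertWord] at ih ⊢
    cases hc : (rowInsert a p).2 with
    | none => rw [tabInsert_of_none hc, ih, rowInsert_of_eq_none hc]; simp
    | some c => rw [tabInsert_of_some hc, ih]; simp

theorem rowInsertWord_cons_le {w : List ℕ} {x : ℕ} (h : ∀ a ∈ w, x ≤ a) (r : List ℕ) :
    rowInsertWord w (x :: r) = (x :: (rowInsertWord w r).1, (rowInsertWord w r).2) := by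
  induction w generalizing r with
  | nil => rfl
  | cons a w ih =>
    rw [List.forall_mem_cons] at h
    simp only [rowInsertWord, rowInsert_cons_le h.1, ih h.2]

theorem rowInsert_le_of_lt {a c e : ℕ} {p : List ℕ} (hp : p.Pairwise (· ≤ ·))
    (hc : (rowInsert a p).2 = some c) (he : e ∈ p) (hae : a < e) : c ≤ e := by
  induction p with
  | nil => simp at he
  | cons x r ih =>
    rw [List.pairwise_cons] at hp
    rcases lt_or_ge a x with h | h
    · rw [rowInsert_cons_lt h] at hc
      obtain rfl : x = c := by simpa using hc
      rcases List.mem_cons.1 he with rfl | he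
      exacts [le_rfl, hp.1 e he]
    · rw [rowInsert_cons_le h] at hc
      rcases List.mem_cons.1 he with rfl | he
      exacts [absurd hae h.not_gt, ih hp.2 hc he]

/-- A single row cannot distinguish Knuth-related triples, and it emits bumped words that are again
equal or Knuth-related. This makes the invariance of insertion an induction on rows. -/
theorem rowInsertWord_knuthTriple {w w' : List ℕ} (h : KnuthTriple w w') {p : List ℕ}
    (hp : p.Pairwise (· ≤ ·)) :
    (rowInsertWord w p).1 = (rowInsertWord w' p).1 ∧
      ((rowInsertWord w p).2 = (rowInsertWord w' p).2 ∨
        KnuthTriple (rowInsertWord w p).2 (rowInsertWord w' p).2 ∨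
        KnuthTriple (rowInsertWord w' p).2 (rowInsertWord w p).2) := by
  induction p with
  | nil =>
    cases h with
    | @acb_cab a b c hab hbc =>
      simp [rowInsertWord, rowInsert, hbc, hab.not_gt, (hab.trans hbc.le).not_gt,
        hab.trans_lt hbc]
    | @bac_bca a b c hab hbc =>
      simp [rowInsertWord, rowInsert, hbc.not_gt, hab, (hab.le.trans hbc).not_gt]
  | cons x r ih =>
    rw [List.pairwise_cons] at hp
    obtain ⟨hx, hr⟩ := hp
    cases h with
    | @acb_cab a b c hab hbc =>
      have hac := hab.trans_lt hbc
      rcases le_or_gt x a with hxa | hax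
      · rw [rowInsertWord_cons_le (by grind), rowInsertWord_cons_le (by grind)]
        simpa using ih hr
      · simp only [rowInsertWord, rowInsert_cons_lt hax, rowInsert_cons_le hac.le,
          rowInsert_cons_le hab]
        rcases lt_or_ge c x with hcx | hxc
        · simp only [rowInsert_cons_lt hcx, rowInsert_cons_lt hac, rowInsert_cons_le hab]
          cases r with
          | nil => simp [rowInsert, hbc]
          | cons y s =>
            have hxy := hx y (by simp)
            have hcy := hcx.trans_le hxy
            simp only [rowInsert_cons_lt hcy, rowInsert_cons_lt hbc,
              rowInsert_cons_lt (hbc.trans hcy)]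
            -- The bumped words are `x y c` and `x c y` with `c < x ≤ y`.
            exact ⟨trivial, Or.inr (Or.inr (.bac_bca hcx hxy))⟩
        · simp only [rowInsert_cons_le hxc, rowInsert_cons_lt hax, rowInsert_cons_le hab]
          refine ⟨trivial, ?_⟩
          cases hd : (rowInsert c r).2 with
          | none => left; simp
          | some d =>
            right; left
            have hr' := pairwise_rowInsert (a := c) hr
            have hcr := mem_rowInsert_self c r
            cases he : (rowInsert b (rowInsert c r).1).2 with
            | none => exact absurd (rowInsert_eq_none_iff.1 he c hcr) hbc.not_ge
            | some e =>
              have h1 := rowInsert_le_of_lt hr' he hcr hbc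
              have h2 := lt_of_rowInsert_eq_some hd
              have h3 : x ≤ e := by
                rcases mem_rowInsert (mem_of_rowInsert_eq_some he) with rfl | h
                exacts [hxc, hx e h]
              -- The bumped words are `x d e` and `d x e` with `x ≤ e < d`.
              exact .acb_cab h3 (h1.trans_lt h2)
    | @bac_bca a b c hab hbc =>
      have hac := hab.trans_le hbc
      rcases le_or_gt x a with hxa | hax
      · rw [rowInsertWord_cons_le (by grind), rowInsertWord_cons_le (by grind)]
        simpa using ih hr
      · rcases lt_or_ge b x with hbx | hxb
        · simp only [rowInsertWord, rowInsert_cons_lt hbx, rowInsert_cons_lt hab,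
            rowInsert_cons_le hac.le, rowInsert_cons_le hbc]
          refine ⟨trivial, ?_⟩
          cases hd : (rowInsert c r).2 with
          | none => left; simp
          | some d =>
            exact Or.inr (Or.inl (.bac_bca hbx (hx d (mem_of_rowInsert_eq_some hd))))
        · simp only [rowInsertWord, rowInsert_cons_le hxb, rowInsert_cons_lt hax,
            rowInsert_cons_le hac.le, rowInsert_cons_le (hxb.trans hbc)]
          refine ⟨trivial, ?_⟩
          cases he : (rowInsert c (rowInsert b r).1).2 with
          | none => left; simp
          | some e =>
            right; left
            have hce := lt_of_rowInsert_eq_some he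
            have hmem : e ∈ r :=
              (mem_rowInsert (mem_of_rowInsert_eq_some he)).resolve_left (hbc.trans_lt hce).ne'
            cases hd : (rowInsert b r).2 with
            | none =>
              exact absurd (rowInsert_eq_none_iff.1 hd e hmem) (hbc.trans_lt hce).not_ge
            | some d =>
              have h1 := lt_of_rowInsert_eq_some hd
              exact .bac_bca (hxb.trans_lt h1) (rowInsert_le_of_lt hr hd hmem (hbc.trans_lt hce))

theorem tabInsertWord_knuthTriple {w w' : List ℕ} (h : KnuthTriple w w') {t : List (List ℕ)}
    (ht : IsTableau t) : tabInsertWord w t = tabInsertWord w' t := by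
  induction t generalizing w w' with
  | nil =>
    cases h with
    | @acb_cab a b c hab hbc =>
      simp [tabInsertWord, tabInsert, rowInsert, hbc, hab.not_gt, (hab.trans hbc.le).not_gt,
        hab.trans_lt hbc]
    | @bac_bca a b c hab hbc =>
      simp [tabInsertWord, tabInsert, rowInsert, hbc.not_gt, hab, (hab.le.trans hbc).not_gt]
  | cons p t ih =>
    obtain ⟨h1, h2⟩ := rowInsertWord_knuthTriple h ht.2.1
    rw [tabInsertWord_cons, tabInsertWord_cons, h1]
    rcases h2 with h2 | h2 | h2
    · rw [h2]
    · rw [ih h2 ht.2.2.2]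
    · rw [ih h2 ht.2.2.2]

theorem tabInsertWord_append (u v : List ℕ) (t : List (List ℕ)) :
    tabInsertWord (u ++ v) t = tabInsertWord v (tabInsertWord u t) := List.foldl_append

theorem tabInsertWord_append_append {w w' : List ℕ} (h : KnuthTriple w w') (u v : List ℕ) :
    tabInsertWord (u ++ w ++ v) [] = tabInsertWord (u ++ w' ++ v) [] := by
  simp only [tabInsertWord_append]
  exact congrArg _ (tabInsertWord_knuthTriple h (isTableau_foldl_tabInsert u))

/-- The letters of colour `b` of a word. -/
def colourPart {B : Type*} [DecidableEq B] (b : B) (w : List (ℕ × B)) : List ℕ :=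
  (w.filter fun x => x.2 = b).map Prod.fst

theorem colourPart_append {B : Type*} [DecidableEq B] (b : B) (u v : List (ℕ × B)) :
    colourPart b (u ++ v) = colourPart b u ++ colourPart b v := by simp [colourPart]

theorem coloured_colourPart {B : Type*} [DecidableEq B] (b : B) (w : List (ℕ × B)) :
    coloured b (colourPart b w) = w.filter fun x => x.2 = b := by
  rw [coloured, colourPart, List.map_map]
  refine (List.map_congr_left fun x hx => ?_).trans (List.map_id _)
  have : x.2 = b := by simpa using (List.mem_filter.1 hx).2
  exact Prod.ext rfl this.symm

/-- An exchange of colours leaves every monochromatic subword unchanged, and a Knuth move affects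
only the subword of its own colour. -/
theorem Knuth.tabInsertWord_colourPart {B : Type*} [DecidableEq B] {w w' : List (ℕ × B)}
    (h : Knuth w w') (b : B) :
    tabInsertWord (colourPart b w) [] = tabInsertWord (colourPart b w') [] := by
  have key : ∀ (u v : List (ℕ × B)) {l l' : List ℕ} {β : B},
      KnuthTriple l l' ∨ KnuthTriple l' l → 
      tabInsertWord (colourPart b (u ++ coloured β l ++ v)) [] =
        tabInsertWord (colourPart b (u ++ coloured β l' ++ v)) [] := by
    intro u v l l' β h
    simp only [colourPart_append]
    by_cases hb : β = b
    · have : ∀ l, colourPart b (coloured β l) = l := fun l => by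
        simp [colourPart, coloured, hb, List.filter_map, Function.comp_def]
      rw [this, this]
      rcases h with h | h
      exacts [tabInsertWord_append_append h _ _, (tabInsertWord_append_append h _ _).symm]
    · have : ∀ l, colourPart b (coloured β l) = [] := fun l => by
        simp [colourPart, coloured, hb, List.filter_map, Function.comp_def]
      rw [this, this]
  cases h with
  | exchange u v x y h =>
    congr 1
    simp only [colourPart_append]
    congr 2
    simp only [colourPart, List.filter_cons, List.filter_nil]
    grind
  | acb_cab u v a b c β h h' => exact key u v (.inl (.acb_cab h h'))
  | cab_acb u v a b c β h h' => exact key u v (.inr (.acb_cab h h'))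
  | bac_bca u v a b c β h h' => exact key u v (.inl (.bac_bca h h'))
  | bca_bac u v a b c β h h' => exact key u v (.inr (.bac_bca h h'))

/-- Knuth's theorem for coloured words. -/
theorem knuthEquiv_of_tabInsertWord_eq {B : Type*} [Fintype B] [DecidableEq B]
    {w w' : List (ℕ × B)}
    (h : ∀ b, tabInsertWord (colourPart b w) [] = tabInsertWord (colourPart b w') []) :
    KnuthEquiv w w' := by
  -- A normal form that depends only on the insertion tableaux: separate the colours, then replace
  -- each subword by the reading word of its tableau.
  have key : ∀ w : List (ℕ × B), KnuthEquiv w (Finset.univ.toList.flatMap fun b =>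
      coloured b (readingWord (tabInsertWord (colourPart b w) []))) := by
    intro w
    refine (knuthEquiv_flatMap_filter (Finset.nodup_toList Finset.univ) (fun x _ => by simp)).trans ?_
    induction (Finset.univ : Finset B).toList with
    | nil => exact .refl _
    | cons b bs ih =>
      rw [List.flatMap_cons, List.flatMap_cons, ← coloured_colourPart]
      exact ((knuthEquiv_readingWord b _).append_right _).trans (ih.append_left _)
  have h1 := key w
  simp only [h] at h1
  exact h1.trans (key w').symm

/-! ### The Robinson-Schensted-Okada correspondence -/

section RSO

variable {B : Type*}

@[simp] theorem dual_fst (inv : B → B) {n : ℕ} (α : Wr B n) (i : Fin n) :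
    (dual inv α).1 i = inv (α.1 (α.2 i)) := by simp [dual, leftAct]

@[simp] theorem dual_snd (inv : B → B) {n : ℕ} (α : Wr B n) : (dual inv α).2 = α.2⁻¹ := by
  simp [dual, leftAct]

theorem dual_dual {inv : B → B} (hinv : Function.Involutive inv) {n : ℕ} (α : Wr B n) :
    dual inv (dual inv α) = α :=
  Prod.ext (funext fun i => by simp [hinv (α.1 i)]) (by simp)

/-- Knuth moves permute letters, so by this criterion they never leave the set of words of elements
of $B\wr\mathfrak S_n$. -/
theorem word_perm_iff {n : ℕ} {w : List (ℕ × B)} :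
    (∃ α : Wr B n, w = word α) ↔ (w.map Prod.fst).Perm
      ((List.finRange n).map fun i : Fin n => (i : ℕ) + 1) := by
  constructor
  · rintro ⟨α, rfl⟩
    rw [word, List.map_ofFn, List.ofFn_eq_map, Function.comp_def,
      show (fun i => (α.2 i : ℕ) + 1) = (fun i : Fin n => (i : ℕ) + 1) ∘ α.2 from rfl,
      ← List.map_map]
    refine List.Perm.map _ ?_
    rw [List.perm_ext_iff_of_nodup ((List.nodup_finRange n).map α.2.injective)
      (List.nodup_finRange n)]
    exact fun i => by simpa using ⟨α.2.symm i, by simp⟩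
  · intro h
    have hlen : w.length = n := by simpa using h.length_eq
    subst hlen
    have hmem : ∀ i : Fin w.length, ∃ k : Fin w.length, (k : ℕ) + 1 = w[i].1 := fun i => by
      simpa using h.mem_iff.1 (List.mem_map_of_mem (f := Prod.fst) (List.getElem_mem i.2))
    choose σ hσ using hmem
    have hnd : (w.map Prod.fst).Nodup := h.nodup_iff.2 <|
      (List.nodup_finRange _).map fun i j hij => Fin.ext (by simpa using hij)
    have hinj : Function.Injective σ := fun i j hij => by
      have : w[i].1 = w[j].1 := by rw [← hσ, ← hσ, hij]
      rw [List.nodup_iff_injective_get] at hnd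
      have := @hnd ⟨i, by simp⟩ ⟨j, by simp⟩ (by simpa using this)
      exact Fin.ext (by simpa using this)
    let τ : Equiv.Perm (Fin w.length) := Equiv.ofBijective σ (Finite.injective_iff_bijective.1 hinj)
    refine ⟨(fun v => w[τ.symm v].2, τ), ?_⟩
    refine List.ext_getElem (by simp [word]) fun i h1 h2 => ?_
    have := hσ ⟨i, h1⟩
    refine Prod.ext ?_ ?_
    · simpa [word, τ] using this.symm
    · simp [word]

theorem word_injective {n : ℕ} : Function.Injective (word : Wr B n → List (ℕ × B)) := by
  intro α β h
  have h1 := List.ofFn_injective h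
  have h2 : ∀ i, α.2 i = β.2 i := fun i => Fin.ext (by simpa using (congrArg Prod.fst (congrFun h1 i)))
  have h3 : ∀ i, α.1 (α.2 i) = β.1 (β.2 i) := fun i => congrArg Prod.snd (congrFun h1 i)
  have h4 : α.2 = β.2 := Equiv.ext h2
  refine Prod.ext (funext fun i => ?_) h4
  have := h3 (α.2⁻¹ i)
  rw [← h4] at this
  simpa using this

variable [DecidableEq B]

/-- The subword of `w(α)` formed by the letters of colour `b`, as a word in two lines. -/
def twoLine {n : ℕ} (α : Wr B n) (b : B) : List (ℕ × ℕ) :=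
  ((List.finRange n).filter fun i : Fin n => α.1 (α.2 i) = b).map
    fun i : Fin n => ((i : ℕ) + 1, (α.2 i : ℕ) + 1)

theorem rso_eq {n : ℕ} (α : Wr B n) (b : B) : rso α b = robinsonSchensted (twoLine α b) := rfl

theorem mem_twoLine {n : ℕ} {α : Wr B n} {b : B} {x : ℕ × ℕ} :
    x ∈ twoLine α b ↔ ∃ i : Fin n, α.1 (α.2 i) = b ∧ x = ((i : ℕ) + 1, (α.2 i : ℕ) + 1) := by
  simp [twoLine, eq_comm]

theorem pairwise_twoLine {n : ℕ} (α : Wr B n) (b : B) :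
    ((twoLine α b).map Prod.fst).Pairwise (· < ·) := by
  rw [twoLine, List.map_map, List.pairwise_map]
  exact (List.pairwise_lt_finRange n).filter _ |>.imp fun h => by simpa using h

theorem eq_of_pairwise_of_mem_iff {w w' : List (ℕ × ℕ)} (hw : (w.map Prod.fst).Pairwise (· < ·))
    (hw' : (w'.map Prod.fst).Pairwise (· < ·)) (h : ∀ x, x ∈ w ↔ x ∈ w') : w = w' := by
  rw [List.pairwise_map] at hw hw'
  refine List.Perm.eq_of_pairwise (le := fun x y => x.1 < y.1)
    (fun _ _ _ _ h h' => absurd h h'.not_gt) hw hw' ?_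
  exact (List.perm_ext_iff_of_nodup (hw.imp fun h => fun e => h.ne (congrArg _ e))
    (hw'.imp fun h => fun e => h.ne (congrArg _ e))).2 h

theorem twoLine_injective {n : ℕ} {α β : Wr B n} (h : ∀ b, twoLine α b = twoLine β b) : α = β := by
  refine word_injective ?_
  refine congrArg List.ofFn (funext fun i => ?_)
  have h1 : ((i : ℕ) + 1, (α.2 i : ℕ) + 1) ∈ twoLine β (α.1 (α.2 i)) := by
    rw [← h, mem_twoLine]; exact ⟨i, rfl, rfl⟩
  obtain ⟨j, hj, hij⟩ := mem_twoLine.1 h1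
  simp only [Prod.mk.injEq, Nat.add_right_cancel_iff] at hij
  obtain rfl := Fin.ext hij.1
  rw [hij.2, hj]

/-- Duality inverts the permutation and applies `inv` to colours, so it swaps the two lines of each
monochromatic subword. -/
theorem twoLine_dual {inv : B → B} (hinv : Function.Involutive inv) {n : ℕ} (α : Wr B n) (b : B) :
    (twoLine (dual inv α) b).Perm ((twoLine α (inv b)).map Prod.swap) := by
  have hnd : ∀ {w : List (ℕ × ℕ)}, (w.map Prod.fst).Pairwise (· < ·) → w.Nodup := fun hw =>
    (List.pairwise_map.1 hw).imp fun h e => h.ne (congrArg _ e)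
  rw [List.perm_ext_iff_of_nodup (hnd (pairwise_twoLine _ _))
    ((hnd (pairwise_twoLine _ _)).map Prod.swap_injective)]
  intro x
  simp only [mem_twoLine, List.mem_map, dual_fst, dual_snd]
  constructor
  · rintro ⟨i, hi, rfl⟩
    exact ⟨_, ⟨α.2⁻¹ i, by simpa [← hi] using (hinv _).symm, rfl⟩, by simp⟩
  · rintro ⟨_, ⟨i, hi, rfl⟩, rfl⟩
    exact ⟨α.2 i, by simp [hi, hinv b], by simp⟩

theorem rso_dual {inv : B → B} (hinv : Function.Involutive inv) {n : ℕ} (α : Wr B n) (b : B) :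
    rso (dual inv α) b = (rso α (inv b)).map Prod.swap :=
  robinsonSchensted_inverse (pairwise_twoLine _ _) (pairwise_twoLine _ _) (twoLine_dual hinv α b)

theorem recordRows_dual {inv : B → B} (hinv : Function.Involutive inv) {n : ℕ} (α : Wr B n)
    (b : B) : recordRows (dual inv α) b = insertionRows α (inv b) := by
  simp [recordRows, insertionRows, rso_dual hinv, Function.comp_def]

theorem insertionRows_eq {n : ℕ} (α : Wr B n) (b : B) :
    insertionRows α b = tabInsertWord (colourPart b (word α)) [] := by
  rw [insertionRows, rso_eq, map_fst_robinsonSchensted, tabInsertWord]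
  congr 1
  simp only [twoLine, colourPart, word, List.ofFn_eq_map, List.filter_map, List.map_map,
    Function.comp_def]

theorem Knuth.insertionRows_eq {n : ℕ} {α β : Wr B n} (h : Knuth (word α) (word β)) :
    insertionRows α = insertionRows β :=
  funext fun b => by
    rw [FQ.insertionRows_eq, FQ.insertionRows_eq, h.tabInsertWord_colourPart]

theorem knuthEquiv_word [Fintype B] {n : ℕ} {α β : Wr B n}
    (h : insertionRows α = insertionRows β) : KnuthEquiv (word α) (word β) :=
  knuthEquiv_of_tabInsertWord_eq fun b => by
    rw [← insertionRows_eq, ← insertionRows_eq, h]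

theorem length_insertionRows {n : ℕ} (α : Wr B n) (b : B) :
    (insertionRows α b).map List.length = (recordRows α b).map List.length := by
  rw [insertionRows, recordRows, List.map_map, List.map_map]
  exact List.map_congr_left (sameShape_robinsonSchensted (twoLine α b))

theorem eq_of_rows_eq {n : ℕ} {α β : Wr B n} (h : insertionRows α = insertionRows β)
    (h' : recordRows α = recordRows β) : α = β := by
  refine twoLine_injective fun b => robinsonSchensted_injective (pairwise_twoLine _ _)
    (pairwise_twoLine _ _) ?_
  have h1 := congrFun h b
  have h2 := congrFun h' b
  rw [insertionRows, insertionRows, rso_eq, rso_eq] at h1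
  rw [recordRows, recordRows, rso_eq, rso_eq] at h2
  rw [← List.zip_unzip (robinsonSchensted (twoLine α b)),
    ← List.zip_unzip (robinsonSchensted (twoLine β b))]
  simp only [List.unzip_eq_map, h1, h2]

variable [Fintype B]

/-- The families of lists of rows that come from standard `B`-tableaux with `n` boxes. -/
def IsStandardRows (n : ℕ) (R : B → List (List ℕ)) : Prop :=
  (∀ b, IsTableau (R b)) ∧ ∑ b, ((R b).flatten : Multiset ℕ) = (Finset.Icc 1 n).val

theorem sum_filter_map {ι : Type*} (l : List ι) (c : ι → B) (f : ι → ℕ) :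
    ∑ b, (((l.filter fun i => c i = b).map f : List ℕ) : Multiset ℕ) = (l.map f : List ℕ) := by
  induction l with
  | nil => simp
  | cons x l ih =>
    have : ∀ b, ((((x :: l).filter fun i => c i = b).map f : List ℕ) : Multiset ℕ) =
        (if c x = b then {f x} else 0) + ((l.filter fun i => c i = b).map f : List ℕ) := by
      intro b
      by_cases h : c x = b <;> simp [h]
    simp_rw [this]
    rw [Finset.sum_add_distrib, ih]
    simp

theorem coe_map_finRange (n : ℕ) (σ : Equiv.Perm (Fin n)) :
    (((List.finRange n).map fun i => (σ i : ℕ) + 1 : List ℕ) : Multiset ℕ) =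
      (Finset.Icc 1 n).val := by
  refine (Multiset.Nodup.ext ?_ (Finset.nodup _)).2 fun a => ?_
  · exact (List.nodup_finRange _).map fun i j hij => σ.injective (Fin.ext (by simpa using hij))
  · simp only [Multiset.mem_coe, List.mem_map, List.mem_finRange, true_and, Finset.mem_val,
      Finset.mem_Icc]
    constructor
    · rintro ⟨i, rfl⟩; have := (σ i).2; omega
    · rintro ⟨h1, h2⟩
      exact ⟨σ.symm ⟨a - 1, by omega⟩, by simp; omega⟩

theorem isStandardRows_insertionRows {n : ℕ} (α : Wr B n) :
    IsStandardRows n (insertionRows α) := by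
  refine ⟨fun b => isTableau_map_fst_robinsonSchensted _, ?_⟩
  rw [← coe_map_finRange n α.2, ← sum_filter_map (List.finRange n) (fun i => α.1 (α.2 i))]
  refine Finset.sum_congr rfl fun b _ => Multiset.coe_eq_coe.2 ?_
  refine (letters_robinsonSchensted (twoLine α b)).trans ?_
  simp [twoLine, Function.comp_def]

theorem isStandardRows_recordRows {n : ℕ} (α : Wr B n) : IsStandardRows n (recordRows α) := by
  -- The symmetry, with trivial involution of the colours, turns record tableaux into insertion
  -- tableaux.
  have h : ∀ b, recordRows α b = insertionRows (dual id α) b := fun b => by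
    rw [← id_eq b, ← recordRows_dual (inv := id) (fun _ => rfl),
      dual_dual (inv := id) (fun _ => rfl), id_eq]
  rw [funext h]
  exact isStandardRows_insertionRows _

/-- Surjectivity of RSO: reverse insertion gives a two-line word for each colour, and standardness
says that their labels and letters each partition $\{1,\dots,n\}$, so these words glue to a coloured
permutation. -/
theorem exists_of_isStandardRows {n : ℕ} {R R' : B → List (List ℕ)} (hR : IsStandardRows n R)
    (hR' : IsStandardRows n R')
    (h : ∀ b, (R b).map List.length = (R' b).map List.length) :
    ∃ α : Wr B n, insertionRows α = R ∧ recordRows α = R' := by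
  have hlen : ∀ b, (R b).length = (R' b).length := fun b => by
    simpa using congrArg List.length (h b)
  have hfst : ∀ b, ((R b).zip (R' b)).map Prod.fst = R b := fun b =>
    List.map_fst_zip (hlen b).le
  have hsnd : ∀ b, ((R b).zip (R' b)).map Prod.snd = R' b := fun b =>
    List.map_snd_zip (hlen b).ge
  have hnd : ∀ {R : B → List (List ℕ)}, IsStandardRows n R → ∀ b, (R b).flatten.Nodup := by
    intro R hR b
    rw [← Multiset.coe_nodup]
    exact Multiset.nodup_of_le
      (Finset.single_le_sum (f := fun b => ((R b).flatten : Multiset ℕ)) (fun _ _ => Multiset.zero_le _) (Finset.mem_univ b))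
      (hR.2 ▸ Finset.nodup _)
  have hmem : ∀ {R : B → List (List ℕ)}, IsStandardRows n R → ∀ {a : ℕ},
      (∃ b, a ∈ (R b).flatten) ↔ 1 ≤ a ∧ a ≤ n := by
    intro R hR a
    rw [← Finset.mem_Icc, ← Finset.mem_val, ← hR.2, Multiset.mem_sum]
    simp only [Finset.mem_univ, true_and, Multiset.mem_coe]
  have huniq : ∀ {R : B → List (List ℕ)}, IsStandardRows n R → ∀ {a : ℕ} {b b' : B},
      a ∈ (R b).flatten → a ∈ (R b').flatten → b = b' := by
    intro R hR a b b' hb hb'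
    by_contra hne
    have h1 : ((R b).flatten : Multiset ℕ) + (R b').flatten ≤ (Finset.Icc 1 n).val := by
      rw [← hR.2, ← Finset.sum_pair (f := fun b => ((R b).flatten : Multiset ℕ)) hne]
      exact Finset.sum_le_sum_of_subset (Finset.subset_univ _)
    have h2 := Multiset.nodup_of_le h1 (Finset.nodup _)
    exact (Multiset.disjoint_left.1 (Multiset.nodup_add.1 h2).2.2) hb hb'
  have hpair : ∀ b, IsTableauPair ((R b).zip (R' b)) := fun b => by
    refine ⟨by rw [hfst]; exact hR.1 b, by rw [hsnd]; exact hR'.1 b, ?_⟩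
    have h1 := h b
    rw [← hfst b, ← hsnd b, List.map_map, List.map_map] at h1
    simp only [hsnd] at h1
    exact List.map_inj_left.1 h1
  have hex := fun b => exists_robinsonSchensted_eq (hpair b) (by
    rw [labels, hsnd]; exact hnd hR' b)
  choose w hw hrs using hex
  have hletters : ∀ b, ((R b).flatten).Perm ((w b).map Prod.snd) := fun b => by
    have := letters_robinsonSchensted (w b)
    rwa [hrs, letters, hfst] at this
  have hlabels : ∀ b, ((R' b).flatten).Perm ((w b).map Prod.fst) := fun b => by
    have := labels_robinsonSchensted (w b)
    rwa [hrs, labels, hsnd] at this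
  -- Each label lies in one component of `R'`; its column there supplies the colour and the value,
  -- shifted to the numbering from `0`.
  have hchoice : ∀ i : Fin n, ∃ (b : B) (k : Fin n), ((i : ℕ) + 1, (k : ℕ) + 1) ∈ w b := by
    intro i
    obtain ⟨b, hb⟩ := (hmem hR' (a := (i : ℕ) + 1)).2 ⟨by omega, i.2⟩
    obtain ⟨⟨l, a⟩, hx, rfl⟩ := List.mem_map.1 ((hlabels b).mem_iff.1 hb)
    have ha := (hmem hR (a := a)).1
      ⟨b, (hletters b).mem_iff.2 (List.mem_map_of_mem (f := Prod.snd) hx)⟩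
    refine ⟨b, ⟨a - 1, by omega⟩, ?_⟩
    rwa [Nat.sub_add_cancel ha.1]
  choose c σ hcσ using hchoice
  have hlab : ∀ {x : ℕ × ℕ} {b : B}, x ∈ w b → x.1 ∈ (R' b).flatten := fun hx =>
    (hlabels _).mem_iff.2 (List.mem_map_of_mem (f := Prod.fst) hx)
  have hlet : ∀ {x : ℕ × ℕ} {b : B}, x ∈ w b → x.2 ∈ (R b).flatten := fun hx =>
    (hletters _).mem_iff.2 (List.mem_map_of_mem (f := Prod.snd) hx)
  have hinj : Function.Injective σ := fun i j hij => by
    have h1 := hcσ i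
    have h2 := hcσ j
    rw [← hij] at h2
    have hl1 := hlet h1
    have hl2 := hlet h2
    have hb := huniq hR hl1 hl2
    rw [← hb] at h2
    have h3 := List.inj_on_of_nodup_map ((hletters (c i)).nodup_iff.1 (hnd hR _)) h1 h2 rfl
    exact Fin.ext (by simpa using h3)
  let τ : Equiv.Perm (Fin n) := Equiv.ofBijective σ (Finite.injective_iff_bijective.1 hinj)
  let α : Wr B n := (fun v => c (τ.symm v), τ)
  have hα : ∀ b, twoLine α b = w b := fun b => by
    refine eq_of_pairwise_of_mem_iff (pairwise_twoLine _ _) (hw b) fun x => ?_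
    rw [mem_twoLine]
    constructor
    · rintro ⟨i, hi, rfl⟩
      have : c i = b := by simpa [α] using hi
      exact this ▸ hcσ i
    · intro hx
      have h1 := (hmem hR').1 ⟨b, hlab hx⟩
      have h2 := hcσ ⟨x.1 - 1, by omega⟩
      have h3 : x.1 - 1 + 1 = x.1 := by omega
      simp only [h3] at h2
      have hl1 := hlab hx
      have hl2 := hlab h2
      have hb := huniq hR' hl1 hl2
      rw [← hb] at h2
      have h4 := List.inj_on_of_nodup_map ((hlabels b).nodup_iff.1 (hnd hR' _)) hx h2 rfl
      exact ⟨⟨x.1 - 1, by omega⟩, by simp [α, ← hb], 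
        Prod.ext h3.symm (by simpa [α, τ] using congrArg Prod.snd h4)⟩
  exact ⟨α, funext fun b => by rw [insertionRows, rso_eq, hα, hrs, hfst],
    funext fun b => by rw [recordRows, rso_eq, hα, hrs, hsnd]⟩

end RSO

/-! ### Tableaux and lists of rows -/

theorem dominates_iff {p q : List ℕ} :
    Dominates p q ↔ q.length ≤ p.length ∧ ∀ i, i < q.length → p.getD i 0 < q.getD i 0 := by
  induction q generalizing p with
  | nil => simp
  | cons y q ih =>
    cases p with
    | nil => simp
    | cons x p =>
      rw [cons_dominates_cons, ih]
      constructor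
      · rintro ⟨h1, h2, h3⟩
        refine ⟨by simpa using h2, fun i hi => ?_⟩
        cases i with
        | zero => simpa using h1
        | succ i => simpa using h3 i (by simpa using hi)
      · rintro ⟨h2, h3⟩
        exact ⟨by simpa using h3 0 (by simp), by simpa using h2,
          fun i hi => by simpa using h3 (i + 1) (by simpa using hi)⟩

theorem Dominates.trans {p q r : List ℕ} (h : Dominates p q) (h' : Dominates q r) :
    Dominates p r := by
  rw [dominates_iff] at *
  exact ⟨h'.1.trans h.1, fun i hi => (h.2 i (hi.trans_le h'.1)).trans (h'.2 i hi)⟩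

theorem isTableau_iff {t : List (List ℕ)} :
    IsTableau t ↔ (∀ p ∈ t, p ≠ [] ∧ p.Pairwise (· ≤ ·)) ∧ t.Pairwise Dominates := by
  induction t with
  | nil => simp
  | cons p t ih =>
    rw [isTableau_cons, ih, List.forall_mem_cons, List.pairwise_cons]
    constructor
    · rintro ⟨h1, h2, h3, h4, h5⟩
      refine ⟨⟨⟨h1, h2⟩, h4⟩, fun q hq => ?_, h5⟩
      cases t with
      | nil => simp at hq
      | cons r t =>
        rcases List.mem_cons.1 hq with rfl | hq
        exacts [h3, Dominates.trans h3 ((List.pairwise_cons.1 h5).1 q hq)]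
    · rintro ⟨⟨⟨h1, h2⟩, h4⟩, h3, h5⟩
      refine ⟨h1, h2, ?_, h4, h5⟩
      cases t with
      | nil => simp
      | cons r t => exact h3 r (by simp)

theorem Tableau.isTableau_rows (T : Tableau) : IsTableau T.rows := by
  rw [isTableau_iff, Tableau.rows]
  constructor
  · intro p hp
    obtain ⟨i, hi, rfl⟩ := List.mem_map.1 hp
    rw [List.mem_range, ← YoungDiagram.mem_iff_lt_colLen, YoungDiagram.mem_iff_lt_rowLen] at hi
    refine ⟨by simpa using hi.ne', ?_⟩
    rw [List.pairwise_map]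
    refine List.Pairwise.imp_of_mem (fun _ hb h => ?_) List.pairwise_lt_range
    exact T.2.row_weak h (YoungDiagram.mem_iff_lt_rowLen.2 (List.mem_range.1 hb))
  · rw [List.pairwise_map]
    refine List.pairwise_lt_range.imp fun {i j} h => dominates_iff.2 ⟨?_, fun k hk => ?_⟩
    · simpa using T.1.rowLen_anti i j h.le
    · have h1 : k < T.1.rowLen j := by simpa using hk
      have h2 : k < T.1.rowLen i := h1.trans_le (T.1.rowLen_anti i j h.le)
      have h3 := T.2.col_strict h (YoungDiagram.mem_iff_lt_rowLen.2 h1)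
      simpa [h1, h2] using h3

theorem Tableau.map_length_rows (T : Tableau) : T.rows.map List.length = T.1.rowLens := by
  simp [Tableau.rows, YoungDiagram.rowLens, Function.comp_def]

theorem Tableau.flatten_rows (T : Tableau) : (T.rows.flatten : Multiset ℕ) = T.weight := by
  have h : (((List.range (T.1.colLen 0)).flatMap fun i =>
      (List.range (T.1.rowLen i)).map fun j => (i, j) : List (ℕ × ℕ)) : Multiset (ℕ × ℕ)) =
      T.1.cells.val := by
    refine (Multiset.Nodup.ext ?_ T.1.cells.nodup).2 fun ⟨i, j⟩ => ?_
    · rw [Multiset.coe_nodup, List.nodup_flatMap]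
      refine ⟨fun i _ => List.nodup_range.map fun _ _ h => (Prod.mk.inj h).2,
        List.nodup_range.imp fun {i j} h => ?_⟩
      rw [Function.onFun, List.disjoint_left]
      rintro x hx hx'
      simp only [List.mem_map] at hx hx'
      obtain ⟨_, _, rfl⟩ := hx
      obtain ⟨_, _, h'⟩ := hx'
      exact h (Prod.mk.inj h').1.symm
    · simp only [Multiset.mem_coe, List.mem_flatMap, List.mem_range, List.mem_map, Prod.mk.injEq,
        Finset.mem_val, YoungDiagram.mem_cells]
      constructor
      · rintro ⟨_, _, _, h, rfl, rfl⟩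
        exact YoungDiagram.mem_iff_lt_rowLen.2 h
      · intro h
        exact ⟨i, YoungDiagram.mem_iff_lt_colLen.1 (T.1.up_left_mem le_rfl (Nat.zero_le j) h), j,
          YoungDiagram.mem_iff_lt_rowLen.1 h, rfl, rfl⟩
  rw [Tableau.weight, ← h, Multiset.map_coe, List.map_flatMap, Tableau.rows, List.flatMap_def]
  simp [Function.comp_def]

theorem Tableau.card_weight (T : Tableau) : Multiset.card T.weight = T.1.card := by
  simp [Tableau.weight, YoungDiagram.card]

theorem exists_tableau_rows_eq {t : List (List ℕ)} (ht : IsTableau t) :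
    ∃ T : Tableau, T.rows = t := by
  rw [isTableau_iff] at ht
  obtain ⟨h1, h2⟩ := ht
  have hw : (t.map List.length).SortedGE := by
    refine List.Pairwise.sortedGE ?_
    rw [List.pairwise_map]
    exact h2.imp fun h => (dominates_iff.1 h).1
  have hpos : ∀ x ∈ t.map List.length, 0 < x := by
    simp only [List.mem_map, forall_exists_index, and_imp, forall_apply_eq_imp_iff₂]
    exact fun p hp => List.length_pos_iff.2 (h1 p hp).1
  have hmem : ∀ {i j : ℕ}, (i, j) ∈ YoungDiagram.ofRowLens _ hw ↔
      ∃ h : i < t.length, j < t[i].length := by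
    intro i j
    simp [YoungDiagram.mem_ofRowLens]
  let T : SemistandardYoungTableau (YoungDiagram.ofRowLens _ hw) :=
    -- The default values are the zeros that a semistandard tableau must have outside its diagram.
    { entry := fun i j => (t.getD i []).getD j 0
      row_weak' := by
        intro i j k hjk hk
        obtain ⟨hi, hk⟩ := hmem.1 hk
        have h3 := List.pairwise_iff_getElem.1 (h1 _ (List.getElem_mem hi)).2 j k
          (hjk.trans hk) hk hjk
        simpa [hi, hk, hjk.trans hk] using h3
      col_strict' := by
        intro i k j hik hk
        obtain ⟨hk, hj⟩ := hmem.1 hk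
        have hi := hik.trans hk
        have h3 := List.pairwise_iff_getElem.1 h2 i k hi hk hik
        rw [List.getD_eq_getElem _ _ hi, List.getD_eq_getElem _ _ hk]
        exact (dominates_iff.1 h3).2 j hj
      zeros' := by
        intro i j hij
        rw [hmem] at hij
        by_cases hi : i < t.length
        · have : t[i].length ≤ j := not_lt.1 fun h => hij ⟨hi, h⟩
          simp [hi, this]
        · simp [not_lt.1 hi] }
  have hlen : (YoungDiagram.ofRowLens _ hw).colLen 0 = t.length := by
    rw [← YoungDiagram.length_rowLens, YoungDiagram.rowLens_length_ofRowLens hpos]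
    simp
  refine ⟨⟨_, T⟩, List.ext_getElem (by simpa [Tableau.rows] using hlen) fun i hi hi' => ?_⟩
  have hrow : (YoungDiagram.ofRowLens _ hw).rowLen i = t[i].length := by
    have := YoungDiagram.rowLen_ofRowLens (hw := hw) ⟨i, by simpa using hi'⟩
    simpa using this
  refine List.ext_getElem (by simpa [Tableau.rows] using hrow) fun j hj hj' => ?_
  simp only [Tableau.rows, List.getElem_map, List.getElem_range]
  change (t.getD i []).getD j 0 = _
  simp [hi', hj']

theorem rowLens_injective {μ ν : YoungDiagram} (h : μ.rowLens = ν.rowLens) : μ = ν :=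
  YoungDiagram.equivListRowLens.injective (Subtype.ext h)

section BTableau

theorem shape_eq_iff {B : Type*} {T T' : BTableau B} : T.shape = T'.shape ↔
    ∀ b, (T b).rows.map List.length = (T' b).rows.map List.length := by
  simp only [Tableau.map_length_rows, funext_iff, BTableau.shape]
  exact forall_congr' fun b => ⟨fun h => by rw [h], rowLens_injective⟩

variable {B : Type*} [Fintype B]

theorem sum_flatten_rows (T : BTableau B) :
    ∑ b, ((T b).rows.flatten : Multiset ℕ) = ∑ b, (T b).weight :=
  Finset.sum_congr rfl fun b _ => (T b).flatten_rows

theorem BTableau.IsStandard.isStandardRows {T : BTableau B} (h : T.IsStandard) :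
    IsStandardRows T.size fun b => (T b).rows :=
  ⟨fun b => (T b).isTableau_rows, (sum_flatten_rows T).trans h⟩

theorem exists_isStandard_rows_eq {n : ℕ} {R : B → List (List ℕ)} (h : IsStandardRows n R) :
    ∃ T : BTableau B, T.IsStandard ∧ T.size = n ∧ (fun b => (T b).rows) = R := by
  choose T hT using fun b => exists_tableau_rows_eq (h.1 b)
  have h1 : ∑ b, (T b).weight = (Finset.Icc 1 n).val := by
    rw [← h.2, ← sum_flatten_rows]
    simp only [hT]
  have h2 : BTableau.size T = n := by
    have := congrArg Multiset.card h1
    simpa [Multiset.card_sum, Tableau.card_weight, BTableau.size, BTableau.shape] using this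
  exact ⟨T, by rw [BTableau.IsStandard, h1, h2], h2, funext hT⟩

end BTableau

/-! ### Sums over fibers in free modules -/

section Fibers

variable {K : Type*} [CommRing K] {S X Y : Type*}

/-- Subtracting from each basis element the representative of its fiber costs nothing, since the
representatives sum to zero. Keeping one element in the support of `x` later gives control of
degrees. -/
theorem mem_span_of_mapDomain_eq_zero (g : S → X) {x : S →₀ K} (hx : x.mapDomain g = 0) :
    x ∈ Submodule.span K {y | ∃ s ∈ x.support, ∃ s', g s = g s' ∧
      y = Finsupp.single s (1 : K) - Finsupp.single s' 1} := by
  classical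
  rcases isEmpty_or_nonempty S with hS | hS
  · rw [Subsingleton.elim x 0]; exact zero_mem _
  have h1 : x.mapDomain (Function.invFun g ∘ g) = 0 := by
    rw [Finsupp.mapDomain_comp, hx, Finsupp.mapDomain_zero]
  have h2 : x = ∑ s ∈ x.support, x s •
      (Finsupp.single s (1 : K) - Finsupp.single (Function.invFun g (g s)) 1) := by
    simp only [smul_sub, Finset.sum_sub_distrib, Finsupp.smul_single, smul_eq_mul, mul_one]
    rw [Finsupp.mapDomain, Finsupp.sum] at h1
    simp only [Function.comp_apply] at h1
    rw [h1, sub_zero]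
    exact (Finsupp.sum_single x).symm
  rw [h2]
  refine Submodule.sum_mem _ fun s hs => Submodule.smul_mem _ _ (Submodule.subset_span ?_)
  exact ⟨s, h2 ▸ hs, _, (Function.invFun_eq ⟨s, rfl⟩).symm, rfl⟩

theorem single_sub_single_mem_ker (g : S → X) {s s' : S} (h : g s = g s') :
    Finsupp.single s (1 : K) - Finsupp.single s' 1 ∈ LinearMap.ker (Finsupp.lmapDomain K K g) := by
  rw [LinearMap.mem_ker, map_sub]
  simp [Finsupp.lmapDomain_apply, h]

variable {f g : S → X} {sh : X → Y} (hf : ∀ k, (f ⁻¹' {k}).Finite)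

/-- The sum of the elements of a finite fiber. -/
noncomputable def fiberSum (K : Type*) [CommRing K] (hf : ∀ k, (f ⁻¹' {k}).Finite) (k : X) :
    S →₀ K :=
  ∑ s ∈ (hf k).toFinset, Finsupp.single s 1

open scoped Classical in
theorem fiberSum_apply (k : X) (s : S) : fiberSum K hf k s = if f s = k then 1 else 0 := by
  simp [fiberSum, Finsupp.finsetSum_apply, Finsupp.single_apply]

/-- The linear map that sends a basis element to the sum of the elements of its fiber. -/
noncomputable def fiberSums (K : Type*) [CommRing K] (hf : ∀ k, (f ⁻¹' {k}).Finite) :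
    (X →₀ K) →ₗ[K] (S →₀ K) :=
  Finsupp.linearCombination K (fiberSum K hf)

theorem fiberSums_single (k : X) : fiberSums K hf (Finsupp.single k 1) = fiberSum K hf k := by
  simp [fiberSums]

/-- Taking fiber sums is pulling back functions along `f`; this is what turns spans of fiber sums
into constancy conditions. -/
theorem fiberSums_apply (y : X →₀ K) (s : S) : fiberSums K hf y s = y (f s) := by
  classical
  induction y using Finsupp.induction_linear with
  | zero => simp
  | add y z hy hz => simp [hy, hz]
  | single k a => simp [fiberSums, fiberSum_apply, Finsupp.single_apply, eq_comm]

theorem mem_range_fiberSums (hsurj : Function.Surjective f) {x : S →₀ K} :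
    x ∈ LinearMap.range (fiberSums K hf) ↔ ∀ s s', f s = f s' → x s = x s' := by
  constructor
  · rintro ⟨y, rfl⟩ s s' h
    rw [fiberSums_apply, fiberSums_apply, h]
  · intro h
    have hr := Function.rightInverse_surjInv hsurj
    refine ⟨x.comapDomain (Function.surjInv hsurj) hr.injective.injOn, Finsupp.ext fun s => ?_⟩
    rw [fiberSums_apply, Finsupp.comapDomain_apply]
    exact h _ _ (hr (f s))

theorem range_fiberSums :
    LinearMap.range (fiberSums K hf) = Submodule.span K (Set.range (fiberSum K hf)) :=
  Finsupp.range_linearCombination K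

/-- The elements of the set `S` correspond bijectively to the pairs of elements of `X` with the same
image in `Y`. -/
structure IsPairing (f g : S → X) (sh : X → Y) : Prop where
  eq : ∀ s, sh (g s) = sh (f s)
  exists_eq : ∀ k k', sh k = sh k' → ∃ s, g s = k ∧ f s = k'
  unique : ∀ s s', g s = g s' → f s = f s' → s = s'

theorem IsPairing.surjective (h : IsPairing f g sh) : Function.Surjective f := fun k =>
  (h.exists_eq k k rfl).imp fun _ hs => hs.2

/-- For `k` and `k'` of equal shape exactly one `s` has `g s = k` and `f s = k'`; for different
shapes there is none. So only the total of `y` over the shape of `k` is seen. -/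
theorem IsPairing.mapDomain_fiberSums (h : IsPairing f g sh) (y : X →₀ K) (k : X) :
    (fiberSums K hf y).mapDomain g k = y.mapDomain sh (sh k) := by
  classical
  induction y using Finsupp.induction_linear with
  | zero => simp
  | add y z hy hz => simp [Finsupp.mapDomain_add, hy, hz]
  | single k' a =>
    have h1 : fiberSums K hf (Finsupp.single k' a) =
        ∑ s ∈ (hf k').toFinset, Finsupp.single s a := by
      simp [fiberSums, fiberSum, Finset.smul_sum]
    rw [h1, Finsupp.mapDomain_finsetSum, Finsupp.finsetSum_apply, Finsupp.mapDomain_single]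
    simp only [Finsupp.mapDomain_single, Finsupp.single_apply]
    by_cases hk : sh k' = sh k
    · obtain ⟨s, hs1, hs2⟩ := h.exists_eq k k' hk.symm
      rw [if_pos hk, Finset.sum_eq_single s]
      · simp [hs1]
      · intro s' hs' hne
        rw [if_neg fun h' => hne (h.unique _ _ (h'.trans hs1.symm) ?_)]
        simpa [hs2] using hs'
      · intro hs
        simp [hs2] at hs
    · rw [if_neg hk]
      refine Finset.sum_eq_zero fun s hs => if_neg fun h' => hk ?_
      have : f s = k' := by simpa using hs
      rw [← this, ← h', h.eq]

/-- A combination of fiber sums is killed by the pushforward exactly when its coefficients sum to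
zero on each shape, that is, when it is generated by differences inside a shape. -/
theorem IsPairing.range_inf_ker (h : IsPairing f g sh) :
    LinearMap.range (fiberSums K hf) ⊓ LinearMap.ker (Finsupp.lmapDomain K K g) =
      Submodule.span K {x | ∃ k k', sh k = sh k' ∧ x = fiberSum K hf k - fiberSum K hf k'} := by
  apply le_antisymm
  · rintro _ ⟨⟨y, rfl⟩, hy⟩
    have h1 : y.mapDomain sh = 0 := by
      ext z
      by_cases hz : z ∈ Set.range sh
      · obtain ⟨k, rfl⟩ := hz
        rw [← h.mapDomain_fiberSums hf]
        exact DFunLike.congr_fun (LinearMap.mem_ker.1 hy) k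
      · exact Finsupp.mapDomain_of_notMem_range _ _ hz
    have h2 := Submodule.mem_map_of_mem (f := fiberSums K hf) (mem_span_of_mapDomain_eq_zero sh h1)
    rw [Submodule.map_span] at h2
    refine Submodule.span_mono ?_ h2
    rintro _ ⟨_, ⟨k, -, k', hk, rfl⟩, rfl⟩
    exact ⟨k, k', hk, by rw [map_sub, fiberSums_single, fiberSums_single]⟩
  · rw [Submodule.span_le]
    rintro _ ⟨k, k', hk, rfl⟩
    rw [← fiberSums_single, ← fiberSums_single, ← map_sub]
    refine ⟨⟨_, rfl⟩, Finsupp.ext fun l => ?_⟩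
    rw [Finsupp.lmapDomain_apply, h.mapDomain_fiberSums hf]
    exact DFunLike.congr_fun (LinearMap.mem_ker.1 (single_sub_single_mem_ker sh hk)) (sh l)

/-- The sum of the two submodules consists of the `x` whose pushforward along `g` is constant on
each shape; subtracting the value at a chosen representative gives an idempotent that measures the
defect. -/
theorem IsPairing.exists_isCompl (h : IsPairing f g sh) :
    ∃ C : Submodule K (S →₀ K), IsCompl
      (LinearMap.range (fiberSums K hf) ⊔ LinearMap.ker (Finsupp.lmapDomain K K g)) C := by
  classical
  rcases isEmpty_or_nonempty X with hX | hX
  · have : IsEmpty S := ⟨fun s => hX.false (f s)⟩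
    exact ⟨⊥, by rw [Subsingleton.elim (_ ⊔ _) ⊤]; exact isCompl_top_bot⟩
  choose σ hσ using fun k => h.exists_eq k k rfl
  -- `r` picks one representative per shape.
  let r : X → X := fun k => Function.invFun sh (sh k)
  have hr : ∀ k, sh (r k) = sh k := fun k => Function.invFun_eq ⟨k, rfl⟩
  have hr' : ∀ {k k'}, sh k = sh k' → r k = r k' := fun hk => congrArg (Function.invFun sh) hk
  let M : (S →₀ K) →ₗ[K] (X →₀ K) := Finsupp.lmapDomain K K g
  let J := fiberSums K hf
  let L : (X →₀ K) →ₗ[K] (S →₀ K) := Finsupp.lmapDomain K K σ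
  -- Keeping only the coefficients at representatives makes the total over a shape equal to the
  -- value at its representative.
  let E₀ : (X →₀ K) →ₗ[K] (X →₀ K) :=
    Finsupp.linearCombination K fun k => if k = r k then Finsupp.single k 1 else 0
  have hMJ : ∀ y k, M (J y) k = y.mapDomain sh (sh k) := h.mapDomain_fiberSums hf
  have hML : ∀ y, M (L y) = y := fun y => by
    simp only [M, L, Finsupp.lmapDomain_apply]
    rw [← Finsupp.mapDomain_comp, show g ∘ σ = id from funext fun k => (hσ k).1,
      Finsupp.mapDomain_id]
  have hE : ∀ y k, M (J (E₀ y)) k = y (r k) := fun y k => by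
    rw [hMJ]
    induction y using Finsupp.induction_linear with
    | zero => simp
    | add y z hy hz => simp [Finsupp.mapDomain_add, hy, hz]
    | single k' a =>
      simp only [E₀, Finsupp.linearCombination_single, Finsupp.single_apply]
      by_cases hk : k' = r k'
      · rw [if_pos hk, Finsupp.smul_single, Finsupp.mapDomain_single, Finsupp.single_apply]
        by_cases hs : sh k' = sh k
        · rw [if_pos hs, if_pos (hk.trans (hr' hs))]; simp
        · rw [if_neg hs, if_neg fun h' => hs (by rw [h', hr])]
      · rw [if_neg hk, if_neg fun h' => hk (by rw [h', hr' (hr k)])]; simp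
  -- `L` is a section of `M`; `G x` lifts the defect `M x - (M x) ∘ r`. This defect vanishes at
  -- representatives, hence `G` is idempotent.
  let G : (S →₀ K) →ₗ[K] (S →₀ K) := L ∘ₗ (LinearMap.id - M ∘ₗ J ∘ₗ E₀) ∘ₗ M
  have hMG : ∀ x k, M (G x) k = M x k - M x (r k) := fun x k => by
    simp only [G, LinearMap.comp_apply, hML, LinearMap.sub_apply, LinearMap.id_apply,
      Finsupp.sub_apply, hE]
  have hG : IsIdempotentElem G := by
    refine LinearMap.ext fun x => ?_
    have h1 : M (G x) - M (J (E₀ (M (G x)))) = M x - M (J (E₀ (M x))) := by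
      ext k
      rw [Finsupp.sub_apply, Finsupp.sub_apply, hE, hE, hMG, hMG, hr' (hr k)]
      ring
    exact congrArg L h1
  have hker : LinearMap.ker G =
      LinearMap.range J ⊔ LinearMap.ker M := by
    apply le_antisymm
    · intro x hx
      have h1 : M x = M (J (E₀ (M x))) := by
        ext k
        have := hMG x k
        rw [LinearMap.mem_ker.1 hx, map_zero, Finsupp.zero_apply] at this
        rw [hE]; exact (sub_eq_zero.1 this.symm)
      refine Submodule.mem_sup.2 ⟨J (E₀ (M x)), ⟨_, rfl⟩, x - J (E₀ (M x)), ?_, by abel⟩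
      rw [LinearMap.mem_ker, map_sub, ← h1, sub_self]
    · have h0 : ∀ {x}, M x = M (J (E₀ (M x))) → x ∈ LinearMap.ker G := fun {x} hx => by
        have : G x = L (M x - M (J (E₀ (M x)))) := rfl
        rw [LinearMap.mem_ker, this, ← hx, sub_self, map_zero]
      refine sup_le ?_ fun x hx => h0 ?_
      · rintro _ ⟨y, rfl⟩
        refine h0 (Finsupp.ext fun k => ?_)
        rw [hE, hMJ, hMJ, hr]
      · rw [LinearMap.mem_ker.1 hx]; simp
  exact ⟨LinearMap.range G, hker ▸ (LinearMap.IsIdempotentElem.isCompl hG).symm⟩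

end Fibers

/-! ### Words, products and coproducts -/

section Words

variable {B : Type*}

theorem Knuth.map {w w' : List (ℕ × B)} (h : Knuth w w') {φ : ℕ → ℕ}
    (hφ : ∀ x ∈ w, ∀ y ∈ w, x.1 < y.1 → φ x.1 < φ y.1) :
    Knuth (w.map (Prod.map φ id)) (w'.map (Prod.map φ id)) := by
  have hφ' : ∀ x ∈ w, ∀ y ∈ w, x.1 ≤ y.1 → φ x.1 ≤ φ y.1 := fun x hx y hy hxy =>
    hxy.lt_or_eq.elim (fun h => (hφ x hx y hy h).le) fun h => by rw [h]
  cases h with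
  | exchange u v x y h =>
    simp only [List.map_append, List.map_cons, List.map_nil]
    exact .exchange _ _ _ _ h
  | acb_cab u v a b c β h h' =>
    simp only [List.map_append, List.map_cons, List.map_nil, Prod.map, id]
    exact .acb_cab _ _ _ _ _ β (hφ' (a, β) (by simp) (b, β) (by simp) h)
      (hφ (b, β) (by simp) (c, β) (by simp) h')
  | cab_acb u v a b c β h h' =>
    simp only [List.map_append, List.map_cons, List.map_nil, Prod.map, id]
    exact .cab_acb _ _ _ _ _ β (hφ' (a, β) (by simp) (b, β) (by simp) h)
      (hφ (b, β) (by simp) (c, β) (by simp) h')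
  | bac_bca u v a b c β h h' =>
    simp only [List.map_append, List.map_cons, List.map_nil, Prod.map, id]
    exact .bac_bca _ _ _ _ _ β (hφ (a, β) (by simp) (b, β) (by simp) h)
      (hφ' (b, β) (by simp) (c, β) (by simp) h')
  | bca_bac u v a b c β h h' =>
    simp only [List.map_append, List.map_cons, List.map_nil, Prod.map, id]
    exact .bca_bac _ _ _ _ _ β (hφ (a, β) (by simp) (b, β) (by simp) h)
      (hφ' (b, β) (by simp) (c, β) (by simp) h')

/-- The two exchanged letters of a Knuth triple are its extremes. If both survive, so does the
middle witness by convexity of `p`; if one disappears, the words become equal. -/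
theorem Knuth.filter {w w' : List (ℕ × B)} (h : Knuth w w') {p : ℕ → Bool}
    (hp : ∀ a b c, a ≤ b → b ≤ c → p a → p c → p b) :
    w.filter (fun x => p x.1) = w'.filter (fun x => p x.1) ∨
      Knuth (w.filter fun x => p x.1) (w'.filter fun x => p x.1) := by
  have key : ∀ u v : List (ℕ × B), ∀ {x y z : ℕ × B}, (p x.1 → p y.1 → p z.1) →
      (p x.1 → p y.1 → p z.1 →
        Knuth ((u ++ [x, y, z] ++ v).filter fun x => p x.1)
          ((u ++ [y, x, z] ++ v).filter fun x => p x.1)) →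
      (u ++ [x, y, z] ++ v).filter (fun x => p x.1) =
          (u ++ [y, x, z] ++ v).filter (fun x => p x.1) ∨
        Knuth ((u ++ [x, y, z] ++ v).filter fun x => p x.1)
          ((u ++ [y, x, z] ++ v).filter fun x => p x.1) := by
    intro u v x y z h1 h2
    cases hx : p x.1 <;> cases hy : p y.1
    · left; simp [List.filter_cons, hx, hy]
    · left; simp [List.filter_cons, hx, hy]
    · left; simp [List.filter_cons, hx, hy]
    · exact Or.inr (h2 hx hy (h1 hx hy))
  have key' : ∀ u v : List (ℕ × B), ∀ {x y z : ℕ × B}, (p x.1 → p y.1 → p z.1) →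
      (p x.1 → p y.1 → p z.1 →
        Knuth ((u ++ [z, x, y] ++ v).filter fun x => p x.1)
          ((u ++ [z, y, x] ++ v).filter fun x => p x.1)) →
      (u ++ [z, x, y] ++ v).filter (fun x => p x.1) =
          (u ++ [z, y, x] ++ v).filter (fun x => p x.1) ∨
        Knuth ((u ++ [z, x, y] ++ v).filter fun x => p x.1)
          ((u ++ [z, y, x] ++ v).filter fun x => p x.1) := by
    intro u v x y z h1 h2
    cases hx : p x.1 <;> cases hy : p y.1
    · left; simp [List.filter_cons, hx, hy]
    · left; simp [List.filter_cons, hx, hy]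
    · left; simp [List.filter_cons, hx, hy]
    · exact Or.inr (h2 hx hy (h1 hx hy))
  cases h with
  | exchange u v x y h =>
    cases hx : p x.1 <;> cases hy : p y.1
    · left; simp [hx, hy]
    · left; simp [hx, hy]
    · left; simp [hx, hy]
    · right
      simpa [List.filter_cons, hx, hy] using
        Knuth.exchange (u.filter fun x => p x.1) (v.filter fun x => p x.1) x y h
  | acb_cab u v a b c β h h' =>
    refine key u v (fun h1 h2 => hp a b c h h'.le h1 h2) fun h1 h2 h3 => ?_
    dsimp only at h1 h2 h3
    simpa [List.filter_cons, h1, h2, h3] using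
      Knuth.acb_cab (u.filter fun x => p x.1) (v.filter fun x => p x.1) a b c β h h'
  | cab_acb u v a b c β h h' =>
    refine key u v (fun h1 h2 => hp a b c h h'.le h2 h1) fun h1 h2 h3 => ?_
    dsimp only at h1 h2 h3
    simpa [List.filter_cons, h1, h2, h3] using
      Knuth.cab_acb (u.filter fun x => p x.1) (v.filter fun x => p x.1) a b c β h h'
  | bac_bca u v a b c β h h' =>
    refine key' u v (fun h1 h2 => hp a b c h.le h' h1 h2) fun h1 h2 h3 => ?_
    dsimp only at h1 h2 h3
    simpa [List.filter_cons, h1, h2, h3] using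
      Knuth.bac_bca (u.filter fun x => p x.1) (v.filter fun x => p x.1) a b c β h h'
  | bca_bac u v a b c β h h' =>
    refine key' u v (fun h1 h2 => hp a b c h.le h' h2 h1) fun h1 h2 h3 => ?_
    dsimp only at h1 h2 h3
    simpa [List.filter_cons, h1, h2, h3] using
      Knuth.bca_bac (u.filter fun x => p x.1) (v.filter fun x => p x.1) a b c β h h'

/-! ### Words of the terms of a product -/

@[simp] theorem permProd_castAdd {n m : ℕ} (σ : Equiv.Perm (Fin n)) (σ' : Equiv.Perm (Fin m))
    (i : Fin n) : permProd σ σ' (Fin.castAdd m i) = Fin.castAdd m (σ i) := by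
  simp [permProd, Equiv.permCongr_apply]

@[simp] theorem permProd_natAdd {n m : ℕ} (σ : Equiv.Perm (Fin n)) (σ' : Equiv.Perm (Fin m))
    (i : Fin m) : permProd σ σ' (Fin.natAdd n i) = Fin.natAdd n (σ' i) := by
  simp [permProd, Equiv.permCongr_apply]

/-- The extension to `ℕ` of a map between intervals numbered from `1`. -/
def shiftMap {n N : ℕ} (f : Fin n → Fin N) (v : ℕ) : ℕ :=
  -- Letters of words start at `1`, so neither the truncation at `v = 0` nor the default value
  -- matters.
  if h : v - 1 < n then f ⟨v - 1, h⟩ + 1 else 0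

@[simp] theorem shiftMap_apply {n N : ℕ} (f : Fin n → Fin N) (i : Fin n) :
    shiftMap f ((i : ℕ) + 1) = f i + 1 := by simp [shiftMap]

/-- For a shuffle `ρ` the two relabellings are increasing, so Knuth moves in either factor remain
Knuth moves in the product. -/
theorem word_leftAct_concat {n m : ℕ} (ρ : Equiv.Perm (Fin (n + m))) (α : Wr B n) (β : Wr B m) :
    word (leftAct ρ (concat α β)) =
      (word α).map (Prod.map (shiftMap fun i => ρ (Fin.castAdd m i)) id) ++
        (word β).map (Prod.map (shiftMap fun i => ρ (Fin.natAdd n i)) id) := by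
  simp only [word, List.ofFn_add, List.map_ofFn]
  congr 2
  · funext i
    change (((ρ * permProd α.2 β.2) (Fin.castAdd m i) : ℕ) + 1,
      Fin.append α.1 β.1 (ρ⁻¹ ((ρ * permProd α.2 β.2) (Fin.castAdd m i)))) = _
    simp
  · funext i
    simp [leftAct, concat]

theorem exists_fin_of_mem_word {n : ℕ} {α : Wr B n} {x : ℕ × B} (h : x ∈ word α) :
    ∃ i : Fin n, x.1 = i + 1 := by
  obtain ⟨i, rfl⟩ := (List.mem_ofFn' _ _).1 h
  exact ⟨α.2 i, rfl⟩

theorem Knuth.map_shiftMap {n N : ℕ} {α α' : Wr B n} (h : Knuth (word α) (word α'))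
    {f : Fin n → Fin N} (hf : ∀ i j, i < j → f i < f j) :
    Knuth ((word α).map (Prod.map (shiftMap f) id)) ((word α').map (Prod.map (shiftMap f) id)) := by
  refine h.map fun x hx y hy hxy => ?_
  obtain ⟨i, hi⟩ := exists_fin_of_mem_word hx
  obtain ⟨j, hj⟩ := exists_fin_of_mem_word hy
  rw [hi, hj, shiftMap_apply, shiftMap_apply]
  have := hf i j (by rw [Fin.lt_def]; omega)
  rw [Fin.lt_def] at this
  omega

theorem Knuth.leftAct_concat_left {n m : ℕ} {ρ : Equiv.Perm (Fin (n + m))} (hρ : ρ ∈ shuffles n m)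
    {α α' : Wr B n} (h : Knuth (word α) (word α')) (β : Wr B m) :
    Knuth (word (leftAct ρ (concat α β))) (word (leftAct ρ (concat α' β))) := by
  rw [word_leftAct_concat, word_leftAct_concat]
  simpa using (h.map_shiftMap (Finset.mem_filter.1 hρ).2.1).append_append [] _

theorem Knuth.leftAct_concat_right {n m : ℕ} {ρ : Equiv.Perm (Fin (n + m))}
    (hρ : ρ ∈ shuffles n m) (α : Wr B n) {β β' : Wr B m} (h : Knuth (word β) (word β')) :
    Knuth (word (leftAct ρ (concat α β))) (word (leftAct ρ (concat α β'))) := by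
  rw [word_leftAct_concat, word_leftAct_concat]
  simpa using (h.map_shiftMap (Finset.mem_filter.1 hρ).2.2).append_append _ []

/-! ### Words of the terms of a coproduct -/

theorem sort_eq_of_strictMono {A : Type*} [LinearOrder A] {n : ℕ} {w : Fin n → A}
    {π : Equiv.Perm (Fin n)} (h : StrictMono (w ∘ π)) : Tuple.sort w = π :=
  (Tuple.eq_sort_iff.2 ⟨h.monotone, fun _ _ hij e => absurd e (h hij).ne⟩).symm

theorem strictMono_comp_sort {A : Type*} [LinearOrder A] {n : ℕ} {w : Fin n → A}
    (h : Function.Injective w) : StrictMono (w ∘ Tuple.sort w) :=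
  (Tuple.monotone_sort w).strictMono_of_injective (h.comp (Tuple.sort w).injective)

/-- The standardization of the part of `α` formed by the letters with values in the image of `e`. -/
def subPart {n k : ℕ} (α : Wr B n) (e : Fin k → Fin n) : Wr B k :=
  (fun i => α.1 (e i), Tuple.sort fun i => α.2⁻¹ (e i))

theorem headPart_eq {n : ℕ} (α : Wr B n) (k : Fin (n + 1)) :
    headPart α k = subPart α fun i => ⟨i, by omega⟩ := by
  simp [headPart, subPart, standardization]

theorem tailPart_eq {n : ℕ} (α : Wr B n) (k : Fin (n + 1)) :
    tailPart α k = subPart α fun i => ⟨k + i, by omega⟩ := by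
  simp [tailPart, subPart, standardization]

/-- Sorting the positions of the retained values lists the retained letters in their original order;
only the values are renumbered. -/
theorem word_subPart {n k : ℕ} (α : Wr B n) {e : Fin k → Fin n} (he : Function.Injective e)
    {p : ℕ → Bool} (hp : ∀ v : Fin n, p (v + 1) ↔ v ∈ Set.range e) {φ : ℕ → ℕ}
    (hφ : ∀ i, φ (e i + 1) = i + 1) :
    word (subPart α e) = ((word α).filter fun x => p x.1).map (Prod.map φ id) := by
  set π := Tuple.sort fun i => α.2⁻¹ (e i) with hπ
  have hmono : StrictMono fun i => α.2⁻¹ (e (π i)) :=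
    strictMono_comp_sort (α.2⁻¹.injective.comp he)
  have h1 : ((List.finRange n).filter fun i => p (α.2 i + 1)) =
      List.ofFn fun i => α.2⁻¹ (e (π i)) := by
    refine List.Perm.eq_of_pairwise (le := (· < ·)) (fun _ _ _ _ h h' => absurd h h'.not_gt)
      ((List.pairwise_lt_finRange n).filter _) (List.pairwise_ofFn.2 fun i j h => hmono h) ?_
    refine (List.perm_ext_iff_of_nodup ((List.nodup_finRange n).filter _)
      (List.nodup_ofFn.2 hmono.injective)).2 fun i => ?_
    simp only [List.mem_filter, List.mem_finRange, true_and, hp, List.mem_ofFn', Set.mem_range]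
    constructor
    · rintro ⟨j, hj⟩
      exact ⟨π⁻¹ j, by simp [hj]⟩
    · rintro ⟨j, rfl⟩
      exact ⟨π j, by simp⟩
  have h2 : (word α).filter (fun x => p x.1) = (List.ofFn fun i => α.2⁻¹ (e (π i))).map
      fun i => ((α.2 i : ℕ) + 1, α.1 (α.2 i)) := by
    rw [← h1, word, List.ofFn_eq_map, List.filter_map]
    rfl
  rw [h2, List.map_ofFn, List.map_ofFn]
  refine congrArg List.ofFn (funext fun i => ?_)
  change ((π i : ℕ) + 1, α.1 (e (π i))) = (φ ((α.2 (α.2⁻¹ (e (π i))) : ℕ) + 1), α.1 (α.2 (α.2⁻¹ (e (π i)))))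
  simp [hφ]

theorem word_headPart {n : ℕ} (α : Wr B n) (k : Fin (n + 1)) :
    word (headPart α k) = (word α).filter fun x => decide (x.1 ≤ (k : ℕ)) := by
  rw [headPart_eq, word_subPart α (p := fun v => decide (v ≤ (k : ℕ))) (φ := id)]
  · simp
  · exact fun i j h => Fin.ext (by simpa using h)
  · intro v
    simp only [decide_eq_true_eq, Set.mem_range]
    exact ⟨fun h => ⟨⟨v, by omega⟩, rfl⟩, fun ⟨i, hi⟩ => by rw [← hi]; exact i.2⟩
  · exact fun i => rfl

theorem word_tailPart {n : ℕ} (α : Wr B n) (k : Fin (n + 1)) :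
    word (tailPart α k) =
      ((word α).filter fun x => decide ((k : ℕ) < x.1)).map (Prod.map (fun v => v - (k : ℕ)) id) := by
  rw [tailPart_eq, word_subPart α (p := fun v => decide ((k : ℕ) < v)) (φ := fun v => v - (k : ℕ))]
  · exact fun i j h => Fin.ext (by simpa using h)
  · intro v
    simp only [decide_eq_true_eq, Set.mem_range]
    refine ⟨fun h => ⟨⟨v - k, by omega⟩, Fin.ext (by simp; omega)⟩, fun ⟨i, hi⟩ => ?_⟩
    rw [← hi]; simp
  · intro i; simp; omega

theorem Knuth.headPart {n : ℕ} {α α' : Wr B n} (h : Knuth (word α) (word α')) (k : Fin (n + 1)) :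
    FQ.headPart α k = FQ.headPart α' k ∨
      Knuth (word (FQ.headPart α k)) (word (FQ.headPart α' k)) := by
  rw [word_headPart, word_headPart]
  refine (h.filter (p := fun v => decide (v ≤ (k : ℕ))) fun a b c _ hbc _ hc => ?_).imp_left
    fun e => word_injective ?_
  · simp at hc ⊢; omega
  · rw [word_headPart, word_headPart, e]

theorem Knuth.tailPart {n : ℕ} {α α' : Wr B n} (h : Knuth (word α) (word α')) (k : Fin (n + 1)) :
    FQ.tailPart α k = FQ.tailPart α' k ∨
      Knuth (word (FQ.tailPart α k)) (word (FQ.tailPart α' k)) := by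
  rw [word_tailPart, word_tailPart]
  refine (h.filter (p := fun v => decide ((k : ℕ) < v)) fun a b c hab _ ha _ => ?_).imp
    (fun e => word_injective ?_) fun e => e.map fun x hx y hy hxy => ?_
  · simp at ha ⊢; omega
  · rw [word_tailPart, word_tailPart, e]
  · have := (List.mem_filter.1 hx).2
    simp at this
    omega

/-! ### Combinatorics of the adjunction between product and coproduct -/

theorem sigma_subPart_eq {n k k' : ℕ} (α : Wr B n) {e : Fin k → Fin n} {e' : Fin k' → Fin n}
    (h : k = k') (he : ∀ i, e i = e' (Fin.cast h i)) :
    (⟨k, subPart α e⟩ : Σ n, Wr B n) = ⟨k', subPart α e'⟩ := by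
  subst h
  rw [funext he]
  rfl

/-- A permutation that makes a word strictly increasing must be the sorting permutation;
standardization thus becomes a monotonicity condition comparable with that of shuffles. -/
theorem dual_subPart_eq_iff {inv : B → B} {n k : ℕ} {γ : Wr B n} {e : Fin k → Fin n}
    (he : Function.Injective e) {α : Wr B k} :
    α = dual inv (subPart γ e) ↔ (StrictMono fun i => γ.2⁻¹ (e (α.2⁻¹ i))) ∧
      ∀ i, α.1 i = inv (γ.1 (e (α.2⁻¹ i))) := by
  constructor
  · rintro rfl
    refine ⟨?_, fun i => ?_⟩
    · simp only [dual_snd, inv_inv]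
      exact strictMono_comp_sort (γ.2⁻¹.injective.comp he)
    · simp [subPart]
  · rintro ⟨h1, h2⟩
    have h3 : Tuple.sort (fun i => γ.2⁻¹ (e i)) = α.2⁻¹ := sort_eq_of_strictMono h1
    refine Prod.ext (funext fun i => ?_) ?_
    · rw [dual_fst, h2]
      simp only [subPart, h3]
    · rw [dual_snd]
      simp only [subPart, h3, inv_inv]

/-- The permutation component of the equation determines `ρ`. That this `ρ` is a shuffle and that
the colours match says exactly that `α` and `β` are dual to the two parts of `γ`. -/
theorem leftAct_concat_eq_dual_iff {inv : B → B} {n m : ℕ} {α : Wr B n} {β : Wr B m}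
    {γ : Wr B (n + m)} {ρ : Equiv.Perm (Fin (n + m))} :
    ρ ∈ shuffles n m ∧ leftAct ρ (concat α β) = dual inv γ ↔
      ρ = γ.2⁻¹ * (permProd α.2 β.2)⁻¹ ∧ α = dual inv (subPart γ (Fin.castAdd m)) ∧
        β = dual inv (subPart γ (Fin.natAdd n)) := by
  rw [dual_subPart_eq_iff (Fin.castAdd_injective n m),
    dual_subPart_eq_iff (Fin.natAdd_injective m n)]
  have hcolour : ∀ ρ : Equiv.Perm (Fin (n + m)), ρ = γ.2⁻¹ * (permProd α.2 β.2)⁻¹ →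
      (leftAct ρ (concat α β) = dual inv γ ↔ (∀ i, α.1 i = inv (γ.1 (Fin.castAdd m (α.2⁻¹ i)))) ∧
        ∀ i, β.1 i = inv (γ.1 (Fin.natAdd n (β.2⁻¹ i)))) := by
    rintro ρ rfl
    rw [Prod.ext_iff, funext_iff]
    have h1 : (leftAct (γ.2⁻¹ * (permProd α.2 β.2)⁻¹) (concat α β)).2 = (dual inv γ).2 := by
      simp [leftAct, concat]
    have h2 : ∀ y, (leftAct (γ.2⁻¹ * (permProd α.2 β.2)⁻¹) (concat α β)).1 (γ.2⁻¹ y) =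
        Fin.append α.1 β.1 (permProd α.2 β.2 y) := fun y => by simp [leftAct, concat]
    have h3 : ∀ y, (dual inv γ).1 (γ.2⁻¹ y) = inv (γ.1 y) := fun y => by simp
    rw [and_iff_left h1, (γ.2⁻¹).surjective.forall]
    simp only [h2, h3]
    constructor
    · exact fun h => ⟨fun i => by simpa using h (Fin.castAdd m (α.2⁻¹ i)),
        fun i => by simpa using h (Fin.natAdd n (β.2⁻¹ i))⟩
    · rintro ⟨h, h'⟩ y
      refine Fin.addCases (fun i => ?_) (fun i => ?_) y
      · simpa using h (α.2 i)
      · simpa using h' (β.2 i)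
  have hmono : ∀ ρ : Equiv.Perm (Fin (n + m)), ρ = γ.2⁻¹ * (permProd α.2 β.2)⁻¹ →
      (ρ ∈ shuffles n m ↔ (StrictMono fun i => γ.2⁻¹ (Fin.castAdd m (α.2⁻¹ i))) ∧
        StrictMono fun i => γ.2⁻¹ (Fin.natAdd n (β.2⁻¹ i))) := by
    intro ρ hρ
    -- With this substitution the two functions on the right are the restrictions of `ρ` to its two
    -- blocks.
    have h1 : γ.2⁻¹ = ρ * permProd α.2 β.2 := by simp [hρ]
    rw [shuffles, Finset.mem_filter, and_iff_right (Finset.mem_univ _), h1]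
    simp [StrictMono]
  constructor
  · rintro ⟨h1, h2⟩
    have hρ : ρ = γ.2⁻¹ * (permProd α.2 β.2)⁻¹ :=
      eq_mul_inv_of_mul_eq ((congrArg Prod.snd h2).trans (dual_snd inv γ))
    have h3 := (hmono ρ hρ).1 h1
    have h4 := (hcolour ρ hρ).1 h2
    exact ⟨hρ, ⟨h3.1, h4.1⟩, h3.2, h4.2⟩
  · rintro ⟨hρ, ⟨h1, h2⟩, h3, h4⟩
    exact ⟨(hmono ρ hρ).2 ⟨h1, h3⟩, (hcolour ρ hρ).2 ⟨h2, h4⟩⟩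

end Words

/-! ### The keys of the basis elements -/

section Keys

variable {B : Type*} [Fintype B] [DecidableEq B]

/-- The set of the standard `B`-tableaux, given by their number of boxes and their rows. -/
abbrev StandardRows (B : Type*) [Fintype B] : Type _ :=
  {x : ℕ × (B → List (List ℕ)) // IsStandardRows x.1 x.2}

/-- The record tableau of a basis element. -/
def recordKey (s : Σ n, Wr B n) : StandardRows B :=
  ⟨(s.1, recordRows s.2), isStandardRows_recordRows s.2⟩

/-- The insertion tableau of a basis element. -/
def insertionKey (s : Σ n, Wr B n) : StandardRows B :=
  ⟨(s.1, insertionRows s.2), isStandardRows_insertionRows s.2⟩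

/-- The number of boxes and the shape of a standard `B`-tableau. -/
def shapeKey (k : StandardRows B) : ℕ × (B → List ℕ) :=
  (k.1.1, fun b => (k.1.2 b).map List.length)

theorem insertionKey_eq_iff {n : ℕ} {α β : Wr B n} :
    insertionKey ⟨n, α⟩ = insertionKey ⟨n, β⟩ ↔ insertionRows α = insertionRows β := by
  simp [insertionKey]

theorem fst_eq_of_insertionKey_eq {s s' : Σ n, Wr B n} (h : insertionKey s = insertionKey s') :
    s.1 = s'.1 := congrArg (fun k => k.1.1) h

theorem fst_eq_of_recordKey_eq {s s' : Σ n, Wr B n} (h : recordKey s = recordKey s') :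
    s.1 = s'.1 := congrArg (fun k => k.1.1) h

theorem finite_recordKey_fiber (k : StandardRows B) :
    ((recordKey : (Σ n, Wr B n) → StandardRows B) ⁻¹' {k}).Finite := by
  refine (Set.finite_range (Sigma.mk (β := fun n => Wr B n) k.1.1)).subset ?_
  rintro ⟨n, α⟩ h
  obtain rfl : n = k.1.1 := congrArg (fun k => k.1.1) (Set.mem_singleton_iff.1 h)
  exact ⟨α, rfl⟩

/-- This is the RSO bijection, in the abstract form used by the linear algebra on fibers. -/
theorem isPairing_keys :
    IsPairing (recordKey : (Σ n, Wr B n) → StandardRows B) insertionKey shapeKey where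
  eq s := Prod.ext rfl (funext fun b => length_insertionRows s.2 b)
  exists_eq := by
    rintro ⟨⟨n, R⟩, hR⟩ ⟨⟨n', R'⟩, hR'⟩ h
    obtain ⟨rfl, h⟩ := Prod.mk.inj h
    obtain ⟨α, h1, h2⟩ := exists_of_isStandardRows hR hR' (congrFun h)
    exact ⟨⟨n, α⟩, Subtype.ext (Prod.ext rfl h1), Subtype.ext (Prod.ext rfl h2)⟩
  unique := by
    rintro ⟨n, α⟩ ⟨n', β⟩ h h'
    obtain rfl : n = n' := fst_eq_of_recordKey_eq h'
    rw [eq_of_rows_eq (insertionKey_eq_iff.1 h) (by simpa [recordKey] using h')]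

/-- The exchange of the components of a standard `B`-tableau by an involution of `B`. -/
def StandardRows.comp (k : StandardRows B) {inv : B → B} (hinv : Function.Involutive inv) :
    StandardRows B :=
  ⟨(k.1.1, fun b => k.1.2 (inv b)), fun b => k.2.1 (inv b),
    (Equiv.sum_comp hinv.toPerm fun b => ((k.1.2 b).flatten : Multiset ℕ)).trans k.2.2⟩

variable {inv : B → B} (hinv : Function.Involutive inv)

theorem StandardRows.comp_comp {B : Type*} [Fintype B] {inv : B → B}
    (hinv : Function.Involutive inv) (k : StandardRows B) : (k.comp hinv).comp hinv = k :=
  Subtype.ext (Prod.ext rfl (funext fun b => congrArg k.1.2 (hinv b)))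

/-- The dual of a basis element. -/
def sigmaDual {B : Type*} (inv : B → B) (s : Σ n, Wr B n) : Σ n, Wr B n := ⟨s.1, dual inv s.2⟩

theorem sigmaDual_sigmaDual {B : Type*} {inv : B → B} (hinv : Function.Involutive inv)
    (s : Σ n, Wr B n) : sigmaDual inv (sigmaDual inv s) = s :=
  Sigma.ext rfl (heq_of_eq (dual_dual hinv s.2))

theorem recordKey_sigmaDual (s : Σ n, Wr B n) :
    recordKey (sigmaDual inv s) = (insertionKey s).comp hinv :=
  Subtype.ext (Prod.ext rfl (funext fun b => recordRows_dual hinv s.2 b))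

theorem insertionKey_sigmaDual (s : Σ n, Wr B n) :
    insertionKey (sigmaDual inv s) = (recordKey s).comp hinv := by
  rw [← StandardRows.comp_comp hinv (insertionKey _), ← recordKey_sigmaDual,
    sigmaDual_sigmaDual hinv]

variable (K : Type*) [CommRing K]

theorem coplacticClass_eq {T : BTableau B} (hT : T.IsStandard) :
    coplacticClass K T = fiberSum K finite_recordKey_fiber
      ⟨(T.size, fun b => (T b).rows), hT.isStandardRows⟩ := by
  classical
  ext ⟨n, β⟩
  rw [fiberSum_apply, coplacticClass, Finsupp.finsetSum_apply]
  simp only [elt, Finsupp.single_apply]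
  by_cases hn : T.size = n
  · subst hn
    simp only [Sigma.mk.injEq, heq_eq_eq, true_and, recordKey, Subtype.mk.injEq, Prod.mk.injEq,
      Finset.sum_ite_eq', Finset.mem_filter, Finset.mem_univ, funext_iff]
  · rw [Finset.sum_eq_zero, if_neg]
    · exact fun h => hn (congrArg (fun k => k.1.1) h).symm
    · exact fun α _ => if_neg fun h => hn (congrArg Sigma.fst h)

theorem coplacticClass_mem_range_iff {x : Free K B} :
    (∃ T : BTableau B, T.IsStandard ∧ x = coplacticClass K T) ↔
      x ∈ Set.range (fiberSum K (finite_recordKey_fiber (B := B))) := by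
  constructor
  · rintro ⟨T, hT, rfl⟩
    exact ⟨_, (coplacticClass_eq K hT).symm⟩
  · rintro ⟨⟨⟨n, R⟩, hR⟩, rfl⟩
    obtain ⟨T, hT, rfl, rfl⟩ := exists_isStandard_rows_eq hR
    exact ⟨T, hT, (coplacticClass_eq K hT).symm⟩

theorem coplactic_eq :
    coplactic K B = LinearMap.range (fiberSums K (finite_recordKey_fiber (B := B))) := by
  rw [range_fiberSums, coplactic]
  congr 1
  exact Set.ext fun x => coplacticClass_mem_range_iff K

variable {K}

/-- Reduces membership to an equality of coefficients, which pairings with dual basis elements can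
test. -/
theorem mem_coplactic_iff {x : Free K B} :
    x ∈ coplactic K B ↔ ∀ s s', recordKey s = recordKey s' → x s = x s' := by
  rw [coplactic_eq, mem_range_fiberSums _ isPairing_keys.surjective]

/-! ### The pairing and the polar of the coplactic submodule -/

theorem pairing_single {B : Type*} (inv : B → B) (s : Σ n, Wr B n) (a : K) (x : Free K B) :
    pairing K inv (Finsupp.single s a) x = a * x (sigmaDual inv s) := by
  simp [pairing, sigmaDual]

theorem pairing_comm {B : Type*} {inv : B → B} (hinv : Function.Involutive inv) (x y : Free K B) :
    pairing K inv x y = pairing K inv y x := by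
  classical
  induction x using Finsupp.induction_linear with
  | zero => simp
  | add x x' hx hx' => simp [hx, hx']
  | single s a =>
    induction y using Finsupp.induction_linear with
    | zero => simp
    | add y y' hy hy' => rw [map_add, map_add, LinearMap.add_apply, hy, hy']
    | single s' a' =>
      rw [pairing_single, pairing_single, Finsupp.single_apply, Finsupp.single_apply]
      have : s' = sigmaDual inv s ↔ s = sigmaDual inv s' :=
        ⟨fun h => by rw [h, sigmaDual_sigmaDual hinv], fun h => by rw [h, sigmaDual_sigmaDual hinv]⟩
      by_cases h : s' = sigmaDual inv s
      · rw [if_pos h, if_pos (this.1 h), mul_comm]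
      · rw [if_neg h, if_neg fun h' => h (this.2 h'), mul_zero, mul_zero]

/-- Duality turns the record tableau into the insertion tableau, so the pairing depends on `x` only
through its pushforward along $\mathbf P$. -/
theorem pairing_fiberSums (x : Free K B) (y : StandardRows B →₀ K) :
    pairing K inv x (fiberSums K finite_recordKey_fiber y) =
      (x.mapDomain insertionKey).sum fun k a => a * y (k.comp hinv) := by
  induction x using Finsupp.induction_linear with
  | zero => simp
  | add x x' hx hx' =>
    rw [map_add, LinearMap.add_apply, hx, hx', Finsupp.mapDomain_add,
      Finsupp.sum_add_index' (by simp) (by intros; ring)]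
  | single s a =>
    rw [pairing_single, fiberSums_apply, Finsupp.mapDomain_single,
      Finsupp.sum_single_index (by simp), recordKey_sigmaDual hinv]

/-- Pairing with the class of a single tableau extracts one coefficient of the pushforward along
$\mathbf P$, and all coefficients are reached in this way. -/
theorem polar_coplactic {inv : B → B} (hinv : Function.Involutive inv) :
    polar inv (coplactic K B) =
      LinearMap.ker (Finsupp.lmapDomain K K (insertionKey : (Σ n, Wr B n) → StandardRows B)) := by
  classical
  ext x
  have h : x ∈ polar inv (coplactic K B) ↔ ∀ y ∈ coplactic K B, pairing K inv x y = 0 := Iff.rfl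
  rw [h, coplactic_eq, LinearMap.mem_ker, Finsupp.lmapDomain_apply]
  constructor
  · intro h
    ext k
    have h1 := h _ ⟨Finsupp.single (k.comp hinv) 1, rfl⟩
    rw [pairing_fiberSums hinv, Finsupp.sum] at h1
    have h2 : ∀ l : StandardRows B, k.comp hinv = l.comp hinv ↔ l = k := fun l =>
      ⟨fun e => by rw [← l.comp_comp hinv, ← e, k.comp_comp hinv], fun e => by rw [e]⟩
    simp only [Finsupp.single_apply, h2, mul_ite, mul_one, mul_zero, Finset.sum_ite_eq',
      Finsupp.mem_support_iff, ite_not] at h1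
    by_cases h3 : (x.mapDomain insertionKey) k = 0
    · exact h3
    · rwa [if_neg h3] at h1
  · rintro h _ ⟨y, rfl⟩
    rw [pairing_fiberSums hinv, h, Finsupp.sum_zero_index]

end Keys

/-! ### Subbialgebra and biideal -/

section Bialgebra

variable {K : Type*} [CommRing K]

theorem extMul_elt {B : Type*} {n m : ℕ} (α : Wr B n) (β : Wr B m) :
    extMul K B (elt K α) (elt K β) = ∑ ρ ∈ shuffles n m, elt K (leftAct ρ (concat α β)) := by
  simp [extMul, elt]

theorem comul_elt {B : Type*} {n : ℕ} (α : Wr B n) :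
    comul K B (elt K α) =
      ∑ k : Fin (n + 1), elt K (headPart α k) ⊗ₜ[K] elt K (tailPart α k) := by
  simp [comul, elt]

theorem isGraded_span {B : Type*} {A : Set (Free K B)} (h : ∀ x ∈ A, ∃ n, x ∈ degreePart K B n) :
    IsGraded (Submodule.span K A) := by
  refine le_antisymm (Submodule.span_le.2 fun x hx => ?_) (iSup_le fun n => inf_le_left)
  obtain ⟨n, hn⟩ := h x hx
  exact Submodule.mem_iSup_of_mem n ⟨Submodule.subset_span hx, hn⟩

theorem elt_mem_degreePart {B : Type*} {n : ℕ} (α : Wr B n) : elt K α ∈ degreePart K B n :=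
  Finsupp.single_mem_supported K 1 rfl

/-- The pairing of tensors with `x ⊗ y`. -/
noncomputable def pairing₂ {B : Type*} (inv : B → B) (x y : Free K B) :
    Free K B ⊗[K] Free K B →ₗ[K] K :=
  LinearMap.mul' K K ∘ₗ TensorProduct.map ((pairing K inv).flip x) ((pairing K inv).flip y)

@[simp] theorem pairing₂_tmul {B : Type*} (inv : B → B) (x y z w : Free K B) :
    pairing₂ inv x y (z ⊗ₜ w) = pairing K inv z x * pairing K inv w y := by
  simp [pairing₂]

theorem tailPart_castAdd_eq {B : Type*} {n m : ℕ} (γ : Wr B (n + m)) (k : Fin (n + m + 1))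
    (hk : (k : ℕ) = n) :
    (⟨n + m - k, tailPart γ k⟩ : Σ n, Wr B n) = ⟨m, subPart γ (Fin.natAdd n)⟩ := by
  rw [tailPart_eq]
  exact sigma_subPart_eq γ (by omega) fun i => Fin.ext (by simp [hk])

theorem headPart_castAdd_eq {B : Type*} {n m : ℕ} (γ : Wr B (n + m)) (k : Fin (n + m + 1))
    (hk : (k : ℕ) = n) :
    (⟨k, headPart γ k⟩ : Σ n, Wr B n) = ⟨n, subPart γ (Fin.castAdd m)⟩ := by
  rw [headPart_eq]
  exact sigma_subPart_eq γ hk fun i => Fin.ext (by simp)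

/-- The product and the coproduct are adjoint to each other on the basis. -/
theorem pairing_extMul_elt {B : Type*} (inv : B → B) (s s' t : Σ n, Wr B n) :
    pairing K inv (elt K t.2) (extMul K B (elt K s.2) (elt K s'.2)) =
      pairing₂ inv (elt K s.2) (elt K s'.2) (comul K B (elt K t.2)) := by
  classical
  obtain ⟨n, α⟩ := s
  obtain ⟨m, β⟩ := s'
  obtain ⟨N, γ⟩ := t
  have hl : pairing K inv (elt K γ) (extMul K B (elt K α) (elt K β)) =
      ∑ ρ ∈ shuffles n m, if (⟨n + m, leftAct ρ (concat α β)⟩ : Σ n, Wr B n) = ⟨N, dual inv γ⟩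
        then 1 else 0 := by
    rw [extMul_elt, map_sum]
    refine Finset.sum_congr rfl fun ρ _ => ?_
    rw [elt, pairing_single, one_mul, elt, Finsupp.single_apply]
    rfl
  have hr : pairing₂ inv (elt K α) (elt K β) (comul K B (elt K γ)) =
      ∑ k : Fin (N + 1), if (⟨n, α⟩ : Σ n, Wr B n) = sigmaDual inv ⟨k, headPart γ k⟩ ∧
        (⟨m, β⟩ : Σ n, Wr B n) = sigmaDual inv ⟨N - k, tailPart γ k⟩ then 1 else 0 := by
    rw [comul_elt, map_sum]
    refine Finset.sum_congr rfl fun k _ => ?_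
    rw [pairing₂_tmul]
    simp only [elt, pairing_single, one_mul, Finsupp.single_apply]
    split_ifs <;> simp_all
  dsimp only
  rw [hl, hr]
  by_cases hN : N = n + m
  · subst hN
    have hk : ∀ k : Fin (n + m + 1), (k : ℕ) = n →
        ((⟨n, α⟩ : Σ n, Wr B n) = sigmaDual inv ⟨k, headPart γ k⟩ ∧
          (⟨m, β⟩ : Σ n, Wr B n) = sigmaDual inv ⟨n + m - k, tailPart γ k⟩ ↔
        α = dual inv (subPart γ (Fin.castAdd m)) ∧ β = dual inv (subPart γ (Fin.natAdd n))) := by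
      intro k hk
      rw [tailPart_castAdd_eq γ k hk, headPart_castAdd_eq γ k hk]
      simp [sigmaDual]
    -- By degree, only the cut after `n` letters can pair nontrivially with `α` and `β`.
    rw [Finset.sum_eq_single (⟨n, by omega⟩ : Fin (n + m + 1))]
    · rw [if_congr (hk _ rfl) rfl rfl, ← Finset.sum_filter]
      have h1 : ∀ ρ, ρ ∈ (shuffles n m).filter (fun ρ =>
          (⟨n + m, leftAct ρ (concat α β)⟩ : Σ n, Wr B n) = ⟨n + m, dual inv γ⟩) ↔
          ρ = γ.2⁻¹ * (permProd α.2 β.2)⁻¹ ∧ α = dual inv (subPart γ (Fin.castAdd m)) ∧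
            β = dual inv (subPart γ (Fin.natAdd n)) := fun ρ => by
        rw [← leftAct_concat_eq_dual_iff, Finset.mem_filter]
        simp
      split_ifs with h
      · rw [Finset.eq_singleton_iff_unique_mem.2
          ⟨(h1 _).2 ⟨rfl, h⟩, fun ρ hρ => ((h1 ρ).1 hρ).1⟩]
        simp
      · rw [Finset.filter_eq_empty_iff.2 fun ρ hρ e =>
          h ((h1 ρ).1 (Finset.mem_filter.2 ⟨hρ, e⟩)).2, Finset.sum_empty]
    · intro k _ hne
      exact if_neg fun h => hne (Fin.ext (congrArg Sigma.fst h.1).symm)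
    · simp
  · rw [Finset.sum_eq_zero, Finset.sum_eq_zero]
    · refine fun k _ => if_neg fun h => hN ?_
      have h1 : n = k := congrArg Sigma.fst h.1
      have h2 : m = N - k := congrArg Sigma.fst h.2
      omega
    · exact fun ρ _ => if_neg fun h => hN (congrArg Sigma.fst h).symm

theorem single_eq_smul_elt {B : Type*} (s : Σ n, Wr B n) (a : K) :
    (Finsupp.single s a : Free K B) = a • elt K s.2 := by
  simp [elt]

theorem pairing₂_add_left {B : Type*} (inv : B → B) (x x' y : Free K B)
    (z : Free K B ⊗[K] Free K B) :
    pairing₂ inv (x + x') y z = pairing₂ inv x y z + pairing₂ inv x' y z := by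
  simp [pairing₂, TensorProduct.map_add_left]

theorem pairing₂_add_right {B : Type*} (inv : B → B) (x y y' : Free K B)
    (z : Free K B ⊗[K] Free K B) :
    pairing₂ inv x (y + y') z = pairing₂ inv x y z + pairing₂ inv x y' z := by
  simp [pairing₂, TensorProduct.map_add_right]

theorem pairing₂_smul {B : Type*} (inv : B → B) (a b : K) (x y : Free K B)
    (z : Free K B ⊗[K] Free K B) :
    pairing₂ inv (a • x) (b • y) z = a * b * pairing₂ inv x y z := by
  simp [pairing₂, TensorProduct.map_smul_left, TensorProduct.map_smul_right, mul_assoc]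
  ring

/-- The pairing is a pairing of bialgebras. -/
theorem pairing_extMul {B : Type*} (inv : B → B) (z x y : Free K B) :
    pairing K inv z (extMul K B x y) = pairing₂ inv x y (comul K B z) := by
  induction x using Finsupp.induction_linear with
  | zero => simp [pairing₂]
  | add x x' hx hx' =>
    rw [map_add, LinearMap.add_apply, map_add, hx, hx', pairing₂_add_left]
  | single s a =>
    induction y using Finsupp.induction_linear with
    | zero => simp [pairing₂]
    | add y y' hy hy' => rw [map_add, map_add, hy, hy', pairing₂_add_right]
    | single s' a' =>
      induction z using Finsupp.induction_linear with
      | zero => simp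
      | add z z' hz hz' => rw [map_add, LinearMap.add_apply, hz, hz', map_add, map_add]
      | single t c =>
        rw [single_eq_smul_elt, single_eq_smul_elt, single_eq_smul_elt, map_smul, map_smul,
          map_smul, map_smul, LinearMap.smul_apply, LinearMap.smul_apply, map_smul, map_smul,
          pairing₂_smul, map_smul, pairing_extMul_elt]
        simp only [smul_eq_mul]
        ring

variable {B : Type*} [Fintype B] [DecidableEq B] {inv : B → B}

/-! ### Generators of the polar and the biideal property -/

theorem elt_sub_elt_mem_polar (hinv : Function.Involutive inv) {n : ℕ} {α β : Wr B n}
    (h : insertionRows α = insertionRows β) :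
    elt K α - elt K β ∈ polar inv (coplactic K B) := by
  rw [polar_coplactic hinv]
  exact single_sub_single_mem_ker _ (insertionKey_eq_iff.2 h)

/-- Knuth's theorem gives a chain of moves from one word to the other, and the difference telescopes
along it. -/
theorem elt_sub_elt_mem_span {n : ℕ} {α β : Wr B n} (h : insertionRows α = insertionRows β) :
    elt K α - elt K β ∈ Submodule.span K {x | ∃ α α' : Wr B n, Knuth (word α) (word α') ∧
      x = elt K α - elt K α'} := by
  have key : ∀ w, KnuthEquiv (word α) w → ∃ β : Wr B n, w = word β ∧ elt K α - elt K β ∈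
      Submodule.span K {x | ∃ α α' : Wr B n, Knuth (word α) (word α') ∧
        x = elt K α - elt K α'} := by
    intro w hw
    induction hw with
    | refl => exact ⟨α, rfl, by simp⟩
    | @tail u v _ huv ih =>
      obtain ⟨β, rfl, hβ⟩ := ih
      obtain ⟨γ, rfl⟩ := word_perm_iff.2
        ((huv.perm.symm.map Prod.fst).trans (word_perm_iff.1 ⟨β, rfl⟩))
      refine ⟨γ, rfl, ?_⟩
      rw [← sub_add_sub_cancel _ (elt K β)]
      exact add_mem hβ (Submodule.subset_span ⟨β, γ, huv, rfl⟩)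
  obtain ⟨γ, h1, h2⟩ := key _ (knuthEquiv_word h)
  rwa [word_injective h1]

theorem polar_inf_degreePart (hinv : Function.Involutive inv) (n : ℕ) :
    polar inv (coplactic K B) ⊓ degreePart K B n =
      Submodule.span K {x | ∃ α α' : Wr B n, Knuth (word α) (word α') ∧
        x = elt K α - elt K α'} := by
  apply le_antisymm
  · rintro x ⟨hx, hn⟩
    rw [SetLike.mem_coe, polar_coplactic hinv, LinearMap.mem_ker, Finsupp.lmapDomain_apply] at hx
    refine Submodule.span_le.2 ?_ (mem_span_of_mapDomain_eq_zero _ hx)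
    rintro _ ⟨⟨m, α⟩, hs, ⟨m', β⟩, h, rfl⟩
    -- One element of each difference lies in the support of `x`, so it has degree `n`; equal
    -- insertion tableaux force the other to have the same degree.
    obtain rfl : m = n := (Finsupp.mem_supported K x).1 hn hs
    obtain rfl : m = m' := fst_eq_of_insertionKey_eq h
    exact elt_sub_elt_mem_span (insertionKey_eq_iff.1 h)
  · refine Submodule.span_le.2 ?_
    rintro _ ⟨α, β, h, rfl⟩
    exact ⟨elt_sub_elt_mem_polar hinv h.insertionRows_eq,
      sub_mem (elt_mem_degreePart α) (elt_mem_degreePart β)⟩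

theorem polar_eq_span (hinv : Function.Involutive inv) :
    polar inv (coplactic K B) = Submodule.span K
      {x | ∃ (n : ℕ) (α α' : Wr B n), Knuth (word α) (word α') ∧ x = elt K α - elt K α'} := by
  apply le_antisymm
  · intro x hx
    rw [polar_coplactic hinv, LinearMap.mem_ker, Finsupp.lmapDomain_apply] at hx
    refine Submodule.span_le.2 ?_ (mem_span_of_mapDomain_eq_zero _ hx)
    rintro _ ⟨⟨m, α⟩, hs, ⟨m', β⟩, h, rfl⟩
    obtain rfl : m = m' := fst_eq_of_insertionKey_eq h
    refine Submodule.span_mono ?_ (elt_sub_elt_mem_span (insertionKey_eq_iff.1 h))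
    rintro _ ⟨α, β, h, rfl⟩
    exact ⟨m, α, β, h, rfl⟩
  · refine Submodule.span_le.2 ?_
    rintro _ ⟨n, α, β, h, rfl⟩
    exact elt_sub_elt_mem_polar hinv h.insertionRows_eq

theorem sum_sub_sum_mem {M ι : Type*} [AddCommGroup M] [Module K M] [Fintype ι]
    {J : Submodule K M} {f g : ι → M} (h : ∀ i, f i - g i ∈ J) : ∑ i, f i - ∑ i, g i ∈ J := by
  rw [← Finset.sum_sub_distrib]
  exact sum_mem fun i _ => h i

theorem isGradedBiideal_polar (hinv : Function.Involutive inv) :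
    IsGradedBiideal (polar inv (coplactic K B)) where
  graded := by
    rw [polar_eq_span hinv]
    refine isGraded_span ?_
    rintro _ ⟨n, α, β, -, rfl⟩
    exact ⟨n, sub_mem (elt_mem_degreePart α) (elt_mem_degreePart β)⟩
  mul_mem_left x y hy := by
    induction x using Finsupp.induction_linear with
    | zero => simp
    | add x x' hx hx' => rw [map_add, LinearMap.add_apply]; exact add_mem hx hx'
    | single s a =>
      rw [single_eq_smul_elt, map_smul, LinearMap.smul_apply]
      refine Submodule.smul_mem _ _ ?_
      have h : polar inv (coplactic K B) ≤
          (polar inv (coplactic K B)).comap (extMul K B (elt K s.2)) := by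
        conv_lhs => rw [polar_eq_span hinv]
        refine Submodule.span_le.2 ?_
        rintro _ ⟨n, α, β, h, rfl⟩
        rw [SetLike.mem_coe, Submodule.mem_comap, map_sub, extMul_elt, extMul_elt,
          ← Finset.sum_sub_distrib]
        exact sum_mem fun ρ hρ =>
          elt_sub_elt_mem_polar hinv (h.leftAct_concat_right hρ s.2).insertionRows_eq
      exact h hy
  mul_mem_right x hx y := by
    induction y using Finsupp.induction_linear with
    | zero => simp
    | add y y' hy hy' => rw [map_add]; exact add_mem hy hy'
    | single s a =>
      rw [single_eq_smul_elt, map_smul]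
      refine Submodule.smul_mem _ _ ?_
      have h : polar inv (coplactic K B) ≤
          (polar inv (coplactic K B)).comap ((extMul K B).flip (elt K s.2)) := by
        conv_lhs => rw [polar_eq_span hinv]
        refine Submodule.span_le.2 ?_
        rintro _ ⟨n, α, β, h, rfl⟩
        rw [SetLike.mem_coe, Submodule.mem_comap, map_sub, LinearMap.flip_apply,
          LinearMap.flip_apply, extMul_elt, extMul_elt, ← Finset.sum_sub_distrib]
        exact sum_mem fun ρ hρ =>
          elt_sub_elt_mem_polar hinv (h.leftAct_concat_left hρ s.2).insertionRows_eq
      exact h hx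
  comul_mem := by
    set I := polar inv (coplactic K B) with hI
    set J := LinearMap.range (TensorProduct.map I.subtype (LinearMap.id : Free K B →ₗ[K] Free K B)) ⊔
      LinearMap.range (TensorProduct.map (LinearMap.id : Free K B →ₗ[K] Free K B) I.subtype)
    have hl : ∀ x ∈ I, ∀ y : Free K B, x ⊗ₜ[K] y ∈ J := fun x hx y =>
      Submodule.mem_sup_left ⟨⟨x, hx⟩ ⊗ₜ y, by simp⟩
    have hr : ∀ x : Free K B, ∀ y ∈ I, x ⊗ₜ[K] y ∈ J := fun x y hy =>
      Submodule.mem_sup_right ⟨x ⊗ₜ ⟨y, hy⟩, by simp⟩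
    suffices h : I ≤ J.comap (comul K B) from fun x hx => h hx
    conv_lhs => rw [hI, polar_eq_span hinv]
    refine Submodule.span_le.2 ?_
    rintro _ ⟨n, α, β, h, rfl⟩
    rw [SetLike.mem_coe, Submodule.mem_comap, map_sub, comul_elt, comul_elt]
    refine sum_sub_sum_mem (f := fun k => elt K (headPart α k) ⊗ₜ[K] elt K (tailPart α k))
      (g := fun k => elt K (headPart β k) ⊗ₜ[K] elt K (tailPart β k)) fun k => ?_
    have h1 : elt K (headPart α k) - elt K (headPart β k) ∈ I := by
      rcases h.headPart k with h | h
      · rw [h, sub_self]; exact zero_mem _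
      · exact elt_sub_elt_mem_polar hinv h.insertionRows_eq
    have h2 : elt K (tailPart α k) - elt K (tailPart β k) ∈ I := by
      rcases h.tailPart k with h | h
      · rw [h, sub_self]; exact zero_mem _
      · exact elt_sub_elt_mem_polar hinv h.insertionRows_eq
    -- The telescoping $a\otimes b-a'\otimes b'=(a-a')\otimes b+a'\otimes(b-b')$.
    have h3 := add_mem (hl _ h1 (elt K (tailPart α k))) (hr (elt K (headPart β k)) _ h2)
    rwa [TensorProduct.sub_tmul, TensorProduct.tmul_sub, sub_add_sub_cancel] at h3
  counit_eq_zero := by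
    suffices h : polar inv (coplactic K B) ≤ LinearMap.ker (counit K B) from
      fun x hx => LinearMap.mem_ker.1 (h hx)
    rw [polar_eq_span hinv]
    refine Submodule.span_le.2 ?_
    rintro _ ⟨n, α, β, -, rfl⟩
    rw [SetLike.mem_coe, LinearMap.mem_ker, map_sub]
    cases n with
    -- There is only one basis element in degree `0`, so no nonzero difference meets the counit.
    | zero => rw [Subsingleton.elim α β, sub_self]
    | succ n => simp [counit, elt]

theorem range_map_subtype_of_range_le {M : Type*} [AddCommGroup M] [Module K M]
    {Q : Submodule K M} {e : M →ₗ[K] M} (he : ∀ x, e x ∈ Q) (z : M ⊗[K] M) :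
    TensorProduct.map e e z ∈ LinearMap.range (TensorProduct.map Q.subtype Q.subtype) := by
  refine ⟨TensorProduct.map (e.codRestrict Q he) (e.codRestrict Q he) z, ?_⟩
  rw [← LinearMap.comp_apply, ← TensorProduct.map_comp, LinearMap.subtype_comp_codRestrict]

/-- Constancy in each variable suffices because there is a linear projector onto the coplactic
submodule: read the coefficient at one representative of each fiber and spread it over the fiber.
Its tensor square fixes such a `z`. -/
theorem mem_range_map_coplactic {z : Free K B ⊗[K] Free K B}
    (h : ∀ s s' t t', recordKey s = recordKey s' → recordKey t = recordKey t' →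
      finsuppTensorFinsupp' K (Σ n, Wr B n) (Σ n, Wr B n) z (s, t) =
        finsuppTensorFinsupp' K (Σ n, Wr B n) (Σ n, Wr B n) z (s', t')) :
    z ∈ LinearMap.range (TensorProduct.map (coplactic K B).subtype (coplactic K B).subtype) := by
  have hsurj := (isPairing_keys (B := B)).surjective
  have hr := Function.rightInverse_surjInv hsurj
  let e : Free K B →ₗ[K] Free K B := fiberSums K finite_recordKey_fiber ∘ₗ
    Finsupp.lcomapDomain (Function.surjInv hsurj) hr.injective
  have he : ∀ x s, e x s = x (Function.surjInv hsurj (recordKey s)) := fun x s =>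
    fiberSums_apply _ _ _
  have heq : ∀ (z : Free K B ⊗[K] Free K B) s t,
      finsuppTensorFinsupp' K (Σ n, Wr B n) (Σ n, Wr B n) (TensorProduct.map e e z) (s, t) =
        finsuppTensorFinsupp' K (Σ n, Wr B n) (Σ n, Wr B n) z
          (Function.surjInv hsurj (recordKey s), Function.surjInv hsurj (recordKey t)) := by
    intro z s t
    induction z using TensorProduct.induction_on with
    | zero => simp
    | tmul x y => simp [he]
    | add x y hx hy => simp only [map_add, Finsupp.add_apply, hx, hy]
  have hz : TensorProduct.map e e z = z := by
    refine (finsuppTensorFinsupp' K (Σ n, Wr B n) (Σ n, Wr B n)).injective (Finsupp.ext ?_)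
    rintro ⟨s, t⟩
    rw [heq]
    exact h _ _ _ _ (hr _) (hr _)
  rw [← hz]
  refine range_map_subtype_of_range_le (fun x => ?_) z
  rw [coplactic_eq]
  exact ⟨_, rfl⟩

/-- The biideal property of the polar, transposed: coefficients are pairings with dual basis
elements, and basis elements with equal record tableaux have duals that differ by an element of the
polar. -/
theorem isGradedSubbialgebra_coplactic (hinv : Function.Involutive inv) :
    IsGradedSubbialgebra (coplactic K B) where
  graded := by
    refine isGraded_span ?_
    rintro _ ⟨T, -, rfl⟩
    exact ⟨T.size, sum_mem fun α _ => elt_mem_degreePart α⟩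
  one_mem := by
    classical
    refine mem_coplactic_iff.2 fun s s' h => ?_
    have h1 : ∀ s : Σ n, Wr B n, one K B s = if s.1 = 0 then 1 else 0 := by
      rintro ⟨n, α⟩
      rw [one, elt, Finsupp.single_apply]
      refine if_congr ⟨fun h => (congrArg Sigma.fst h).symm, fun h => ?_⟩ rfl rfl
      obtain rfl : n = 0 := h
      exact Sigma.ext rfl (heq_of_eq (Subsingleton.elim _ _))
    rw [h1, h1, fst_eq_of_recordKey_eq h]
  mul_mem x hx y hy := by
    refine mem_coplactic_iff.2 fun s s' h => ?_
    have hs : ∀ (s : Σ n, Wr B n) (x : Free K B),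
        x s = pairing K inv (Finsupp.single (sigmaDual inv s) 1) x := fun s x => by
      rw [pairing_single, sigmaDual_sigmaDual hinv, one_mul]
    have hI : Finsupp.single (sigmaDual inv s) (1 : K) - Finsupp.single (sigmaDual inv s') 1 ∈
        polar inv (coplactic K B) := by
      rw [polar_coplactic hinv]
      refine single_sub_single_mem_ker _ ?_
      rw [insertionKey_sigmaDual hinv, insertionKey_sigmaDual hinv, h]
    have hzero : ∀ z ∈ LinearMap.range (TensorProduct.map (polar inv (coplactic K B)).subtype
          (LinearMap.id : Free K B →ₗ[K] Free K B)) ⊔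
        LinearMap.range (TensorProduct.map (LinearMap.id : Free K B →ₗ[K] Free K B)
          (polar inv (coplactic K B)).subtype), pairing₂ inv x y z = 0 := by
      suffices h : _ ≤ LinearMap.ker (pairing₂ inv x y) from fun z hz => LinearMap.mem_ker.1 (h hz)
      refine sup_le ?_ ?_
      · rintro _ ⟨z, rfl⟩
        rw [LinearMap.mem_ker]
        induction z using TensorProduct.induction_on with
        | zero => simp
        | tmul u v =>
          rw [TensorProduct.map_tmul, pairing₂_tmul, Submodule.subtype_apply, u.2 x hx, zero_mul]
        | add u v hu hv => rw [map_add, map_add, hu, hv, add_zero]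
      · rintro _ ⟨z, rfl⟩
        rw [LinearMap.mem_ker]
        induction z using TensorProduct.induction_on with
        | zero => simp
        | tmul u v =>
          rw [TensorProduct.map_tmul, pairing₂_tmul, Submodule.subtype_apply, v.2 y hy, mul_zero]
        | add u v hu hv => rw [map_add, map_add, hu, hv, add_zero]
    -- By adjunction, the coideal property makes the coefficients of the product at `s` and `s'`
    -- equal.
    have h1 := hzero _ ((isGradedBiideal_polar hinv).comul_mem _ hI)
    rw [← pairing_extMul, map_sub, LinearMap.sub_apply, ← hs, ← hs] at h1
    exact sub_eq_zero.1 h1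
  comul_mem x hx := by
    have hs : ∀ (s t : Σ n, Wr B n) (z : Free K B ⊗[K] Free K B),
        finsuppTensorFinsupp' K (Σ n, Wr B n) (Σ n, Wr B n) z (s, t) =
          pairing₂ inv (Finsupp.single (sigmaDual inv s) 1) (Finsupp.single (sigmaDual inv t) 1)
            z := by
      intro s t z
      induction z using TensorProduct.induction_on with
      | zero => simp
      | tmul u v =>
        rw [pairing₂_tmul, pairing_comm hinv, pairing_single, pairing_comm hinv, pairing_single]
        simp [sigmaDual_sigmaDual hinv]
      | add u v hu hv => rw [map_add, map_add, Finsupp.add_apply, hu, hv]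
    have hI : ∀ s s' : Σ n, Wr B n, recordKey s = recordKey s' →
        Finsupp.single (sigmaDual inv s) (1 : K) - Finsupp.single (sigmaDual inv s') 1 ∈
          polar inv (coplactic K B) := by
      intro s s' h
      rw [polar_coplactic hinv]
      refine single_sub_single_mem_ker _ ?_
      rw [insertionKey_sigmaDual hinv, insertionKey_sigmaDual hinv, h]
    have hzero : ∀ z ∈ polar inv (coplactic K B), pairing K inv x z = 0 := fun z hz => by
      rw [pairing_comm hinv]; exact hz x hx
    refine mem_range_map_coplactic fun s s' t t' h h' => ?_
    have hb := isGradedBiideal_polar (K := K) hinv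
    -- The two coefficients of the coproduct are pairings of `x` with products of dual basis
    -- elements; the ideal property puts the difference of these products in the polar, one factor
    -- being changed at a time.
    rw [hs, hs, ← pairing_extMul, ← pairing_extMul, ← sub_eq_zero, ← map_sub]
    refine hzero _ ?_
    have h1 := hb.mul_mem_right _ (hI s s' h) (Finsupp.single (sigmaDual inv t) 1)
    have h2 := hb.mul_mem_left (Finsupp.single (sigmaDual inv s') 1) _ (hI t t' h')
    rw [map_sub, LinearMap.sub_apply] at h1
    rw [map_sub] at h2
    simpa using add_mem h1 h2

theorem coplactic_inf_polar (hinv : Function.Involutive inv) :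
    coplactic K B ⊓ polar inv (coplactic K B) =
      Submodule.span K {x | ∃ T T' : BTableau B, T.IsStandard ∧ T'.IsStandard ∧
        T.shape = T'.shape ∧ x = coplacticClass K T - coplacticClass K T'} := by
  rw [polar_coplactic hinv, coplactic_eq, isPairing_keys.range_inf_ker]
  congr 1
  ext x
  constructor
  · rintro ⟨⟨⟨n, R⟩, hR⟩, ⟨⟨n', R'⟩, hR'⟩, h, rfl⟩
    obtain ⟨T, hT, rfl, rfl⟩ := exists_isStandard_rows_eq hR
    obtain ⟨T', hT', rfl, rfl⟩ := exists_isStandard_rows_eq hR'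
    refine ⟨T, T', hT, hT', shape_eq_iff.2 (congrFun (Prod.mk.inj h).2), ?_⟩
    rw [coplacticClass_eq K hT, coplacticClass_eq K hT']
  · rintro ⟨T, T', hT, hT', h, rfl⟩
    refine ⟨_, _, ?_, by rw [coplacticClass_eq K hT, coplacticClass_eq K hT']⟩
    exact Prod.ext (by simp [shapeKey, BTableau.size, h]) (funext (shape_eq_iff.1 h))

end Bialgebra

end FQ

theorem mainTheorem12 {K : Type*} [CommRing K] {B : Type*} [Fintype B] [DecidableEq B]
    (inv : B → B) (hinv : Function.Involutive inv) :
    (∀ n : ℕ, FQ.polar inv (FQ.coplactic K B) ⊓ FQ.degreePart K B n =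
      Submodule.span K {x | ∃ α α' : FQ.Wr B n, FQ.Knuth (FQ.word α) (FQ.word α') ∧
        x = FQ.elt K α - FQ.elt K α'}) ∧
    FQ.IsGradedSubbialgebra (FQ.coplactic K B) ∧
    FQ.IsGradedBiideal (FQ.polar inv (FQ.coplactic K B)) ∧
    FQ.coplactic K B ⊓ FQ.polar inv (FQ.coplactic K B) =
      Submodule.span K {x | ∃ T T' : FQ.BTableau B, T.IsStandard ∧ T'.IsStandard ∧
        T.shape = T'.shape ∧ x = FQ.coplacticClass K T - FQ.coplacticClass K T'} ∧
    ∃ C : Submodule K (FQ.Free K B),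
      IsCompl (FQ.coplactic K B ⊔ FQ.polar inv (FQ.coplactic K B)) C := by
  refine ⟨FQ.polar_inf_degreePart hinv, FQ.isGradedSubbialgebra_coplactic hinv,
    FQ.isGradedBiideal_polar hinv, FQ.coplactic_inf_polar hinv, ?_⟩
  rw [FQ.polar_coplactic hinv, FQ.coplactic_eq]
  exact FQ.isPairing_keys.exists_isCompl _
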